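/- **Setting.** Let $p:\mathbb R^n\to\mathbb R\cup\{+\infty\}$, $q:\mathbb R^m\to\mathbb R\cup\{+\infty\}$ be proper closed convex functions with compact domains $\mathcal X=\mathrm{dom}\,p$, $\mathcal Y=\mathrm{dom}\,q$, and let $h:\mathbb R^n\times\mathbb R^m\to\mathbb R$, $L>0$, $\sigma_y>0$, $U\supseteq\mathcal X$, $V\supseteq\mathcal Y$ with $V$ convex, be such that $h$ is differentiable at the points of $U\times V$ with $\|\nabla h(z)-\nabla h(z')\|\le L\|z-z'\|$ for $z,z'\in U\times V$, and $h(x,\cdot)$ is $\sigma_y$-strongly concave on $V$ for every $x\in\mathcal X$. Put $H(x,y)=h(x,y)+p(x)-q(y)$, $H^*=\min_x\max_yH(x,y)$, $H_{\rm low}=\inf_{\mathcal X\times\mathcal Y}H$, $D_x=\mathrm{diam}\,\mathcal X$, $D_y=\mathrm{diam}\,\mathcal Y$, and $\mathrm{prox}_{\gamma p}(x)=\arg\min_u\{\frac12\|u-x\|^2+\gamma p(u)\}$. For lower semicontinuous $\phi$ and $x\in\mathrm{dom}\,\phi$, $\partial\phi(x)$ is the set of $s$ with $\langle s,d\rangle\le\limsup_{x'\to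 x,\ \phi(x')\to\phi(x),\ t\downarrow0}\ \inf_{d'\to d}(\phi(x'+td')-\phi(x'))/t$ for all $d$; for upper semicontinuous $\phi$, $\partial\phi=-\partial(-\phi)$. A point $(x,y)$ is an $\epsilon$-primal-dual stationary point of $\min_x\max_y H$ if $\mathrm{dist}(0,\partial_xH(x,y))\le\epsilon$ and $\mathrm{dist}(0,\partial_yH(x,y))\le\epsilon$. **Inner method**, for $\min_x\max_y\{\bar h(x,y)+p(x)-q(y)\}$, with parameters $\sigma_x,\sigma_y,\bar L,\bar\epsilon>0$ and input $(z^0,y^0)=(z^0_f,y^0_f)$. Put $\bar\alpha=\min\{1,\sqrt{8\sigma_y/\sigma_x}\}$, $\eta_z=\sigma_x/2$, $\eta_y=\min\{1/(2\sigma_y),4/(\bar\alpha\sigma_x)\}$, $\beta_t=2/(t+3)$, $\zeta=(2\sqrt5(1+8\bar L/\sigma_x))^{-1}$, $\gamma=8/\sigma_x$, $\bar\zeta=\min\{\sigma_x,\sigma_y\}/\bar L^2$, $\hat h(x,y)=\bar h(x,y)-\frac{\sigma_x}2\|x\|^2+\frac{\sigma_y}2\|y\|^2$. For $k=0,1,2,\dots$: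 1. $(z_g,y_g)=\bar\alpha(z^k,y^k)+(1-\bar\alpha)(z^k_f,y^k_f)$, $(x^{-1},y^{-1})=(-\sigma_x^{-1}z_g,y_g)$. Write $a_x(x,y)=\nabla_x\hat h(x,y)+\frac{\sigma_x}2(x-\sigma_x^{-1}z_g)$ and $a_y(x,y)=-\nabla_y\hat h(x,y)+\sigma_yy+\frac{\sigma_x}8(y-y_g)$. With $u=x^{-1}-\zeta\gamma a_x(x^{-1},y^{-1})$, $w=y^{-1}-\zeta\gamma a_y(x^{-1},y^{-1})$ set $x^0=\mathrm{prox}_{\zeta\gamma p}(u)$, $y^0=\mathrm{prox}_{\zeta\gamma q}(w)$, $b_x^0=(u-x^0)/(\zeta\gamma)$, $b_y^0=(w-y^0)/(\zeta\gamma)$, $t=0$. 2. While $\gamma\|a_x(x^t,y^t)+b_x^t\|^2+\gamma\|a_y(x^t,y^t)+b_y^t\|^2>\gamma^{-1}\|x^t-x^{-1}\|^2+\gamma^{-1}\|y^t-y^{-1}\|^2$: let $c_x=x^t+\beta_t(x^0-x^t)$, $c_y=y^t+\beta_t(y^0-y^t)$, $x^{t+1/2}=c_x-\zeta\gamma(a_x(x^t,y^t)+b^t_x)$,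 $y^{t+1/2}=c_y-\zeta\gamma(a_y(x^t,y^t)+b^t_y)$, $u=c_x-\zeta\gamma a_x(x^{t+1/2},y^{t+1/2})$, $w=c_y-\zeta\gamma a_y(x^{t+1/2},y^{t+1/2})$, $x^{t+1}=\mathrm{prox}_{\zeta\gamma p}(u)$, $y^{t+1}=\mathrm{prox}_{\zeta\gamma q}(w)$, $b^{t+1}_x=(u-x^{t+1})/(\zeta\gamma)$, $b^{t+1}_y=(w-y^{t+1})/(\zeta\gamma)$, and increase $t$ by one. 3. $(x_f^{k+1},y^{k+1}_f)=(x^t,y^t)$, $z^{k+1}_f=\nabla_x\hat h(x^{k+1}_f,y^{k+1}_f)+b^t_x$, $w_f=-\nabla_y\hat h(x^{k+1}_f,y^{k+1}_f)+b^t_y$, $z^{k+1}=z^k+\eta_z\sigma_x^{-1}(z^{k+1}_f-z^k)-\eta_z(x^{k+1}_f+\sigma_x^{-1}z^{k+1}_f)$, $y^{k+1}=y^k+\eta_y\sigma_y(y^{k+1}_f-y^k)-\eta_y(w_f+\sigma_yy^{k+1}_f)$, $x^{k+1}=-\sigma_x^{-1}z^{k+1}$, $\tilde x=\mathrm{prox}_{\bar\zeta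 p}(x^{k+1}-\bar\zeta\nabla_x\bar h(x^{k+1},y^{k+1}))$, $\tilde y=\mathrm{prox}_{\bar\zeta q}(y^{k+1}+\bar\zeta\nabla_y\bar h(x^{k+1},y^{k+1}))$. Stop with output $(\tilde x,\tilde y)$ if $\|\bar\zeta^{-1}(x^{k+1}-\tilde x,\tilde y-y^{k+1})-(\nabla\bar h(x^{k+1},y^{k+1})-\nabla\bar h(\tilde x,\tilde y))\|\le\bar\epsilon$. **Inexact proximal point method.** Let $\epsilon>0$, $\hat\epsilon_0\in(0,\epsilon/2]$, $(x^0,y^0)=(\hat x^0,\hat y^0)\in\mathcal X\times\mathcal Y$. For $k=0,1,2,\dots$: let $(x^{k+1},y^{k+1})$ be the output of the inner method for $\bar h(x,y)=h(x,y)+L\|x-x^k\|^2$ with $\sigma_x=L$, the given $\sigma_y$, $\bar L=3L$, $\bar\epsilon=\hat\epsilon_0/(k+1)$ and input $z^0=z^0_f=-Lx^k$, $y^0=y^0_f=y^k$; terminate with output $(x_\epsilon,y_\epsilon)=(x^{k+1},y^{k+1})$ if $\|x^{k+1}-x^k\|\le\epsilon/(4L)$. Assume that every point at which this method evaluates $\nabla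 h$ lies in $U\times V$ (which is no condition if $U=\mathbb R^n$, $V=\mathbb R^m$). **Theorem.** Put $\hat\alpha=\min\{1,\sqrt{8\sigma_y/L}\}$, $\hat\delta=(2+\hat\alpha^{-1})LD_x^2+\max\{2\sigma_y,\hat\alpha L/4\}D_y^2$, $$\widehat T=\Big\lceil16\big(\max_yH(\hat x^0,y)-H^*\big)L\epsilon^{-2}+32\hat\epsilon_0^2(1+\sigma_y^{-2}L^2)\epsilon^{-2}-1\Big\rceil_+,$$ $$\widehat N=3397\max\Big\{2,\sqrt{\tfrac{L}{2\sigma_y}}\Big\}\Big[(\widehat T+1)\Big(\log\frac{4\max\{\frac1{2L},\min\{\frac1{2\sigma_y},\frac4{\hat\alpha L}\}\}\big(\hat\delta+2\hat\alpha^{-1}(H^*-H_{\rm low}+LD_x^2)\big)}{(9L^2/\min\{L,\sigma_y\}+3L)^{-2}\hat\epsilon_0^2}\Big)_++\widehat T+1+2\widehat T\log(\widehat T+1)\Big].$$ Then the method terminates after at most $\widehat T+1$ outer iterations, and its output is an $\epsilon$-primal-dual stationary point $(x_\epsilon,y_\epsilon)$ of $\min_x\max_yH(x,y)$ with $$\max_yH(x_\epsilon,y)\le\max_yH(\hat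 x^0,y)+2\hat\epsilon_0^2\,(L^{-1}+\sigma_y^{-2}L).$$ Moreover, if $H_{\rm low}>-\infty$ (as is the case when $q$ is continuous on $\mathcal Y$), the total number of evaluations of $\nabla h$, that of the proximal operators of $p$ and that of the proximal operators of $q$ are each at most $\widehat N$. -/

import Mathlib

open scoped Topology

noncomputable section MinimaxDefs

/-! ### Extended-valued functions, subdifferentials, stationarity -/

section Basics

variable {E F : Type*} [NormedAddCommGroup E] [InnerProductSpace ℝ E]
  [NormedAddCommGroup F] [InnerProductSpace ℝ F]

/-- The effective domain of an extended-real-valued function. -/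
def effDom (φ : E → EReal) : Set E := {x | φ x < ⊤}

/-- Proper closed convex functions with values in `ℝ ∪ {+∞}`
(convexity is convexity of the epigraph, closedness is lower semicontinuity). -/
structure IsProperClosedConvex (φ : E → EReal) : Prop where
  ne_bot : ∀ x, φ x ≠ ⊥
  nonempty_dom : (effDom φ).Nonempty
  convex_epigraph : Convex ℝ {z : E × ℝ | φ z.1 ≤ (z.2 : EReal)}
  lsc : LowerSemicontinuous φ

/-- `prox φ γ x` is the proximal point `argmin_u { ‖u - x‖² / 2 + γ φ(u) }`, that is, the value at
`x` of the proximal operator of `γ φ`. -/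
def prox (φ : E → EReal) (γ : ℝ) (x : E) : E :=
  Classical.epsilon fun u => ∀ v,
    ((‖u - x‖ ^ 2 / 2 : ℝ) : EReal) + (γ : EReal) * φ u ≤
      ((‖v - x‖ ^ 2 / 2 : ℝ) : EReal) + (γ : EReal) * φ v

/-- The upper subderivative
`φ'(x; d) = limsup_{x' → x, φ(x') → φ(x), t ↓ 0} inf_{d' → d} (φ(x' + t d') - φ(x')) / t`,
where `limsup inf_{d' → d}` stands for the supremum over `r > 0` of the upper limit of the infimum
over the ball of radius `r` around `d`. -/
def upperSubderiv (φ : E → EReal) (x d : E) : EReal :=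
  ⨆ (r : ℝ) (_ : 0 < r),
    Filter.limsup
      (fun z : E × ℝ => ⨅ d' ∈ Metric.ball d r, (φ (z.1 + z.2 • d') - φ z.1) / (z.2 : EReal))
      ((𝓝 x ⊓ Filter.comap φ (𝓝 (φ x))) ×ˢ 𝓝[>] (0 : ℝ))

/-- The subdifferential of a lower semicontinuous function (empty outside the domain). -/
def subdiff (φ : E → EReal) (x : E) : Set E :=
  {s | x ∈ effDom φ ∧ ∀ d, ((inner ℝ s d : ℝ) : EReal) ≤ upperSubderiv φ x d}

/-- The subdifferential `-∂(-φ)` of an upper semicontinuous function `φ`. -/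
def superdiff (φ : E → EReal) (x : E) : Set E :=
  {s | -s ∈ subdiff (fun u => -φ u) x}

/-- `(x, y)` is an `ε`-primal-dual stationary point of `min_x max_y Ψ(x, y)`
(the distance to the empty set is `+∞`). -/
def IsPDStationary (Ψ : E → F → EReal) (ε : ℝ) (x : E) (y : F) : Prop :=
  Metric.infEDist 0 (subdiff (fun x' => Ψ x' y) x) ≤ ENNReal.ofReal ε ∧
    Metric.infEDist 0 (superdiff (fun y' => Ψ x y') y) ≤ ENNReal.ofReal ε

variable [CompleteSpace E] [CompleteSpace F]

/-- `h` is `L`-smooth on `S`: differentiable at the points of `S`, with `L`-Lipschitz gradient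
on `S`. The product `E × F` carries its Euclidean norm. -/
def SmoothOn (h : WithLp 2 (E × F) → ℝ) (L : ℝ) (S : Set (WithLp 2 (E × F))) : Prop :=
  (∀ z ∈ S, DifferentiableAt ℝ h z) ∧
    ∀ z ∈ S, ∀ w ∈ S, ‖gradient h z - gradient h w‖ ≤ L * ‖z - w‖

end Basics

/-! ### The minimax problem -/

section Problem

variable {E F : Type*}

/-- The objective `H(x, y) = h(x, y) + p(x) - q(y)`, with `+∞` for `x ∉ dom p`, `y ∈ dom q` and
`-∞` for `y ∉ dom q`. -/
def objH (h : WithLp 2 (E × F) → ℝ) (p : E → EReal) (q : F → EReal) (x : E) (y : F) : EReal :=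
  (h (WithLp.toLp 2 (x, y)) : EReal) + p x - q y

/-- `max_y H(x, y)`. -/
def maxH (h : WithLp 2 (E × F) → ℝ) (p : E → EReal) (q : F → EReal) (x : E) : EReal :=
  ⨆ y, objH h p q x y

/-- `H* = min_x max_y H(x, y)`. -/
def optH (h : WithLp 2 (E × F) → ℝ) (p : E → EReal) (q : F → EReal) : EReal :=
  ⨅ x, maxH h p q x

variable [NormedAddCommGroup E] [InnerProductSpace ℝ E]
  [NormedAddCommGroup F] [InnerProductSpace ℝ F]

/-- `H_low`, the infimum of `H` on `dom p × dom q`. -/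
def lowH (h : WithLp 2 (E × F) → ℝ) (p : E → EReal) (q : F → EReal) : EReal :=
  ⨅ x ∈ effDom p, ⨅ y ∈ effDom q, objH h p q x y

end Problem

/-! ### The algorithms, as step-by-step machines with a record of their oracle calls -/

section Algorithms

variable {E F : Type*} [NormedAddCommGroup E] [InnerProductSpace ℝ E]
  [NormedAddCommGroup F] [InnerProductSpace ℝ F]

/-- The oracle calls made so far: the list of the points at which the gradient was evaluated and
the numbers of evaluations of the proximal operators of `p` and of `q`. -/
structure Ledger (E F : Type*) where
  grads : List (WithLp 2 (E × F))
  proxP : ℕ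
  proxQ : ℕ

/-- No oracle calls. -/
def Ledger.empty : Ledger E F := ⟨[], 0, 0⟩

/-- Total of two records of oracle calls. -/
def Ledger.append (l l' : Ledger E F) : Ledger E F :=
  ⟨l.grads ++ l'.grads, l.proxP + l'.proxP, l.proxQ + l'.proxQ⟩

/-- The gradient and each of the two proximal operators were evaluated at most `N` times. -/
def Ledger.AtMost (l : Ledger E F) (N : ℝ) : Prop :=
  (l.grads.length : ℝ) ≤ N ∧ (l.proxP : ℝ) ≤ N ∧ (l.proxQ : ℝ) ≤ N

/-- The data of a call of the inner method, for
`min_x max_y { hbar(x, y) + p(x) - q(y) }` with tolerance `tol`. -/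
structure InnerData (E F : Type*) where
  hbar : WithLp 2 (E × F) → ℝ
  p : E → EReal
  q : F → EReal
  sx : ℝ
  sy : ℝ
  Lbar : ℝ
  tol : ℝ

namespace InnerData

variable (D : InnerData E F)

/-- `ᾱ = min {1, √(8 σ_y / σ_x)}` -/
def alpha : ℝ := min 1 (Real.sqrt (8 * D.sy / D.sx))

/-- `η_z = σ_x / 2` -/
def etaZ : ℝ := D.sx / 2

/-- `η_y = min {1 / (2 σ_y), 4 / (ᾱ σ_x)}` -/
def etaY : ℝ := min (1 / (2 * D.sy)) (4 / (D.alpha * D.sx))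

/-- `β_t = 2 / (t + 3)` -/
def beta (t : ℕ) : ℝ := 2 / ((t : ℝ) + 3)

/-- `ζ = (2 √5 (1 + 8 L / σ_x))⁻¹` -/
def zeta : ℝ := (2 * Real.sqrt 5 * (1 + 8 * D.Lbar / D.sx))⁻¹

/-- `γ_x = γ_y = 8 / σ_x` -/
def gam : ℝ := 8 / D.sx

/-- `ζ̄ = min {σ_x, σ_y} / L²` -/
def zetaBar : ℝ := min D.sx D.sy / D.Lbar ^ 2

variable [CompleteSpace E] [CompleteSpace F]

/-- `∇_x hbar(x, y)` -/
def gx (x : E) (y : F) : E := (gradient D.hbar (WithLp.toLp 2 (x, y))).fst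

/-- `∇_y hbar(x, y)` -/
def gy (x : E) (y : F) : F := (gradient D.hbar (WithLp.toLp 2 (x, y))).snd

/-- `∇_x ĥ(x, y)`, where `ĥ(x, y) = hbar(x, y) - σ_x ‖x‖² / 2 + σ_y ‖y‖² / 2` -/
def hatGx (x : E) (y : F) : E := D.gx x y - D.sx • x

/-- `∇_y ĥ(x, y)` -/
def hatGy (x : E) (y : F) : F := D.gy x y + D.sy • y

/-- `a_x^k(x, y) = ∇_x ĥ(x, y) + σ_x (x - σ_x⁻¹ z_g^k) / 2` -/
def ax (zg : E) (x : E) (y : F) : E :=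
  D.hatGx x y + (D.sx / 2) • (x - D.sx⁻¹ • zg)

/-- `a_y^k(x, y) = -∇_y ĥ(x, y) + σ_y y + σ_x (y - y_g^k) / 8` -/
def ay (yg : F) (x : E) (y : F) : F :=
  -D.hatGy x y + D.sy • y + (D.sx / 8) • (y - yg)

end InnerData

/-- The variables `z^k, y^k, z_f^k, y_f^k` at the head of the `for` loop of the inner method. -/
structure HeadVars (E F : Type*) where
  z : E
  y : F
  zf : E
  yf : F

/-- The variables of the `while` loop of the inner method at counter `t`: `z_g^k, y_g^k`, the anchor
`x^{k,0}, y^{k,0}` and the current `x^{k,t}, y^{k,t}, b_x^{k,t}, b_y^{k,t}`. -/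
structure LoopVars (E F : Type*) where
  zg : E
  yg : F
  x0 : E
  y0 : F
  t : ℕ
  x : E
  y : F
  bx : E
  by' : F

/-- The states of the inner method: head of the `for` loop, test of the `while` loop, output. -/
inductive InnerState (E F : Type*) where
  | head (v : HeadVars E F)
  | loop (v : HeadVars E F) (w : LoopVars E F)
  | done (x : E) (y : F)

namespace InnerData

variable (D : InnerData E F) [CompleteSpace E] [CompleteSpace F]

/-- From the head of the `for` loop to the first test of the `while` loop. -/
def enter (v : HeadVars E F) : InnerState E F × Ledger E F :=
  let zg := D.alpha • v.z + (1 - D.alpha) • v.zf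
  let yg := D.alpha • v.y + (1 - D.alpha) • v.yf
  let xm := -(D.sx⁻¹ • zg)
  let r := D.zeta * D.gam
  let u := xm - r • D.ax zg xm yg
  let w := yg - r • D.ay yg xm yg
  let x0 := prox D.p r u
  let y0 := prox D.q r w
  (.loop v
    { zg := zg, yg := yg, x0 := x0, y0 := y0, t := 0, x := x0, y := y0,
      bx := (1 / r) • (u - x0), by' := (1 / r) • (w - y0) },
    ⟨[WithLp.toLp 2 (xm, yg)], 1, 1⟩)

/-- The condition of the `while` loop. -/
def continues (w : LoopVars E F) : Prop :=
  D.gam * ‖D.ax w.zg w.x w.y + w.bx‖ ^ 2 + D.gam * ‖D.ay w.yg w.x w.y + w.by'‖ ^ 2 >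
    D.gam⁻¹ * ‖w.x - -(D.sx⁻¹ • w.zg)‖ ^ 2 + D.gam⁻¹ * ‖w.y - w.yg‖ ^ 2

/-- The body of the `while` loop; the gradient at `(x^{k,t}, y^{k,t})` is the one evaluated
for the test. -/
def body (w : LoopVars E F) : LoopVars E F × Ledger E F :=
  let r := D.zeta * D.gam
  let cx := w.x + beta w.t • (w.x0 - w.x)
  let cy := w.y + beta w.t • (w.y0 - w.y)
  let xh := cx - r • (D.ax w.zg w.x w.y + w.bx)
  let yh := cy - r • (D.ay w.yg w.x w.y + w.by')
  let u := cx - r • D.ax w.zg xh yh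
  let v := cy - r • D.ay w.yg xh yh
  let x1 := prox D.p r u
  let y1 := prox D.q r v
  ({ zg := w.zg, yg := w.yg, x0 := w.x0, y0 := w.y0, t := w.t + 1, x := x1, y := y1,
     bx := (1 / r) • (u - x1), by' := (1 / r) • (v - y1) },
    ⟨[WithLp.toLp 2 (xh, yh)], 1, 1⟩)

open Classical in
/-- From the exit of the `while` loop to the termination test of the `for` loop; the gradient at
`(x_f^{k+1}, y_f^{k+1})` is the one evaluated for the last test of the `while` loop. -/
def leave (v : HeadVars E F) (w : LoopVars E F) : InnerState E F × Ledger E F :=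
  let zf := D.hatGx w.x w.y + w.bx
  let wf := -D.hatGy w.x w.y + w.by'
  let z := v.z + (D.etaZ * D.sx⁻¹) • (zf - v.z) - D.etaZ • (w.x + D.sx⁻¹ • zf)
  let y := v.y + (D.etaY * D.sy) • (w.y - v.y) - D.etaY • (wf + D.sy • w.y)
  let x := -(D.sx⁻¹ • z)
  let xt := prox D.p D.zetaBar (x - D.zetaBar • D.gx x y)
  let yt := prox D.q D.zetaBar (y + D.zetaBar • D.gy x y)
  let res : WithLp 2 (E × F) :=
    D.zetaBar⁻¹ • WithLp.toLp 2 (x - xt, yt - y) -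
      (gradient D.hbar (WithLp.toLp 2 (x, y)) - gradient D.hbar (WithLp.toLp 2 (xt, yt)))
  (if ‖res‖ ≤ D.tol then .done xt yt else .head ⟨z, y, zf, w.y⟩,
    ⟨[WithLp.toLp 2 (x, y), WithLp.toLp 2 (xt, yt)], 1, 1⟩)

open Classical in
/-- One step of the inner method. -/
def step : InnerState E F → InnerState E F × Ledger E F
  | .head v => D.enter v
  | .loop v w =>
    let test : Ledger E F := ⟨[WithLp.toLp 2 (w.x, w.y)], 0, 0⟩
    if D.continues w then
      (.loop v (D.body w).1, test.append (D.body w).2)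
    else
      ((D.leave v w).1, test.append (D.leave v w).2)
  | .done x y => (.done x y, .empty)

end InnerData

/-- The data of the outer method: the problem, its constants `L`, `σ_y`, the tolerances `ε`, `ε̂_0`
and the starting point. -/
structure OuterData (E F : Type*) where
  h : WithLp 2 (E × F) → ℝ
  p : E → EReal
  q : F → EReal
  L : ℝ
  sy : ℝ
  eps : ℝ
  eps0 : ℝ
  x0 : E
  y0 : F

/-- The states of the outer method: inside iteration `k`, with current iterate `(x^k, y^k)` and the
state of the call of the inner method; or terminated with output `(x, y)` after `iters` outer
iterations. -/
inductive OuterState (E F : Type*) where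
  | running (k : ℕ) (x : E) (y : F) (s : InnerState E F)
  | terminated (iters : ℕ) (x : E) (y : F)

namespace OuterData

variable (A : OuterData E F)

/-- `h_k(x, y) = h(x, y) + L ‖x - x^k‖²` -/
def hk (xk : E) (z : WithLp 2 (E × F)) : ℝ := A.h z + A.L * ‖z.fst - xk‖ ^ 2

/-- The data of the call of the inner method at iteration `k`. -/
def call (k : ℕ) (xk : E) : InnerData E F where
  hbar := A.hk xk
  p := A.p
  q := A.q
  sx := A.L
  sy := A.sy
  Lbar := 3 * A.L
  tol := A.eps0 / ((k : ℝ) + 1)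

/-- The state at the beginning of iteration `k`. -/
def start (k : ℕ) (x : E) (y : F) : OuterState E F :=
  .running k x y (.head ⟨-(A.L • x), y, -(A.L • x), y⟩)

variable [CompleteSpace E] [CompleteSpace F]

open Classical in
/-- One step of the outer method. An evaluation of `∇h_k` is recorded as one of `∇h`. -/
def step : OuterState E F → OuterState E F × Ledger E F
  | .running k xk _ (.done x y) =>
    (if ‖x - xk‖ ≤ A.eps / (4 * A.L) then .terminated (k + 1) x y else A.start (k + 1) x y, .empty)
  | .running k xk yk s =>
    (.running k xk yk ((A.call k xk).step s).1, ((A.call k xk).step s).2)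
  | .terminated k x y => (.terminated k x y, .empty)

/-- State and oracle calls of the outer method after `n` steps. -/
def run : ℕ → OuterState E F × Ledger E F
  | 0 => (A.start 0 A.x0 A.y0, .empty)
  | n + 1 => ((A.step (run n).1).1, (run n).2.append (A.step (run n).1).2)

end OuterData

end Algorithms

/-! ### The constants of the complexity bound -/

section Constants

/-- `α̂ = min {1, √(8 σ_y / L)}` -/
def alphaHat (L sy : ℝ) : ℝ := min 1 (Real.sqrt (8 * sy / L))

/-- `δ̂ = (2 + α̂⁻¹) L D_x² + max {2 σ_y, α̂ L / 4} D_y²` -/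
def deltaHat (L sy Dx Dy : ℝ) : ℝ :=
  (2 + (alphaHat L sy)⁻¹) * L * Dx ^ 2 + max (2 * sy) (alphaHat L sy * L / 4) * Dy ^ 2

/-- `T̂`, for `M = max_y H(x̂⁰, y)` and `Hs = H*`; `⌈·⌉₊` is the nonnegative part of the ceiling. -/
def THat (L sy eps eps0 M Hs : ℝ) : ℕ :=
  ⌈16 * (M - Hs) * L / eps ^ 2 + 32 * eps0 ^ 2 * (1 + L ^ 2 / sy ^ 2) / eps ^ 2 - 1⌉₊

/-- `N̂`, for given `T = T̂`. -/
def NHat (L sy eps0 Dx Dy Hs Hlow : ℝ) (T : ℕ) : ℝ :=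
  3397 * max 2 (Real.sqrt (L / (2 * sy))) *
    (((T : ℝ) + 1) *
        max 0 (Real.log
          (4 * max (1 / (2 * L)) (min (1 / (2 * sy)) (4 / (alphaHat L sy * L))) *
              (deltaHat L sy Dx Dy + 2 * (alphaHat L sy)⁻¹ * (Hs - Hlow + L * Dx ^ 2)) /
            (((9 * L ^ 2 / min L sy + 3 * L) ^ 2)⁻¹ * eps0 ^ 2)))
      + (T : ℝ) + 1 + 2 * (T : ℝ) * Real.log ((T : ℝ) + 1))

end Constants

end MinimaxDefs

/-! Outer level. Since `h` is `L`-smooth, adding `L‖x - x^k‖²` makes the problem `L`-strongly convex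
in `x`, still `σ_y`-strongly concave in `y`, with `3L`-Lipschitz gradient. The inner stopping test
yields subgradients of `p` and `q` that satisfy the saddle conditions of this subproblem up to `ε̂_0
/ (k + 1)`. Two consequences follow. Strong convexity and concavity turn the residual into a
function-value error, so `max_y H` drops by `L‖x^{k+1} - x^k‖²` up to a summable error (`descent`).
If the step is at most `ε / (4L)`, the proximal term adds at most `ε / 2` to the gradient, so the
output is stationary (`isPDStationary`). Every iteration that does not stop gains `ε² / (16L)`, and
`max_y H` cannot fall below `H*`; this bounds the outer iterations.

Inner level. Write `‖z + σ_x x‖² / (2σ_x)` minus the payoff and take the supremum over `x`: the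
result is strongly convex in `(z, y)`, and its minimizer is the saddle point in the coordinates `z =
-σ_x x`. The `for` loop is an accelerated inexact proximal point method for this dual. Its proximal
steps pass a relative error test, and a Lyapunov function shrinks by `1 - ᾱ/2` per pass
(`lyapunov_leaveVars_le`). The termination residual is at most a constant times the distance to the
saddle point (`norm_residual_le`), which gives the logarithmic number of passes
(`Reaches.exists_done`).

Innermost level. The `while` loop applies an extra anchored gradient method to a monotone inclusion
whose operator is Lipschitz with constant of order `σ_x`. The residual decays like `1/t`
(`anchored_rate`). If the relative test failed, the initial residual and the distance travelled
would be bounded by the current residual, which is incompatible with this rate once `t` reaches 1000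
(`anchored_stop`). One pass of the `for` loop thus costs an absolute constant number of oracle
calls. -/

/-! ### Extended-valued convex functions, proximal points and subdifferentials. -/

section ConvexAnalysis

variable {E : Type*} [NormedAddCommGroup E] [InnerProductSpace ℝ E]

/-- `b` is a subgradient at `x` of the extended-valued convex function `p`. -/
def IsSubgradient (p : E → EReal) (x b : E) : Prop :=
  x ∈ effDom p ∧ ∀ v ∈ effDom p, (p x).toReal + inner ℝ b (v - x) ≤ (p v).toReal

theorem IsSubgradient.monotone {p : E → EReal} {x x' b b' : E} (h : IsSubgradient p x b)
    (h' : IsSubgradient p x' b') : 0 ≤ inner ℝ (b - b') (x - x') := by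
  have h1 := h.2 x' h'.1
  have h2 := h'.2 x h.1
  simp only [inner_sub_left, inner_sub_right] at *
  linarith

namespace IsProperClosedConvex

variable {p : E → EReal}

theorem coe_toReal (hp : IsProperClosedConvex p) {x : E} (hx : x ∈ effDom p) :
    ((p x).toReal : EReal) = p x :=
  EReal.coe_toReal (ne_of_lt hx) (hp.ne_bot x)

theorem convexOn (hp : IsProperClosedConvex p) :
    ConvexOn ℝ (effDom p) fun x => (p x).toReal := by
  have key : ∀ x ∈ effDom p, ∀ y ∈ effDom p, ∀ a b : ℝ, 0 ≤ a → 0 ≤ b → a + b = 1 →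
      p (a • x + b • y) ≤ ((a * (p x).toReal + b * (p y).toReal : ℝ) : EReal) := by
    intro x hx y hy a b ha hb hab
    have h1 : ((x, (p x).toReal) : E × ℝ) ∈ {z : E × ℝ | p z.1 ≤ (z.2 : EReal)} := by
      simp [hp.coe_toReal hx]
    have h2 : ((y, (p y).toReal) : E × ℝ) ∈ {z : E × ℝ | p z.1 ≤ (z.2 : EReal)} := by
      simp [hp.coe_toReal hy]
    simpa using hp.convex_epigraph h1 h2 ha hb hab
  refine ⟨fun x hx y hy a b ha hb hab => ?_, fun x hx y hy a b ha hb hab => ?_⟩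
  · exact lt_of_le_of_lt (key x hx y hy a b ha hb hab) (EReal.coe_lt_top _)
  · have hk := key x hx y hy a b ha hb hab
    have hd : a • x + b • y ∈ effDom p := lt_of_le_of_lt hk (EReal.coe_lt_top _)
    rw [← hp.coe_toReal hd] at hk
    exact_mod_cast hk

theorem lowerSemicontinuousOn (hp : IsProperClosedConvex p) :
    LowerSemicontinuousOn (fun x => (p x).toReal) (effDom p) := by
  intro x hx a ha
  have h1 : (a : EReal) < p x := by rw [← hp.coe_toReal hx]; exact_mod_cast ha
  filter_upwards [mem_nhdsWithin_of_mem_nhds (hp.lsc x a h1), self_mem_nhdsWithin] with v hv hvd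
  rw [← hp.coe_toReal hvd] at hv
  exact_mod_cast hv

theorem exists_lower_bound (hp : IsProperClosedConvex p) (hc : IsCompact (effDom p)) :
    ∃ m : ℝ, ∀ x ∈ effDom p, m ≤ (p x).toReal := by
  obtain ⟨u, -, hmin⟩ := hp.lowerSemicontinuousOn.exists_isMinOn hp.nonempty_dom hc
  exact ⟨_, fun x hx => hmin hx⟩

theorem exists_prox (hp : IsProperClosedConvex p) (hc : IsCompact (effDom p)) {r : ℝ}
    (hr : 0 < r) (w : E) :
    ∃ u, ∀ v, ((‖u - w‖ ^ 2 / 2 : ℝ) : EReal) + (r : EReal) * p u ≤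
      ((‖v - w‖ ^ 2 / 2 : ℝ) : EReal) + (r : EReal) * p v := by
  have hl : LowerSemicontinuousOn (fun v => r⁻¹ * (‖v - w‖ ^ 2 / 2) + (p v).toReal)
      (effDom p) := by
    refine LowerSemicontinuousOn.add ?_ hp.lowerSemicontinuousOn
    exact Continuous.lowerSemicontinuous (by fun_prop) |>.lowerSemicontinuousOn _
  obtain ⟨u, hu, hmin⟩ := hl.exists_isMinOn hp.nonempty_dom hc
  refine ⟨u, fun v => ?_⟩
  by_cases hv : v ∈ effDom p
  · have := hmin hv
    simp only [Set.mem_ofPred_eq] at this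
    rw [← hp.coe_toReal hu, ← hp.coe_toReal hv]
    have h2 := mul_le_mul_of_nonneg_left this hr.le
    rw [mul_add, mul_add, mul_inv_cancel_left₀ hr.ne', mul_inv_cancel_left₀ hr.ne'] at h2
    exact_mod_cast h2
  · have : p v = ⊤ := by simpa [effDom] using hv
    rw [this, EReal.coe_mul_top_of_pos hr, EReal.coe_add_top]
    exact le_top

theorem prox_spec (hp : IsProperClosedConvex p) (hc : IsCompact (effDom p)) {r : ℝ}
    (hr : 0 < r) (w v : E) :
    ((‖prox p r w - w‖ ^ 2 / 2 : ℝ) : EReal) + (r : EReal) * p (prox p r w) ≤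
      ((‖v - w‖ ^ 2 / 2 : ℝ) : EReal) + (r : EReal) * p v :=
  Classical.epsilon_spec (hp.exists_prox hc hr w) v

theorem prox_mem (hp : IsProperClosedConvex p) (hc : IsCompact (effDom p)) {r : ℝ}
    (hr : 0 < r) (w : E) : prox p r w ∈ effDom p := by
  by_contra hu
  obtain ⟨v, hv⟩ := hp.nonempty_dom
  have hs := hp.prox_spec hc hr w v
  have : p (prox p r w) = ⊤ := by simpa [effDom] using hu
  rw [this, EReal.coe_mul_top_of_pos hr, EReal.coe_add_top, ← hp.coe_toReal hv] at hs
  rw [← EReal.coe_mul, ← EReal.coe_add, top_le_iff] at hs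
  exact EReal.coe_ne_top _ hs

/-- Compare the minimizer `u` with `(1 - t) u + t v`, use convexity of `p`, divide by `t` and let
`t` tend to `0`: the quadratic remainder vanishes. -/
theorem isSubgradient_prox (hp : IsProperClosedConvex p) (hc : IsCompact (effDom p)) {r : ℝ}
    (hr : 0 < r) (w : E) : IsSubgradient p (prox p r w) ((1 / r) • (w - prox p r w)) := by
  set u := prox p r w with hu_def
  have hu : u ∈ effDom p := hp.prox_mem hc hr w
  refine ⟨hu, fun v hv => ?_⟩
  have key : ∀ t : ℝ, 0 < t → t ≤ 1 →
      (p u).toReal + inner ℝ ((1 / r) • (w - u)) (v - u) - t * (‖v - u‖ ^ 2 / (2 * r)) ≤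
        (p v).toReal := by
    intro t ht ht1
    have hcv := hp.convexOn.2 hu hv (by linarith : 0 ≤ 1 - t) ht.le (by ring)
    have hd := hp.convexOn.1 hu hv (by linarith : 0 ≤ 1 - t) ht.le (by ring)
    have hs := hp.prox_spec hc hr w ((1 - t) • u + t • v)
    rw [← hu_def, ← hp.coe_toReal hu, ← hp.coe_toReal hd] at hs
    have hs' : ‖u - w‖ ^ 2 / 2 + r * (p u).toReal ≤ ‖(1 - t) • u + t • v - w‖ ^ 2 / 2 +
        r * (p ((1 - t) • u + t • v)).toReal := by exact_mod_cast hs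
    have e1 : (1 - t) • u + t • v - w = (u - w) + t • (v - u) := by module
    rw [e1, norm_add_sq_real, norm_smul, inner_smul_right, mul_pow, Real.norm_eq_abs, sq_abs] at hs'
    rw [inner_smul_left]
    have e2 : inner ℝ (u - w) (v - u) = - inner ℝ (w - u) (v - u) := by
      rw [← inner_neg_left]; congr 1; abel
    rw [e2] at hs'
    simp only [smul_eq_mul] at hcv
    have h4 := mul_le_mul_of_nonneg_left hcv hr.le
    have h5 : t * (r * (p u).toReal + inner ℝ (w - u) (v - u) - t * (‖v - u‖ ^ 2 / 2)) ≤
        t * (r * (p v).toReal) := by nlinarith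
    have h6 := le_of_mul_le_mul_left h5 ht
    simp only [conj_trivial]
    rw [← mul_le_mul_iff_right₀ hr]
    convert h6 using 1
    field_simp
  have hlim : Filter.Tendsto (fun t : ℝ => (p u).toReal + inner ℝ ((1 / r) • (w - u)) (v - u) -
      t * (‖v - u‖ ^ 2 / (2 * r))) (𝓝[>] 0)
      (𝓝 ((p u).toReal + inner ℝ ((1 / r) • (w - u)) (v - u) - 0 * (‖v - u‖ ^ 2 / (2 * r)))) :=
    (Continuous.tendsto (by fun_prop) 0).mono_left nhdsWithin_le_nhds
  rw [zero_mul, sub_zero] at hlim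
  refine le_of_tendsto hlim ?_
  filter_upwards [Ioc_mem_nhdsGT (zero_lt_one' ℝ)] with t ht using key t ht.1 ht.2

end IsProperClosedConvex

/-- Proximal maps are nonexpansive. -/
theorem IsSubgradient.norm_sub_le {p : E → EReal} {r : ℝ} (hr : 0 < r) {w w' u u' : E}
    (h : IsSubgradient p u ((1 / r) • (w - u))) (h' : IsSubgradient p u' ((1 / r) • (w' - u'))) :
    ‖u - u'‖ ≤ ‖w - w'‖ := by
  have hm := h.monotone h'
  rw [← smul_sub, inner_smul_left] at hm
  have h1 : 0 ≤ inner ℝ (w - u - (w' - u')) (u - u') := by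
    by_contra hneg
    have : (1 / r) * inner ℝ (w - u - (w' - u')) (u - u') < 0 :=
      mul_neg_of_pos_of_neg (by positivity) (not_le.mp hneg)
    simp only [conj_trivial] at hm
    linarith
  have e : w - u - (w' - u') = (w - w') - (u - u') := by abel
  rw [e, inner_sub_left, real_inner_self_eq_norm_sq] at h1
  have h2 := real_inner_le_norm (w - w') (u - u')
  by_contra hlt
  push Not at hlt
  nlinarith [norm_nonneg (w - w'), norm_nonneg (u - u')]

/-! ### Regular subgradients belong to the subdifferential -/

theorem mem_subdiff_of_eventually {φ : E → EReal} {x s : E} {c : ℝ} (hc : φ x = c)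
    (h : ∀ ε > (0 : ℝ), ∀ᶠ v in 𝓝 x,
      ((c + inner ℝ s (v - x) - ε * ‖v - x‖ : ℝ) : EReal) ≤ φ v) :
    s ∈ subdiff φ x := by
  refine ⟨by simp [effDom, hc], fun d => ?_⟩
  refine EReal.ge_of_forall_gt_iff_ge.1 fun a ha => ?_
  have ha' : a < inner ℝ s d := by exact_mod_cast ha
  set δ := inner ℝ s d - a with hδ
  have hδ0 : 0 < δ := by linarith
  -- The slack `δ` between `⟨s, d⟩` and `a` is halved: `r` spends one half on moving `d'` away from
  -- `d`, `ε` the other half on the error term.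
  set r := δ / (2 * (‖s‖ + 1)) with hr
  have hr0 : 0 < r := by positivity
  set ε := δ / (2 * (‖d‖ + r)) with hε
  have hε0 : 0 < ε := by positivity
  have hb : ∀ d' ∈ Metric.ball d r, a ≤ inner ℝ s d' - ε * ‖d'‖ := by
    intro d' hd'
    rw [Metric.mem_ball, dist_eq_norm] at hd'
    have e1 : inner ℝ s d' = inner ℝ s d + inner ℝ s (d' - d) := by
      rw [← inner_add_right]; congr 1; abel
    have e2 : -(‖s‖ * r) ≤ inner ℝ s (d' - d) := by
      have := neg_le_of_abs_le (abs_real_inner_le_norm s (d' - d))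
      nlinarith [norm_nonneg s]
    have e3 : ‖d'‖ ≤ ‖d‖ + r := by
      have := norm_add_le d (d' - d)
      rw [add_sub_cancel] at this
      linarith
    have e4 : ‖s‖ * r ≤ δ / 2 := by
      have : (‖s‖ + 1) * r = δ / 2 := by rw [hr]; field_simp
      nlinarith
    have e5 : ε * (‖d‖ + r) = δ / 2 := by rw [hε]; field_simp
    have e6 : ε * ‖d'‖ ≤ δ / 2 := by rw [← e5]; gcongr
    linarith
  unfold upperSubderiv
  refine le_iSup₂_of_le r hr0 ?_
  -- The upper limit can only decrease when the base point is frozen at `x' = x`, where the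
  -- inequality assumed at `x` applies.
  have hle : (pure x ×ˢ 𝓝[>] (0 : ℝ)) ≤ (𝓝 x ⊓ Filter.comap φ (𝓝 (φ x))) ×ˢ 𝓝[>] (0 : ℝ) := by
    refine Filter.prod_mono_left _ (le_inf (pure_le_nhds x) ?_)
    rw [← Filter.map_le_iff_le_comap, Filter.map_pure]
    exact pure_le_nhds _
  refine Filter.le_limsup_of_frequently_le (Filter.Frequently.filter_mono (Filter.Eventually.frequently ?_) hle)
  rw [Filter.pure_prod, Filter.eventually_map]
  obtain ⟨ρ, hρ, hball⟩ := Metric.eventually_nhds_iff.1 (h ε hε0)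
  have hlt : 0 < ρ / (‖d‖ + r) := by positivity
  filter_upwards [Ioo_mem_nhdsGT hlt] with t ht
  refine le_iInf₂ fun d' hd' => ?_
  have hn : ‖d'‖ < ‖d‖ + r := by
    have h1 := norm_add_le d (d' - d)
    rw [add_sub_cancel] at h1
    rw [Metric.mem_ball, dist_eq_norm] at hd'
    linarith
  have hin := hball (y := x + t • d') (by
    rw [dist_eq_norm, add_sub_cancel_left, norm_smul, Real.norm_of_nonneg ht.1.le]
    have := (lt_div_iff₀ (by positivity)).1 ht.2
    nlinarith [ht.1])
  rw [add_sub_cancel_left, inner_smul_right, norm_smul, Real.norm_of_nonneg ht.1.le] at hin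
  rw [EReal.le_div_iff_mul_le (by exact_mod_cast ht.1) (EReal.coe_ne_top _), hc,
    EReal.le_sub_iff_add_le (by simp) (by simp)]
  refine le_trans ?_ hin
  have := mul_le_mul_of_nonneg_left (hb d' hd') ht.1.le
  have h3 : a * t + c ≤ c + t * inner ℝ s d' - ε * (t * ‖d'‖) := by nlinarith
  exact_mod_cast h3

theorem mem_subdiff_of_hasGradientAt [CompleteSpace E] {φ p : E → EReal} {f : E → ℝ} {g b x : E}
    {c : ℝ} (hf : HasGradientAt f g x) (hb : IsSubgradient p x b)
    (hφ : ∀ u ∈ effDom p, φ u = ((f u + (p u).toReal + c : ℝ) : EReal))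
    (hφ' : ∀ u ∉ effDom p, φ u = ⊤) : g + b ∈ subdiff φ x := by
  refine mem_subdiff_of_eventually (hφ x hb.1) fun ε hε => ?_
  have hlo := (hasGradientAt_iff_isLittleO.1 hf).def hε
  filter_upwards [hlo] with v hv
  by_cases hd : v ∈ effDom p
  · rw [hφ v hd]
    have h1 := hb.2 v hd
    have h2 := neg_le_of_abs_le hv
    rw [inner_add_left]
    have : f x + (p x).toReal + c + (inner ℝ g (v - x) + inner ℝ b (v - x)) - ε * ‖v - x‖ ≤
        f v + (p v).toReal + c := by linarith
    exact_mod_cast this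
  · rw [hφ' v hd]; exact le_top

end ConvexAnalysis

/-! ### The extra anchored gradient method -/

section Anchored

variable {Z : Type*} [NormedAddCommGroup Z] [InnerProductSpace ℝ Z]

/-- Monotonicity is multiplied by `B / (β (1 - β))`, and `u' - u` is written through `u - u0` when
paired with `g` and through `u' - u0` when paired with `g'`. What remains are inner products with
`gh`. The Lipschitz bound makes them a quadratic in `gh` with leading coefficient `9/10`; minimizing
it by completing the square leaves `1 - 2β + 10/9 β²`. -/
theorem anchored_one_step {β r B a : ℝ} (hβ : 0 < β) (hβ1 : β < 1) (hr : 0 < r) (hB : 0 < B)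
    {u0 u u' g g' gh : Z} (hu : u' = u + β • (u0 - u) - r • gh)
    (hlip : ‖g' - gh‖ ^ 2 ≤ 1 / 10 * ‖g - gh‖ ^ 2) (hmon : 0 ≤ inner ℝ (g' - g) (u' - u))
    (ha : r * B / (2 * β * (1 - β)) * (1 - 2 * β + 10 / 9 * β ^ 2) ≤ a) :
    r * B / (2 * β * (1 - β)) * ‖g'‖ ^ 2 + B / (1 - β) * inner ℝ g' (u' - u0) ≤
      a * ‖g‖ ^ 2 + B * inner ℝ g (u - u0) := by
  have h1β : 0 < 1 - β := by linarith
  set q := r * B / (2 * β * (1 - β)) with hq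
  have hq0 : 0 < q := by positivity
  have hd : u' - u = -(β • (u - u0)) - r • gh := by rw [hu]; module
  have hd' : (1 - β) • (u' - u) = -(β • (u' - u0)) - r • gh := by rw [hu]; module
  have m1 : inner ℝ g (u' - u) = -(β * inner ℝ g (u - u0)) - r * inner ℝ g gh := by
    rw [hd]; simp [inner_sub_right, inner_smul_right, inner_neg_right]
  have m2 : (1 - β) * inner ℝ g' (u' - u) = -(β * inner ℝ g' (u' - u0)) - r * inner ℝ g' gh := by
    rw [← inner_smul_right, hd']; simp [inner_sub_right, inner_smul_right, inner_neg_right]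
  rw [inner_sub_left] at hmon
  have hm : 0 ≤ -(β * inner ℝ g' (u' - u0)) - r * inner ℝ g' gh -
      (1 - β) * (-(β * inner ℝ g (u - u0)) - r * inner ℝ g gh) := by
    rw [← m2, ← m1, ← mul_sub]; exact mul_nonneg h1β.le hmon
  have hm2 := mul_nonneg (by positivity : 0 ≤ B / (β * (1 - β))) hm
  have e1 : B / (β * (1 - β)) * (-(β * inner ℝ g' (u' - u0)) - r * inner ℝ g' gh -
      (1 - β) * (-(β * inner ℝ g (u - u0)) - r * inner ℝ g gh)) =
      B * inner ℝ g (u - u0) - B / (1 - β) * inner ℝ g' (u' - u0) -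
        q * (2 * inner ℝ g' gh - 2 * (1 - β) * inner ℝ g gh) := by
    rw [hq]; field_simp; ring
  rw [e1] at hm2
  have n1 := norm_sub_sq_real g' gh
  have n2 := norm_sub_sq_real g gh
  rw [n1, n2] at hlip
  -- the quadratic form in `gh` is bounded below
  have n3 : 0 ≤ ‖(9 / 10 : ℝ) • gh - (9 / 10 - β) • g‖ ^ 2 := by positivity
  rw [norm_sub_sq_real, norm_smul, norm_smul, inner_smul_left, inner_smul_right, mul_pow, mul_pow,
    Real.norm_eq_abs, Real.norm_eq_abs, sq_abs, sq_abs, real_inner_comm] at n3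
  simp only [conj_trivial] at n3
  have k1 : ‖g'‖ ^ 2 - (1 - 2 * β + 10 / 9 * β ^ 2) * ‖g‖ ^ 2 ≤
      2 * inner ℝ g' gh - 2 * (1 - β) * inner ℝ g gh := by
    nlinarith
  have k2 := mul_le_mul_of_nonneg_left k1 hq0.le
  have k3 := mul_le_mul_of_nonneg_right ha (sq_nonneg ‖g‖)
  nlinarith

/-- The rate of the extra anchored gradient method with anchoring coefficients `2 / (t + 3)`. -/
theorem anchored_rate {r : ℝ} (hr : 0 < r) {u g gh : ℕ → Z} (t : ℕ)
    (hu : ∀ s ≤ t, u (s + 1) = u s + (2 / ((s : ℝ) + 3)) • (u 0 - u s) - r • gh s)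
    (hlip : ∀ s ≤ t, ‖g (s + 1) - gh s‖ ^ 2 ≤ 1 / 10 * ‖g s - gh s‖ ^ 2)
    (hmon : ∀ s ≤ t, 0 ≤ inner ℝ (g (s + 1) - g s) (u (s + 1) - u s)) :
    r * (((t : ℝ) + 2) * (t + 3) ^ 2 / 8) * ‖g (t + 1)‖ ^ 2 +
      ((t : ℝ) + 2) * (t + 3) / 2 * inner ℝ (g (t + 1)) (u (t + 1) - u 0) ≤
      3 / 8 * r * ‖g 0‖ ^ 2 := by
  induction t with
  | zero =>
    -- In the first step `u = u0`, so only the norm of `g 0` survives; its coefficient `13/36` is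
    -- rounded up to `3/8`.
    have h := anchored_one_step (β := 2 / 3) (B := 1) (a := 3 / 8 * r) (by norm_num) (by norm_num)
      hr one_pos (u0 := u 0) (u := u 0) (u' := u 1) (gh := gh 0) (by have := hu 0 le_rfl; norm_num at this ⊢; exact this)
      (hlip 0 le_rfl) (hmon 0 le_rfl) (by norm_num; nlinarith)
    simp only [sub_self, inner_zero_right, mul_zero, add_zero] at h
    refine le_trans (le_of_eq ?_) h
    simp only [Nat.cast_zero, zero_add]
    ring
  | succ t ih =>
    have ht : (0 : ℝ) ≤ t := Nat.cast_nonneg t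
    -- The weight `B = (t + 2)(t + 3) / 2` is chosen so that `B / (1 - β)` is the same expression at
    -- `t + 1`; the inner-product terms then telescope. The norm terms do so because `t² + 4t + 40/9
    -- ≤ (t + 2)(t + 3)`.
    have h := anchored_one_step (β := 2 / (((t + 1 : ℕ) : ℝ) + 3)) (B := ((t : ℝ) + 2) * (t + 3) / 2)
      (a := r * (((t : ℝ) + 2) * (t + 3) ^ 2 / 8)) (by positivity)
      (by rw [div_lt_one (by positivity)]; push_cast; linarith) hr (by positivity) (hu (t + 1) le_rfl)
      (hlip (t + 1) le_rfl) (hmon (t + 1) le_rfl) (by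
        have e : 1 - 2 / (((t + 1 : ℕ) : ℝ) + 3) = (t + 2) / (t + 4) := by
          push_cast; field_simp; ring
        rw [e]
        push_cast
        have e2 : r * (((t : ℝ) + 2) * (t + 3) / 2) / (2 * (2 / (t + 1 + 3)) * ((t + 2) / (t + 4))) *
            (1 - 2 * (2 / (t + 1 + 3)) + 10 / 9 * (2 / (t + 1 + 3)) ^ 2) =
            r * ((t + 3) / 8) * (t ^ 2 + 4 * t + 40 / 9) := by
          have : (t : ℝ) + 1 + 3 = t + 4 := by ring
          rw [this]; field_simp; ring
        rw [e2]
        have : (t + 3) / 8 * ((t : ℝ) ^ 2 + 4 * t + 40 / 9) ≤ (t + 2) * (t + 3) ^ 2 / 8 := by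
          nlinarith [mul_nonneg ht ht]
        nlinarith)
    refine le_trans (le_of_eq ?_) (h.trans (ih (fun s hs => hu s (by lia)) (fun s hs => hlip s (by lia))
      fun s hs => hmon s (by lia)))
    have e : 1 - 2 / (((t + 1 : ℕ) : ℝ) + 3) = (t + 2) / (t + 4) := by
      push_cast; field_simp; ring
    rw [e]
    push_cast
    have e3 : r * (((t : ℝ) + 2) * (t + 3) / 2) / (2 * (2 / (t + 1 + 3)) * ((t + 2) / (t + 4))) =
        r * ((t + 1 + 2) * (t + 1 + 3) ^ 2 / 8) := by
      have : (t : ℝ) + 1 + 3 = t + 4 := by ring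
      rw [this]; field_simp; ring
    have e4 : ((t : ℝ) + 2) * (t + 3) / 2 / ((t + 2) / (t + 4)) = (t + 1 + 2) * (t + 1 + 3) / 2 := by
      field_simp; ring
    rw [e3, e4]

/-- The stopping test holds when the anchored iteration is long enough. Here `um` is the point from
which the forward-backward step to `u 0` is taken, `am` the value of the forward operator there. -/
theorem anchored_stop {r G : ℝ} (hr : 0 < r) (hG : 0 < G) {u g gh a : ℕ → Z} {um am : Z} {t : ℕ}
    (hu : ∀ s ≤ t, u (s + 1) = u s + (2 / ((s : ℝ) + 3)) • (u 0 - u s) - r • gh s)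
    (hlip : ∀ s ≤ t, ‖g (s + 1) - gh s‖ ^ 2 ≤ 1 / 10 * ‖g s - gh s‖ ^ 2)
    (hmon : ∀ s ≤ t, 0 ≤ inner ℝ (g (s + 1) - g s) (u (s + 1) - u s))
    (hgm : 0 ≤ inner ℝ ((g (t + 1) - a (t + 1)) - (g 0 - a 0)) (u (t + 1) - u 0))
    (hum : um - u 0 = r • (am + (g 0 - a 0))) (hrG : r ≤ G / 100)
    (ham : ∀ s, r * ‖am - a s‖ ≤ 28 / 100 * ‖um - u s‖) (ht : 7 * G ≤ r * (t + 3)) :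
    G ^ 2 * ‖g (t + 1)‖ ^ 2 ≤ ‖u (t + 1) - um‖ ^ 2 := by
  -- If the test fails, `N = G ‖g (t + 1)‖` exceeds the distance from `um`. All other quantities are
  -- then bounded by multiples of `N`, and the rate is contradicted.
  by_contra hcon
  push Not at hcon
  have hS : ‖u (t + 1) - um‖ < G * ‖g (t + 1)‖ := by
    rw [← mul_pow] at hcon
    exact lt_of_pow_lt_pow_left₀ 2 (by positivity) hcon
  set N := G * ‖g (t + 1)‖ with hN
  have hN0 : 0 < N := lt_of_le_of_lt (norm_nonneg _) hS
  set w := u (t + 1) - u 0 with hw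
  set d := um - u 0 with hd
  have hds : u (t + 1) - um = w - d := by rw [hw, hd]; abel
  have hrg : r * ‖g (t + 1)‖ ≤ N / 100 := by
    rw [hN, mul_div_right_comm]; gcongr
  -- Monotonicity of the subgradient parts `g - a` between steps `0` and `t + 1` bounds `⟨d, w⟩`:
  -- `1/100` comes from `r ≤ G / 100` and `28/100` from the Lipschitz bound.
  have hdw : inner ℝ d w ≤ 29 / 100 * N * ‖w‖ := by
    have h1 := mul_nonneg hr.le hgm
    have e : r * inner ℝ ((g (t + 1) - a (t + 1)) - (g 0 - a 0)) w =
        r * inner ℝ (g (t + 1)) w + r * inner ℝ (am - a (t + 1)) w - inner ℝ d w := by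
      rw [hum]
      simp only [inner_sub_left, inner_add_left, inner_smul_left, conj_trivial]
      ring
    rw [e] at h1
    have h2 := mul_le_mul_of_nonneg_left (real_inner_le_norm (g (t + 1)) w) hr.le
    have h3 := mul_le_mul_of_nonneg_left (real_inner_le_norm (am - a (t + 1)) w) hr.le
    have h4 := ham (t + 1)
    rw [norm_sub_rev um] at h4
    have h5 : r * ‖am - a (t + 1)‖ ≤ 28 / 100 * N := by linarith
    have h6 := mul_le_mul_of_nonneg_right h5 (norm_nonneg w)
    have h7 := mul_le_mul_of_nonneg_right hrg (norm_nonneg w)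
    linarith
  have hsq : ‖d‖ ^ 2 + ‖w‖ ^ 2 ≤ N ^ 2 + 58 / 100 * N * ‖w‖ := by
    have h1 : ‖u (t + 1) - um‖ ^ 2 ≤ N ^ 2 := by gcongr
    rw [hds, norm_sub_sq_real, real_inner_comm] at h1
    linarith
  have hQ : ‖w‖ ≤ 14 / 10 * N := by
    by_contra hlt
    push Not at hlt
    nlinarith [sq_nonneg ‖d‖]
  have hD : ‖d‖ ^ 2 ≤ 11 / 10 * N ^ 2 := by nlinarith [sq_nonneg (‖w‖ - 29 / 100 * N)]
  -- Since `r • g 0` is `d` up to a Lipschitz error, `‖r • g 0‖ ≤ 1.28 ‖d‖`, and `1.28² · 1.1 < 2`.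
  have hg0 : (r * ‖g 0‖) ^ 2 ≤ 2 * N ^ 2 := by
    have e : r • g 0 = d + r • (a 0 - am) := by rw [hum]; module
    have h1 : r * ‖g 0‖ ≤ 128 / 100 * ‖d‖ := by
      rw [← Real.norm_of_nonneg hr.le, ← norm_smul, e]
      refine (norm_add_le _ _).trans ?_
      rw [norm_smul, Real.norm_of_nonneg hr.le, norm_sub_rev (a 0)]
      linarith [ham 0]
    calc (r * ‖g 0‖) ^ 2 ≤ (128 / 100 * ‖d‖) ^ 2 := by gcongr
      _ ≤ 2 * N ^ 2 := by nlinarith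
  have hrate := anchored_rate hr t hu hlip hmon
  have ht0 : (0 : ℝ) ≤ t := Nat.cast_nonneg t
  set σ := r * (t + 3) * ‖g (t + 1)‖ with hσ
  have hσN : 7 * N ≤ σ := by
    rw [hσ, hN, ← mul_assoc]; gcongr
  have hiw : -(14 / 10 * N * ‖g (t + 1)‖) ≤ inner ℝ (g (t + 1)) w := by
    have h1 := neg_le_of_abs_le (abs_real_inner_le_norm (g (t + 1)) w)
    nlinarith [norm_nonneg (g (t + 1))]
  -- Scaled by `8r / (t + 2)`, the rate becomes `σ² - 5.6 N σ ≤ 3 N²`, which is false for `σ ≥ 7N`.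
  have h1 := mul_le_mul_of_nonneg_left hrate (by positivity : 0 ≤ 8 * r / ((t : ℝ) + 2))
  have e1 : 8 * r / ((t : ℝ) + 2) * (r * (((t : ℝ) + 2) * (t + 3) ^ 2 / 8) * ‖g (t + 1)‖ ^ 2 +
      ((t : ℝ) + 2) * (t + 3) / 2 * inner ℝ (g (t + 1)) w) =
      σ ^ 2 + 4 * (r * (t + 3)) * inner ℝ (g (t + 1)) w := by
    rw [hσ]; field_simp; ring
  have e2 : 8 * r / ((t : ℝ) + 2) * (3 / 8 * r * ‖g 0‖ ^ 2) = 3 * (r * ‖g 0‖) ^ 2 / (t + 2) := by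
    field_simp
  rw [e1, e2] at h1
  have h2 : 3 * (r * ‖g 0‖) ^ 2 / ((t : ℝ) + 2) ≤ 3 * N ^ 2 := by
    rw [div_le_iff₀ (by positivity)]
    nlinarith [sq_nonneg N]
  have h3 := mul_le_mul_of_nonneg_left hiw (by positivity : 0 ≤ 4 * (r * ((t : ℝ) + 3)))
  have e3 : 4 * (r * ((t : ℝ) + 3)) * -(14 / 10 * N * ‖g (t + 1)‖) = -(56 / 10 * N * σ) := by
    rw [hσ]; ring
  rw [e3] at h3
  nlinarith

end Anchored

/-! ### First-order inequalities for smooth functions -/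

section Smooth

variable {E F : Type*} [NormedAddCommGroup E] [InnerProductSpace ℝ E] [CompleteSpace E]
  [NormedAddCommGroup F] [InnerProductSpace ℝ F] [CompleteSpace F]

theorem HasGradientAt.hasDerivAt_line {f : E → ℝ} {g x d : E} {t : ℝ}
    (hf : HasGradientAt f g (x + t • d)) :
    HasDerivAt (fun s : ℝ => f (x + s • d)) (inner ℝ g d) t := by
  have h1 : HasDerivAt (fun s : ℝ => x + s • d) d t := by
    simpa using ((hasDerivAt_id t).smul_const d).const_add x
  exact hf.hasFDerivAt.comp_hasDerivAt t h1

/-- Along the segment, `f` minus its linearization plus the quadratic has nonnegative derivative.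
Only `X` has to be convex; it is applied with `X = dom p`, so `U` may be arbitrary. -/
theorem descent_lower {X : Set E} (hX : Convex ℝ X) {f : E → ℝ} {g : E → E} {L : ℝ}
    (hg : ∀ u ∈ X, HasGradientAt f (g u) u)
    (hL : ∀ u ∈ X, ∀ v ∈ X, ‖g u - g v‖ ≤ L * ‖u - v‖) {u v : E} (hu : u ∈ X) (hv : v ∈ X) :
    f u + inner ℝ (g u) (v - u) - L / 2 * ‖v - u‖ ^ 2 ≤ f v := by
  have hmem : ∀ t ∈ Set.Icc (0 : ℝ) 1, u + t • (v - u) ∈ X := fun t ht =>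
    hX.add_smul_sub_mem hu hv ht
  have hd : ∀ t ∈ Set.Icc (0 : ℝ) 1, HasDerivAt
      (fun t : ℝ => f (u + t • (v - u)) - t * inner ℝ (g u) (v - u) + L / 2 * ‖v - u‖ ^ 2 * t ^ 2)
      (inner ℝ (g (u + t • (v - u))) (v - u) - 1 * inner ℝ (g u) (v - u) +
        L / 2 * ‖v - u‖ ^ 2 * (2 * t)) t := by
    intro t ht
    have h1 := (hg _ (hmem t ht)).hasDerivAt_line
    have h2 := (hasDerivAt_id t).mul_const (inner ℝ (g u) (v - u))
    have h3 := (hasDerivAt_pow 2 t).const_mul (L / 2 * ‖v - u‖ ^ 2)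
    refine ((h1.sub h2).add h3).congr_deriv ?_
    norm_num
  have hmono := monotoneOn_of_hasDerivWithinAt_nonneg (convex_Icc (0 : ℝ) 1)
    (fun t ht => (hd t ht).continuousAt.continuousWithinAt)
    (fun t ht => (hd t (interior_subset ht)).hasDerivWithinAt) (by
      intro t ht
      have ht' := interior_subset ht
      have h1 := hL _ (hmem t ht') u hu
      rw [add_sub_cancel_left, norm_smul, Real.norm_of_nonneg ht'.1] at h1
      have h2 := neg_le_of_abs_le (abs_real_inner_le_norm (g (u + t • (v - u)) - g u) (v - u))
      rw [inner_sub_left] at h2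
      have h3 := mul_le_mul_of_nonneg_right h1 (norm_nonneg (v - u))
      nlinarith)
  have := hmono (Set.left_mem_Icc.2 zero_le_one) (Set.right_mem_Icc.2 zero_le_one) zero_le_one
  simp only [zero_smul, add_zero, one_smul, add_sub_cancel] at this
  linarith

theorem StrongConcaveOn.le_tangent {V : Set F} {σ : ℝ} {f : F → ℝ} (hf : StrongConcaveOn V σ f)
    {g y y' : F} (hy : y ∈ V) (hy' : y' ∈ V) (hg : HasGradientAt f g y) :
    f y' ≤ f y + inner ℝ g (y' - y) - σ / 2 * ‖y' - y‖ ^ 2 := by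
  have h0 : HasGradientAt f g (y + (0 : ℝ) • (y' - y)) := by simpa using hg
  have h1 := h0.hasDerivAt_line.tendsto_slope_zero_right
  have h2 : Filter.Tendsto (fun t : ℝ => f y' - f y + (1 - t) * (σ / 2 * ‖y' - y‖ ^ 2)) (𝓝[>] 0)
      (𝓝 (f y' - f y + (1 - 0) * (σ / 2 * ‖y' - y‖ ^ 2))) :=
    (Continuous.tendsto (by fun_prop) 0).mono_left nhdsWithin_le_nhds
  have h3 := le_of_tendsto_of_tendsto h2 h1 (by
    filter_upwards [Ioc_mem_nhdsGT (zero_lt_one' ℝ)] with t ht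
    have h := hf.2 hy hy' (by linarith [ht.2] : 0 ≤ 1 - t) ht.1.le (by ring)
    have e : (1 - t) • y + t • y' = y + t • (y' - y) := by module
    rw [e, norm_sub_rev] at h
    simp only [smul_eq_mul, zero_add, zero_smul, add_zero] at h ⊢
    rw [← mul_le_mul_iff_right₀ ht.1, mul_inv_cancel_left₀ ht.1.ne']
    nlinarith)
  linarith

theorem HasGradientAt.comp_toLp_left {h : WithLp 2 (E × F) → ℝ} {x : E} {y : F}
    {G : WithLp 2 (E × F)} (hG : HasGradientAt h G (WithLp.toLp 2 (x, y))) :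
    HasGradientAt (fun u => h (WithLp.toLp 2 (u, y))) G.fst x := by
  have hι : HasFDerivAt (fun u : E => WithLp.toLp 2 (u, y))
      ((WithLp.prodContinuousLinearEquiv 2 ℝ E F).symm.toContinuousLinearMap.comp
        (ContinuousLinearMap.inl ℝ E F)) x :=
    (WithLp.prodContinuousLinearEquiv 2 ℝ E F).symm.toContinuousLinearMap.hasFDerivAt.comp x
      (hasFDerivAt_prodMk_left x y)
  rw [hasGradientAt_iff_hasFDerivAt]
  refine (hG.hasFDerivAt.comp x hι).congr_fderiv ?_
  ext u
  simp [WithLp.prod_inner_apply]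

theorem HasGradientAt.comp_toLp_right {h : WithLp 2 (E × F) → ℝ} {x : E} {y : F}
    {G : WithLp 2 (E × F)} (hG : HasGradientAt h G (WithLp.toLp 2 (x, y))) :
    HasGradientAt (fun u => h (WithLp.toLp 2 (x, u))) G.snd y := by
  have hι : HasFDerivAt (fun u : F => WithLp.toLp 2 (x, u))
      ((WithLp.prodContinuousLinearEquiv 2 ℝ E F).symm.toContinuousLinearMap.comp
        (ContinuousLinearMap.inr ℝ E F)) y :=
    (WithLp.prodContinuousLinearEquiv 2 ℝ E F).symm.toContinuousLinearMap.hasFDerivAt.comp y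
      (hasFDerivAt_prodMk_right x y)
  rw [hasGradientAt_iff_hasFDerivAt]
  refine (hG.hasFDerivAt.comp y hι).congr_fderiv ?_
  ext u
  simp [WithLp.prod_inner_apply]

/-- The properties of a call of the inner method on which its analysis rests: a strongly convex,
strongly concave problem on compact domains, with a gradient that is Lipschitz on a set `S` that
contains the domain. -/
structure InnerData.IsRegular (D : InnerData E F) (S : Set (WithLp 2 (E × F))) : Prop where
  hp : IsProperClosedConvex D.p
  hq : IsProperClosedConvex D.q
  hpc : IsCompact (effDom D.p)
  hqc : IsCompact (effDom D.q)
  sx_pos : 0 < D.sx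
  sy_pos : 0 < D.sy
  Lbar_eq : D.Lbar = 3 * D.sx
  mem : ∀ x ∈ effDom D.p, ∀ y ∈ effDom D.q, WithLp.toLp 2 (x, y) ∈ S
  lip : ∀ z ∈ S, ∀ w ∈ S, ‖gradient D.hbar z - gradient D.hbar w‖ ≤ D.Lbar * ‖z - w‖
  convex_left : ∀ x ∈ effDom D.p, ∀ x' ∈ effDom D.p, ∀ y ∈ effDom D.q,
    D.hbar (WithLp.toLp 2 (x, y)) + inner ℝ (D.gx x y) (x' - x) + D.sx / 2 * ‖x' - x‖ ^ 2 ≤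
      D.hbar (WithLp.toLp 2 (x', y))
  concave_right : ∀ x ∈ effDom D.p, ∀ y ∈ effDom D.q, ∀ y' ∈ effDom D.q,
    D.hbar (WithLp.toLp 2 (x, y')) ≤
      D.hbar (WithLp.toLp 2 (x, y)) + inner ℝ (D.gy x y) (y' - y) - D.sy / 2 * ‖y' - y‖ ^ 2

theorem OuterData.hasGradientAt_hk (A : OuterData E F) (xk : E) {z : WithLp 2 (E × F)}
    (hz : DifferentiableAt ℝ A.h z) :
    HasGradientAt (A.hk xk)
      (gradient A.h z + WithLp.toLp 2 ((2 * A.L) • (z.fst - xk), (0 : F))) z := by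
  have h1 : HasFDerivAt (fun w : WithLp 2 (E × F) => w.fst - xk) (WithLp.fstL 2 ℝ E F) z :=
    (WithLp.fstL 2 ℝ E F).hasFDerivAt.sub_const xk
  have h2 := h1.norm_sq.const_mul A.L
  rw [hasGradientAt_iff_hasFDerivAt]
  refine (hz.hasGradientAt.hasFDerivAt.add h2).congr_fderiv ?_
  ext u
  simp [WithLp.prod_inner_apply, inner_smul_left]
  simp only [inner_sub_left]
  ring

theorem OuterData.gradient_hk (A : OuterData E F) (xk : E) {z : WithLp 2 (E × F)}
    (hz : DifferentiableAt ℝ A.h z) :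
    gradient (A.hk xk) z = gradient A.h z + WithLp.toLp 2 ((2 * A.L) • (z.fst - xk), (0 : F)) :=
  (A.hasGradientAt_hk xk hz).gradient

/-- The term `L‖x - x^k‖²` has `2L`-Lipschitz gradient and is `2L`-strongly convex. It raises the
Lipschitz constant from `L` to `3L` and turns the weak convexity `-L` of `h` in `x` into strong
convexity `L`. -/
theorem OuterData.call_isRegular (A : OuterData E F) {U : Set E} {V : Set F}
    (hp : IsProperClosedConvex A.p) (hq : IsProperClosedConvex A.q)
    (hpc : IsCompact (effDom A.p)) (hqc : IsCompact (effDom A.q)) (hL : 0 < A.L) (hsy : 0 < A.sy)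
    (hU : effDom A.p ⊆ U) (hV : effDom A.q ⊆ V)
    (hsmooth : SmoothOn A.h A.L {z | z.fst ∈ U ∧ z.snd ∈ V})
    (hconc : ∀ x ∈ effDom A.p, StrongConcaveOn V A.sy fun y => A.h (WithLp.toLp 2 (x, y)))
    (k : ℕ) (xk : E) : (A.call k xk).IsRegular {z | z.fst ∈ U ∧ z.snd ∈ V} where
  hp := hp
  hq := hq
  hpc := hpc
  hqc := hqc
  sx_pos := hL
  sy_pos := hsy
  Lbar_eq := rfl
  mem x hx y hy := ⟨hU hx, hV hy⟩
  lip z hz w hw := by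
    simp only [call]
    rw [A.gradient_hk xk (hsmooth.1 z hz), A.gradient_hk xk (hsmooth.1 w hw), add_sub_add_comm]
    refine (norm_add_le _ _).trans ?_
    have h1 := hsmooth.2 z hz w hw
    have e : WithLp.toLp 2 ((2 * A.L) • (z.fst - xk), (0 : F)) -
        WithLp.toLp 2 ((2 * A.L) • (w.fst - xk), (0 : F)) =
        WithLp.toLp 2 ((2 * A.L) • (z - w).fst, (0 : F)) := by
      rw [← WithLp.toLp_sub, Prod.mk_sub_mk, ← smul_sub, sub_sub_sub_cancel_right, sub_zero]
      rfl
    rw [e, WithLp.norm_toLp_fst, norm_smul, Real.norm_of_nonneg (by positivity)]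
    have h2 := mul_le_mul_of_nonneg_left (WithLp.norm_fst_le (p := 2) (x := z - w)) (by positivity : 0 ≤ 2 * A.L)
    linarith
  convex_left x hx x' hx' y hy := by
    have hm : ∀ u ∈ effDom A.p, WithLp.toLp 2 (u, y) ∈ {z : WithLp 2 (E × F) | z.fst ∈ U ∧ z.snd ∈ V} :=
      fun u hu => ⟨hU hu, hV hy⟩
    have hd := descent_lower (f := fun u => A.h (WithLp.toLp 2 (u, y)))
      (g := fun u => (gradient A.h (WithLp.toLp 2 (u, y))).fst) (L := A.L) hp.convexOn.1
      (fun u hu => (hsmooth.1 _ (hm u hu)).hasGradientAt.comp_toLp_left) (by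
        intro u hu v hv
        have h1 := hsmooth.2 _ (hm u hu) _ (hm v hv)
        have e : WithLp.toLp 2 (u, y) - WithLp.toLp 2 (v, y) = WithLp.toLp 2 (u - v, (0 : F)) := by
          rw [← WithLp.toLp_sub, Prod.mk_sub_mk, sub_self]
        rw [e, WithLp.norm_toLp_fst] at h1
        exact (WithLp.norm_fst_le (p := 2) (x := gradient A.h (WithLp.toLp 2 (u, y)) -
          gradient A.h (WithLp.toLp 2 (v, y)))).trans h1) hx hx'
    simp only [call, InnerData.gx, hk]
    rw [A.gradient_hk xk (hsmooth.1 _ (hm x hx))]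
    simp only [WithLp.add_fst, WithLp.toLp_fst, inner_add_left, inner_smul_left, conj_trivial] at hd ⊢
    have e : x' - xk = (x - xk) + (x' - x) := by abel
    rw [e, norm_add_sq_real]
    nlinarith
  concave_right x hx y hy y' hy' := by
    have hm : WithLp.toLp 2 (x, y) ∈ {z : WithLp 2 (E × F) | z.fst ∈ U ∧ z.snd ∈ V} :=
      ⟨hU hx, hV hy⟩
    have hd := (hconc x hx).le_tangent (hV hy) (hV hy')
      (hsmooth.1 _ hm).hasGradientAt.comp_toLp_right
    simp only [call, InnerData.gy, hk]
    rw [A.gradient_hk xk (hsmooth.1 _ hm)]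
    simp only [WithLp.add_snd, WithLp.toLp_fst, WithLp.toLp_snd, add_zero] at hd ⊢
    linarith

end Smooth

theorem InnerData.alpha_le_one {E F : Type*} {D : InnerData E F} : D.alpha ≤ 1 :=
  min_le_left _ _

/-! ### Step sizes, the monotone operator and the saddle point of one subproblem. -/

section InnerMethod

variable {E F : Type*} [NormedAddCommGroup E] [InnerProductSpace ℝ E] [CompleteSpace E]
  [NormedAddCommGroup F] [InnerProductSpace ℝ F] [CompleteSpace F]

namespace InnerData

variable {D : InnerData E F} {S : Set (WithLp 2 (E × F))}

/-! ### The constants -/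

theorem alpha_pos (hD : D.IsRegular S) : 0 < D.alpha := by
  have := hD.sx_pos
  have := hD.sy_pos
  unfold alpha
  positivity

/-- If `ᾱ = 1` then `8σ_y / σ_x ≥ 1` and the minimum is `1 / (2σ_y)`; otherwise `ᾱ² = 8σ_y / σ_x`
and `4 / (ᾱ σ_x)` is the smaller one. In both cases the `y` block contracts exactly at the rate of
the Lyapunov function. -/
theorem etaY_mul_sy (hD : D.IsRegular S) : D.etaY * D.sy = D.alpha / 2 := by
  have hx := hD.sx_pos
  have hy := hD.sy_pos
  have ha := alpha_pos hD
  unfold etaY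
  rw [min_mul_of_nonneg _ _ hy.le]
  have e1 : 1 / (2 * D.sy) * D.sy = 1 / 2 := by field_simp
  have e2 : 4 / (D.alpha * D.sx) * D.sy = (8 * D.sy / D.sx) / (2 * D.alpha) := by
    field_simp; ring
  rw [e1, e2]
  have hq : 0 < 8 * D.sy / D.sx := by positivity
  rcases le_total 1 (Real.sqrt (8 * D.sy / D.sx)) with h | h
  · have e : D.alpha = 1 := min_eq_left h
    have h1 : 1 ≤ 8 * D.sy / D.sx := by
      rwa [Real.one_le_sqrt] at h
    rw [e, min_eq_left]
    linarith
  · have e : D.alpha = Real.sqrt (8 * D.sy / D.sx) := min_eq_right h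
    have e3 : 8 * D.sy / D.sx = D.alpha ^ 2 := by rw [e, Real.sq_sqrt hq.le]
    rw [e3, min_eq_right]
    · field_simp
    · have := alpha_le_one (D := D)
      rw [div_le_div_iff₀ (by positivity) (by positivity)]
      nlinarith

theorem etaY_pos (hD : D.IsRegular S) : 0 < D.etaY := by
  have := hD.sx_pos
  have := hD.sy_pos
  have := alpha_pos hD
  unfold etaY
  positivity

theorem zetaBar_pos (hD : D.IsRegular S) : 0 < D.zetaBar := by
  have := hD.sx_pos
  have := hD.sy_pos
  have h : 0 < D.Lbar := by rw [hD.Lbar_eq]; positivity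
  unfold zetaBar
  positivity

theorem gam_pos (hD : D.IsRegular S) : 0 < D.gam := by
  have := hD.sx_pos
  unfold gam
  positivity

/-- From `L̄ = 3σ_x` one gets `1 + 8L̄ / σ_x = 25`. The ratio `50√5` of `γ` to the step lies between
`100` and `112`, the two bounds used below. -/
theorem zeta_mul_gam (hD : D.IsRegular S) : D.zeta * D.gam * (50 * √5) = D.gam := by
  have := hD.sx_pos
  unfold zeta
  rw [hD.Lbar_eq]
  have e : 8 * (3 * D.sx) / D.sx = 24 := by field_simp; norm_num
  rw [e]
  field_simp
  ring

theorem step_pos (hD : D.IsRegular S) : 0 < D.zeta * D.gam := by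
  have h := zeta_mul_gam hD
  have h1 := gam_pos hD
  by_contra hneg
  have : D.zeta * D.gam * (50 * √5) ≤ 0 :=
    mul_nonpos_of_nonpos_of_nonneg (not_lt.1 hneg) (by positivity)
  linarith

theorem step_le (hD : D.IsRegular S) : D.zeta * D.gam ≤ D.gam / 100 := by
  have h := zeta_mul_gam hD
  have h1 := step_pos hD
  have h2 : 2 ≤ √5 := Real.le_sqrt_of_sq_le (by norm_num)
  nlinarith

theorem le_step (hD : D.IsRegular S) : D.gam ≤ 112 * (D.zeta * D.gam) := by
  have h := zeta_mul_gam hD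
  have h1 := step_pos hD
  have h2 : √5 ≤ 224 / 100 := Real.sqrt_le_iff.2 ⟨by norm_num, by norm_num⟩
  nlinarith

/-! ### The operator of the auxiliary problem -/

theorem IsRegular.strong_monotone (hD : D.IsRegular S) {x x' : E} {y y' : F}
    (hx : x ∈ effDom D.p) (hx' : x' ∈ effDom D.p) (hy : y ∈ effDom D.q) (hy' : y' ∈ effDom D.q) :
    D.sx * ‖x - x'‖ ^ 2 + D.sy * ‖y - y'‖ ^ 2 ≤
      inner ℝ (D.gx x y - D.gx x' y') (x - x') - inner ℝ (D.gy x y - D.gy x' y') (y - y') := by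
  have h1 := hD.convex_left x hx x' hx' y hy
  have h2 := hD.convex_left x' hx' x hx y' hy'
  have h3 := hD.concave_right x hx y hy y' hy'
  have h4 := hD.concave_right x' hx' y' hy' y hy
  rw [norm_sub_rev x' x] at h1
  rw [norm_sub_rev y' y] at h3
  simp only [inner_sub_left, inner_sub_right] at *
  linarith

variable (D) in
/-- The operator `(a_x, a_y)` on the product space. -/
noncomputable def opA (zg : E) (yg : F) (x : E) (y : F) : WithLp 2 (E × F) :=
  WithLp.toLp 2 (D.ax zg x y, D.ay yg x y)

theorem norm_opA_sub_le (hD : D.IsRegular S) (zg : E) (yg : F) {x x' : E} {y y' : F}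
    (h : WithLp.toLp 2 (x, y) ∈ S) (h' : WithLp.toLp 2 (x', y') ∈ S) :
    ‖D.opA zg yg x y - D.opA zg yg x' y'‖ ≤
      7 / 2 * D.sx * ‖WithLp.toLp 2 (x, y) - WithLp.toLp 2 (x', y')‖ := by
  have hx := hD.sx_pos
  have e : D.opA zg yg x y - D.opA zg yg x' y' =
      WithLp.toLp 2 (D.gx x y - D.gx x' y', -(D.gy x y - D.gy x' y')) +
        WithLp.toLp 2 (-(D.sx / 2) • (x - x'), (D.sx / 8) • (y - y')) := by
    unfold opA ax ay hatGx hatGy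
    rw [← WithLp.toLp_sub, ← WithLp.toLp_add, Prod.mk_sub_mk, Prod.mk_add_mk]
    congr 2 <;> module
  rw [e]
  refine (norm_add_le _ _).trans ?_
  have h1 := hD.lip _ h _ h'
  rw [hD.Lbar_eq] at h1
  have e1 : ‖WithLp.toLp 2 (D.gx x y - D.gx x' y', -(D.gy x y - D.gy x' y'))‖ =
      ‖gradient D.hbar (WithLp.toLp 2 (x, y)) - gradient D.hbar (WithLp.toLp 2 (x', y'))‖ := by
    refine (sq_eq_sq₀ (norm_nonneg _) (norm_nonneg _)).1 ?_
    rw [WithLp.prod_norm_sq_eq_of_L2, WithLp.prod_norm_sq_eq_of_L2]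
    rw [WithLp.toLp_snd, norm_neg]
    rfl
  have e2 : ‖WithLp.toLp 2 (-(D.sx / 2) • (x - x'), (D.sx / 8) • (y - y'))‖ ≤
      D.sx / 2 * ‖WithLp.toLp 2 (x, y) - WithLp.toLp 2 (x', y')‖ := by
    refine (sq_le_sq₀ (norm_nonneg _) (by positivity)).1 ?_
    rw [mul_pow, WithLp.prod_norm_sq_eq_of_L2, WithLp.prod_norm_sq_eq_of_L2]
    simp only [WithLp.toLp_fst, WithLp.toLp_snd, WithLp.sub_fst, WithLp.sub_snd, norm_smul, mul_pow,
      norm_neg, Real.norm_eq_abs, sq_abs]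
    nlinarith [mul_nonneg (sq_nonneg D.sx) (sq_nonneg ‖y - y'‖)]
  rw [e1]
  linarith

/-- The operator `(a_x, a_y)` is the saddle operator with `σ_x / 2` subtracted in `x` and `σ_x / 8`
added in `y`; the strong monotonicity `σ_x` in `x` covers the loss. -/
theorem inner_opA_sub_nonneg (hD : D.IsRegular S) (zg : E) (yg : F) {x x' : E} {y y' : F}
    (hx : x ∈ effDom D.p) (hx' : x' ∈ effDom D.p) (hy : y ∈ effDom D.q) (hy' : y' ∈ effDom D.q) :
    0 ≤ inner ℝ (D.ax zg x y - D.ax zg x' y') (x - x') +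
      inner ℝ (D.ay yg x y - D.ay yg x' y') (y - y') := by
  have h := hD.strong_monotone hx hx' hy hy'
  have hsx := hD.sx_pos
  have hsy := hD.sy_pos
  have e1 : D.ax zg x y - D.ax zg x' y' = (D.gx x y - D.gx x' y') - (D.sx / 2) • (x - x') := by
    unfold ax hatGx; module
  have e2 : D.ay yg x y - D.ay yg x' y' = (D.sx / 8) • (y - y') - (D.gy x y - D.gy x' y') := by
    unfold ay hatGy; module
  rw [e1, e2, inner_sub_left, inner_sub_left (_ • _), inner_smul_left, inner_smul_left,
    real_inner_self_eq_norm_sq, real_inner_self_eq_norm_sq]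
  simp only [conj_trivial]
  nlinarith [mul_nonneg hsx.le (sq_nonneg ‖x - x'‖), mul_nonneg hsx.le (sq_nonneg ‖y - y'‖),
    mul_nonneg hsy.le (sq_nonneg ‖y - y'‖)]

/-! ### The saddle point -/

/-- A saddle point of `hbar + p - q`, by its first-order conditions. -/
structure IsSaddle (D : InnerData E F) (x : E) (y : F) : Prop where
  left : IsSubgradient D.p x (-D.gx x y)
  right : IsSubgradient D.q y (D.gy x y)

/-- The forward-backward map with step `ζ̄` is a contraction of the compact set `dom p × dom q`, and
its fixed point satisfies the first-order conditions. No minimax theorem is needed. -/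
theorem exists_isSaddle (hD : D.IsRegular S) : ∃ x y, D.IsSaddle x y := by
  set T : WithLp 2 (E × F) → WithLp 2 (E × F) := fun w => WithLp.toLp 2
    (prox D.p D.zetaBar (w.fst - D.zetaBar • D.gx w.fst w.snd),
      prox D.q D.zetaBar (w.snd + D.zetaBar • D.gy w.fst w.snd)) with hT
  have hz := zetaBar_pos hD
  have hsx := hD.sx_pos
  have hsy := hD.sy_pos
  have hL : 0 < D.Lbar := by rw [hD.Lbar_eq]; positivity
  set C : Set (WithLp 2 (E × F)) := {w | w.fst ∈ effDom D.p ∧ w.snd ∈ effDom D.q} with hC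
  have hCc : IsCompact C := by
    have h1 := (hD.hpc.prod hD.hqc).image (WithLp.prodContinuousLinearEquiv 2 ℝ E F).symm.continuous
    convert h1 using 1
    ext w
    constructor
    · intro hw; exact ⟨(w.fst, w.snd), ⟨hw.1, hw.2⟩, rfl⟩
    · rintro ⟨⟨a, b⟩, ⟨ha, hb⟩, rfl⟩; exact ⟨ha, hb⟩
  have hmaps : Set.MapsTo T C C := fun w _ =>
    ⟨hD.hp.prox_mem hD.hpc hz _, hD.hq.prox_mem hD.hqc hz _⟩
  set m := min D.sx D.sy with hm
  have hm0 : 0 < m := lt_min hsx hsy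
  have hzm : D.zetaBar * D.Lbar ^ 2 = m := by unfold zetaBar; rw [← hm]; field_simp
  have hlip : ∀ w ∈ C, ∀ w' ∈ C, ‖T w - T w'‖ ≤ Real.sqrt (1 - D.zetaBar * m) * ‖w - w'‖ := by
    intro w hw w' hw'
    have p1 := (hD.hp.isSubgradient_prox hD.hpc hz (w.fst - D.zetaBar • D.gx w.fst w.snd)).norm_sub_le hz
      (hD.hp.isSubgradient_prox hD.hpc hz (w'.fst - D.zetaBar • D.gx w'.fst w'.snd))
    have p2 := (hD.hq.isSubgradient_prox hD.hqc hz (w.snd + D.zetaBar • D.gy w.fst w.snd)).norm_sub_le hz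
      (hD.hq.isSubgradient_prox hD.hqc hz (w'.snd + D.zetaBar • D.gy w'.fst w'.snd))
    have hs := hD.strong_monotone hw.1 hw'.1 hw.2 hw'.2
    have hl := hD.lip _ (hD.mem _ hw.1 _ hw.2) _ (hD.mem _ hw'.1 _ hw'.2)
    have hl2 : ‖D.gx w.fst w.snd - D.gx w'.fst w'.snd‖ ^ 2 + ‖D.gy w.fst w.snd - D.gy w'.fst w'.snd‖ ^ 2 ≤
        D.Lbar ^ 2 * ‖w - w'‖ ^ 2 := by
      have := pow_le_pow_left₀ (norm_nonneg _) hl 2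
      rw [WithLp.prod_norm_sq_eq_of_L2, mul_pow] at this
      exact this
    have e1 : w.fst - D.zetaBar • D.gx w.fst w.snd - (w'.fst - D.zetaBar • D.gx w'.fst w'.snd) =
        (w.fst - w'.fst) - D.zetaBar • (D.gx w.fst w.snd - D.gx w'.fst w'.snd) := by module
    have e2 : w.snd + D.zetaBar • D.gy w.fst w.snd - (w'.snd + D.zetaBar • D.gy w'.fst w'.snd) =
        (w.snd - w'.snd) + D.zetaBar • (D.gy w.fst w.snd - D.gy w'.fst w'.snd) := by module
    rw [e1] at p1
    rw [e2] at p2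
    have q1 := pow_le_pow_left₀ (norm_nonneg _) p1 2
    have q2 := pow_le_pow_left₀ (norm_nonneg _) p2 2
    rw [norm_sub_sq_real (w.fst - w'.fst), norm_smul, mul_pow, inner_smul_right, Real.norm_eq_abs, sq_abs, real_inner_comm] at q1
    rw [norm_add_sq_real, norm_smul, mul_pow, inner_smul_right, Real.norm_eq_abs, sq_abs, real_inner_comm] at q2
    have hn : ‖w - w'‖ ^ 2 = ‖w.fst - w'.fst‖ ^ 2 + ‖w.snd - w'.snd‖ ^ 2 :=
      WithLp.prod_norm_sq_eq_of_L2 _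
    -- Expanding the square gives `1 - 2ζ̄m + ζ̄²L̄²`, and `ζ̄ L̄² = m` by the choice of `ζ̄`.
    have hn2 : ‖T w - T w'‖ ^ 2 ≤ (1 - D.zetaBar * m) * ‖w - w'‖ ^ 2 := by
      rw [WithLp.prod_norm_sq_eq_of_L2]
      have b1 : m * ‖w - w'‖ ^ 2 ≤ D.sx * ‖w.fst - w'.fst‖ ^ 2 + D.sy * ‖w.snd - w'.snd‖ ^ 2 := by
        rw [hn, mul_add]
        gcongr
        · exact min_le_left _ _
        · exact min_le_right _ _
      have b2 := mul_le_mul_of_nonneg_left (b1.trans hs) hz.le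
      have b3 := mul_le_mul_of_nonneg_left hl2 (sq_nonneg D.zetaBar)
      have b4 : D.zetaBar ^ 2 * (D.Lbar ^ 2 * ‖w - w'‖ ^ 2) = D.zetaBar * m * ‖w - w'‖ ^ 2 := by
        rw [← hzm]; ring
      rw [b4] at b3
      change ‖prox D.p D.zetaBar _ - prox D.p D.zetaBar _‖ ^ 2 + ‖prox D.q D.zetaBar _ - prox D.q D.zetaBar _‖ ^ 2 ≤ _
      nlinarith
    by_cases hw0 : ‖w - w'‖ = 0
    · rw [hw0] at hn2 ⊢
      have : ‖T w - T w'‖ ^ 2 ≤ 0 := by simpa using hn2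
      have : ‖T w - T w'‖ = 0 := by nlinarith [norm_nonneg (T w - T w')]
      simp [this]
    · have hpos : 0 < ‖w - w'‖ := lt_of_le_of_ne (norm_nonneg _) (Ne.symm hw0)
      have h0 : 0 ≤ 1 - D.zetaBar * m := by
        by_contra hneg
        nlinarith [sq_nonneg ‖T w - T w'‖, pow_pos hpos 2]
      refine (sq_le_sq₀ (norm_nonneg _) (by positivity)).1 ?_
      rwa [mul_pow, Real.sq_sqrt h0]
  have hK : ContractingWith (Real.toNNReal (Real.sqrt (1 - D.zetaBar * m))) (hmaps.restrict T C C) := by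
    refine ⟨?_, ?_⟩
    · rw [← NNReal.coe_lt_coe, Real.coe_toNNReal _ (Real.sqrt_nonneg _), NNReal.coe_one,
        Real.sqrt_lt' one_pos]
      have : 0 < D.zetaBar * m := by positivity
      linarith
    · refine LipschitzWith.of_dist_le_mul fun w w' => ?_
      rw [Real.coe_toNNReal _ (Real.sqrt_nonneg _)]
      simpa [Subtype.dist_eq, dist_eq_norm] using hlip w w.2 w' w'.2
  obtain ⟨x1, hx1⟩ := hD.hp.nonempty_dom
  obtain ⟨y1, hy1⟩ := hD.hq.nonempty_dom
  obtain ⟨w, hw, hfix, -⟩ := hK.exists_fixedPoint' hCc.isComplete hmaps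
    (x := WithLp.toLp 2 (x1, y1)) ⟨hx1, hy1⟩ (edist_ne_top _ _)
  have f1 : prox D.p D.zetaBar (w.fst - D.zetaBar • D.gx w.fst w.snd) = w.fst :=
    congrArg (fun z : WithLp 2 (E × F) => z.fst) hfix
  have f2 : prox D.q D.zetaBar (w.snd + D.zetaBar • D.gy w.fst w.snd) = w.snd :=
    congrArg (fun z : WithLp 2 (E × F) => z.snd) hfix
  refine ⟨w.fst, w.snd, ?_, ?_⟩
  · have := hD.hp.isSubgradient_prox hD.hpc hz (w.fst - D.zetaBar • D.gx w.fst w.snd)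
    rw [f1] at this
    convert this using 1
    rw [sub_sub_cancel_left, smul_neg, smul_smul, one_div, inv_mul_cancel₀ hz.ne', one_smul]
  · have := hD.hq.isSubgradient_prox hD.hqc hz (w.snd + D.zetaBar • D.gy w.fst w.snd)
    rw [f2] at this
    convert this using 1
    rw [add_sub_cancel_left, smul_smul, one_div, inv_mul_cancel₀ hz.ne', one_smul]

end InnerData

end InnerMethod

/-! ### The `while` loop as an anchored iteration, and its length. -/

section WhileLoop

variable {E F : Type*} [NormedAddCommGroup E] [InnerProductSpace ℝ E] [CompleteSpace E]
  [NormedAddCommGroup F] [InnerProductSpace ℝ F] [CompleteSpace F]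

namespace InnerData

variable (D : InnerData E F) {S : Set (WithLp 2 (E × F))}

/-- The variables at the first test of the `while` loop. -/
noncomputable def enterVars (v : HeadVars E F) : LoopVars E F :=
  let zg := D.alpha • v.z + (1 - D.alpha) • v.zf
  let yg := D.alpha • v.y + (1 - D.alpha) • v.yf
  let xm := -(D.sx⁻¹ • zg)
  let r := D.zeta * D.gam
  let u := xm - r • D.ax zg xm yg
  let w := yg - r • D.ay yg xm yg
  let x0 := prox D.p r u
  let y0 := prox D.q r w
  { zg := zg, yg := yg, x0 := x0, y0 := y0, t := 0, x := x0, y := y0,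
    bx := (1 / r) • (u - x0), by' := (1 / r) • (w - y0) }

/-- The point from which the first forward-backward step is taken. -/
noncomputable def enterPoint (v : HeadVars E F) : WithLp 2 (E × F) :=
  WithLp.toLp 2 (-(D.sx⁻¹ • (D.enterVars v).zg), (D.enterVars v).yg)

theorem enter_eq (v : HeadVars E F) :
    D.enter v = (.loop v (D.enterVars v), ⟨[D.enterPoint v], 1, 1⟩) := rfl

/-- The intermediate point of the body of the `while` loop. -/
noncomputable def halfPoint (w : LoopVars E F) : WithLp 2 (E × F) :=
  let r := D.zeta * D.gam
  WithLp.toLp 2 (w.x + beta w.t • (w.x0 - w.x) - r • (D.ax w.zg w.x w.y + w.bx),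
    w.y + beta w.t • (w.y0 - w.y) - r • (D.ay w.yg w.x w.y + w.by'))

/-- The successive variables of the `while` loop. -/
noncomputable def loopSeq (v : HeadVars E F) : ℕ → LoopVars E F
  | 0 => D.enterVars v
  | t + 1 => (D.body (loopSeq v t)).1

variable {D}

theorem loopSeq_const (v : HeadVars E F) (t : ℕ) :
    (D.loopSeq v t).zg = (D.enterVars v).zg ∧ (D.loopSeq v t).yg = (D.enterVars v).yg ∧
      (D.loopSeq v t).x0 = (D.enterVars v).x ∧ (D.loopSeq v t).y0 = (D.enterVars v).y ∧
      (D.loopSeq v t).t = t := by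
  induction t with
  | zero => exact ⟨rfl, rfl, rfl, rfl, rfl⟩
  | succ t ih =>
    obtain ⟨h1, h2, h3, h4, h5⟩ := ih
    refine ⟨h1, h2, h3, h4, ?_⟩
    change (D.loopSeq v t).t + 1 = t + 1
    rw [h5]

theorem loopSeq_isSubgradient (hD : D.IsRegular S) (v : HeadVars E F) (t : ℕ) :
    IsSubgradient D.p (D.loopSeq v t).x (D.loopSeq v t).bx ∧
      IsSubgradient D.q (D.loopSeq v t).y (D.loopSeq v t).by' := by
  cases t with
  | zero =>
    exact ⟨hD.hp.isSubgradient_prox hD.hpc (step_pos hD) _,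
      hD.hq.isSubgradient_prox hD.hqc (step_pos hD) _⟩
  | succ t =>
    exact ⟨hD.hp.isSubgradient_prox hD.hpc (step_pos hD) _,
      hD.hq.isSubgradient_prox hD.hqc (step_pos hD) _⟩

/-- `anchored_stop` is applied in the product space with `g = a + b`, where `b` collects the
subgradients produced by the proximal steps. Only the points that the loop itself queries must lie
in `S`; the iterates do so because proximal points are in the domains. -/
theorem not_continues_loopSeq (hD : D.IsRegular S) (v : HeadVars E F)
    (h0 : D.enterPoint v ∈ S) (hhalf : ∀ t ≤ 999, D.halfPoint (D.loopSeq v t) ∈ S) :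
    ¬ D.continues (D.loopSeq v 1000) := by
  set W := D.loopSeq v with hW
  set zg := (D.enterVars v).zg with hzg
  set yg := (D.enterVars v).yg with hyg
  set r := D.zeta * D.gam with hr
  have hr0 : 0 < r := step_pos hD
  have hsx := hD.sx_pos
  have hG := gam_pos hD
  have hsub := loopSeq_isSubgradient hD v
  have hmem : ∀ t, WithLp.toLp 2 ((W t).x, (W t).y) ∈ S := fun t =>
    hD.mem _ (hsub t).1.1 _ (hsub t).2.1
  set u : ℕ → WithLp 2 (E × F) := fun t => WithLp.toLp 2 ((W t).x, (W t).y) with hu_def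
  set a : ℕ → WithLp 2 (E × F) := fun t => D.opA zg yg (W t).x (W t).y with ha_def
  set b : ℕ → WithLp 2 (E × F) := fun t => WithLp.toLp 2 ((W t).bx, (W t).by') with hb_def
  set ah : ℕ → WithLp 2 (E × F) := fun t =>
    D.opA zg yg (D.halfPoint (W t)).fst (D.halfPoint (W t)).snd with hah_def
  set um := D.enterPoint v with hum_def
  set am := D.opA zg yg um.fst um.snd with ham_def
  have hhalf_eq : ∀ t : ℕ, D.halfPoint (W t) =
      u t + (2 / ((t : ℝ) + 3)) • (u 0 - u t) - r • (a t + b t) := by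
    intro t
    obtain ⟨h1, h2, h3, h4, h5⟩ := loopSeq_const (D := D) v t
    change WithLp.toLp 2 ((W t).x + beta (W t).t • ((W t).x0 - (W t).x) -
      r • (D.ax (W t).zg (W t).x (W t).y + (W t).bx),
      (W t).y + beta (W t).t • ((W t).y0 - (W t).y) -
      r • (D.ay (W t).yg (W t).x (W t).y + (W t).by')) = _
    rw [h1, h2, h3, h4, h5]
    rfl
  -- By the definition of `b`, the proximal step is an implicit step along the subgradient, so the
  -- full step uses `ah t + b (t + 1)`.
  have hunext : ∀ t : ℕ, u (t + 1) =
      u t + (2 / ((t : ℝ) + 3)) • (u 0 - u t) - r • (ah t + b (t + 1)) := by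
    intro t
    obtain ⟨h1, h2, h3, h4, h5⟩ := loopSeq_const (D := D) v t
    have e : b (t + 1) = (1 / r) • (u t + (2 / ((t : ℝ) + 3)) • (u 0 - u t) - r • ah t - u (t + 1)) := by
      change WithLp.toLp 2 ((1 / r) • ((W t).x + beta (W t).t • ((W t).x0 - (W t).x) -
        r • D.ax (W t).zg (D.halfPoint (W t)).fst (D.halfPoint (W t)).snd - (W (t + 1)).x),
        (1 / r) • ((W t).y + beta (W t).t • ((W t).y0 - (W t).y) -
        r • D.ay (W t).yg (D.halfPoint (W t)).fst (D.halfPoint (W t)).snd - (W (t + 1)).y)) = _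
      rw [h1, h2, h3, h4, h5]
      rfl
    rw [e, smul_add, smul_smul, mul_one_div_cancel hr0.ne', one_smul]
    abel
  have hlipA : ∀ x y x' y', WithLp.toLp 2 (x, y) ∈ S → WithLp.toLp 2 (x', y') ∈ S →
      r * ‖D.opA zg yg x y - D.opA zg yg x' y'‖ ≤
        28 / 100 * ‖WithLp.toLp 2 (x, y) - WithLp.toLp 2 (x', y')‖ := by
    intro x y x' y' h h'
    have h1 := norm_opA_sub_le hD zg yg h h'
    have h2 : r * (7 / 2 * D.sx) ≤ 28 / 100 := by
      have h3 : r ≤ D.gam / 100 := step_le hD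
      have h4 : D.gam * D.sx = 8 := by unfold gam; field_simp
      nlinarith
    calc _ ≤ r * (7 / 2 * D.sx * ‖WithLp.toLp 2 (x, y) - WithLp.toLp 2 (x', y')‖) := by gcongr
      _ = r * (7 / 2 * D.sx) * ‖WithLp.toLp 2 (x, y) - WithLp.toLp 2 (x', y')‖ := by ring
      _ ≤ _ := by gcongr
  have key := anchored_stop (r := r) (G := D.gam) hr0 hG (u := u) (g := fun t => a t + b t)
    (gh := fun t => ah t + b (t + 1)) (a := a) (um := um) (am := am) (t := 999)
    (fun s _ => hunext s)
    (by
      intro s hs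
      have e1 : a (s + 1) + b (s + 1) - (ah s + b (s + 1)) = a (s + 1) - ah s := by abel
      have h1 : r * ‖a (s + 1) - ah s‖ ≤ 28 / 100 * ‖u (s + 1) - D.halfPoint (W s)‖ :=
        hlipA _ _ _ _ (hmem (s + 1)) (hhalf s hs)
      have e2 : u (s + 1) - D.halfPoint (W s) = r • (a s + b s - (ah s + b (s + 1))) := by
        rw [hhalf_eq, hunext, smul_sub r (a s + b s)]; abel
      rw [e2, norm_smul, Real.norm_of_nonneg hr0.le] at h1
      -- Squaring gives `0.28² = 0.0784 ≤ 1/10`.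
      have h2 : ‖a (s + 1) - ah s‖ ≤ 28 / 100 * ‖a s + b s - (ah s + b (s + 1))‖ := by
        rw [← mul_le_mul_iff_right₀ hr0]; linarith
      rw [e1]
      have h3 := pow_le_pow_left₀ (norm_nonneg _) h2 2
      rw [mul_pow] at h3
      nlinarith [sq_nonneg ‖a s + b s - (ah s + b (s + 1))‖])
    (by
      intro s _
      have h1 := inner_opA_sub_nonneg hD zg yg (hsub (s + 1)).1.1 (hsub s).1.1 (hsub (s + 1)).2.1
        (hsub s).2.1
      have h2 := (hsub (s + 1)).1.monotone (hsub s).1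
      have h3 := (hsub (s + 1)).2.monotone (hsub s).2
      have e : a (s + 1) + b (s + 1) - (a s + b s) = (a (s + 1) - a s) + (b (s + 1) - b s) := by abel
      rw [e, inner_add_left, WithLp.prod_inner_apply, WithLp.prod_inner_apply]
      have h4 := add_nonneg h1 (add_nonneg h2 h3)
      exact h4)
    (by
      have h2 := (hsub 1000).1.monotone (hsub 0).1
      have h3 := (hsub 1000).2.monotone (hsub 0).2
      rw [add_sub_cancel_left, add_sub_cancel_left, WithLp.prod_inner_apply]
      exact add_nonneg h2 h3)
    (by
      have e : b 0 = (1 / r) • (um - r • am - u 0) := rfl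
      change um - u 0 = r • (am + (a 0 + b 0 - a 0))
      rw [add_sub_cancel_left, e, smul_add, smul_smul, mul_one_div_cancel hr0.ne', one_smul]
      abel)
    (step_le hD)
    (fun s => hlipA _ _ _ _ h0 (hmem s))
    -- With `γ ≤ 112 r` this is `7 · 112 = 784 ≤ 1002`.
    (by have : D.gam ≤ 112 * r := le_step hD
        push_cast
        nlinarith)
  rw [continues, not_lt]
  obtain ⟨h1, h2, -, -, -⟩ := loopSeq_const (D := D) v 1000
  rw [WithLp.prod_norm_sq_eq_of_L2, WithLp.prod_norm_sq_eq_of_L2] at key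
  have key2 : D.gam ^ 2 * (‖D.ax (W 1000).zg (W 1000).x (W 1000).y + (W 1000).bx‖ ^ 2 +
      ‖D.ay (W 1000).yg (W 1000).x (W 1000).y + (W 1000).by'‖ ^ 2) ≤
      ‖(W 1000).x - -(D.sx⁻¹ • (W 1000).zg)‖ ^ 2 + ‖(W 1000).y - (W 1000).yg‖ ^ 2 := by
    rw [h1, h2]; exact key
  rw [← mul_add, ← mul_add, ← mul_le_mul_iff_right₀ hG, mul_inv_cancel_left₀ hG.ne']
  linarith

end InnerData

end WhileLoop

/-! ### The dual problem and the contraction of the Lyapunov function. -/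

section Lyapunov

/-- By the parallelogram law, `‖μd - g‖² ≤ 2μ²‖d‖² + 2‖g‖²` with `d = x' - x`; the term in `‖d‖²` is
absorbed because `ημ ≤ 1/2`. -/
theorem norm_step_sq_le {H : Type*} [NormedAddCommGroup H] [InnerProductSpace ℝ H] {η μ : ℝ}
    (hη : 0 < η) (hμ : 0 < μ) (hημ : η * μ ≤ 1 / 2) (x x' xs g : H) :
    ‖x + (η * μ) • (x' - x) - η • g - xs‖ ^ 2 / η ≤
      (1 - η * μ) * (‖x - xs‖ ^ 2 / η) + μ * ‖x' - xs‖ ^ 2 - 2 * inner ℝ g (x - xs) +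
        2 * η * ‖g‖ ^ 2 := by
  have e1 : x + (η * μ) • (x' - x) - η • g - xs = (x - xs) + η • (μ • (x' - x) - g) := by module
  have e2 : x' - xs = (x - xs) + (x' - x) := by abel
  have h1 : 0 ≤ ‖μ • (x' - x) + g‖ ^ 2 := sq_nonneg _
  rw [e1, e2]
  generalize x - xs = a at *
  generalize x' - x = d at *
  rw [norm_add_sq_real, norm_add_sq_real, inner_smul_right, norm_smul,
    mul_pow, Real.norm_eq_abs, sq_abs, norm_sub_sq_real, inner_sub_right, inner_smul_right,
    inner_smul_left, norm_smul, mul_pow, Real.norm_eq_abs, sq_abs, real_inner_comm g]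
  rw [norm_add_sq_real, inner_smul_left, norm_smul, mul_pow, Real.norm_eq_abs, sq_abs] at h1
  simp only [conj_trivial] at h1 ⊢
  rw [div_le_iff₀ hη]
  have h2 : 0 ≤ μ * η * (1 / 2 - η * μ) * ‖d‖ ^ 2 := by
    have : 0 ≤ 1 / 2 - η * μ := by linarith
    positivity
  have e3 : (1 - η * μ) * (‖a‖ ^ 2 / η) * η = (1 - η * μ) * ‖a‖ ^ 2 := by field_simp
  have h3 := mul_nonneg (sq_nonneg η) h1
  nlinarith

variable {E F : Type*} [NormedAddCommGroup E] [InnerProductSpace ℝ E]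
  [NormedAddCommGroup F] [InnerProductSpace ℝ F]

/-- The error of an inexact proximal step that passes the relative test. -/
theorem relative_test_le {sx : ℝ} (hsx : 0 < sx) {u d : E} {v e : F}
    (h : 8 / sx * ‖(1 / 2 : ℝ) • (d + sx • u)‖ ^ 2 + 8 / sx * ‖v + (sx / 8) • e‖ ^ 2 ≤
      sx / 8 * ‖u - sx⁻¹ • d‖ ^ 2 + sx / 8 * ‖e‖ ^ 2) :
    2 * inner ℝ u d + 2 * inner ℝ v e + sx * ‖u‖ ^ 2 + 8 / sx * ‖v‖ ^ 2 ≤ 0 := by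
  rw [norm_smul, mul_pow, norm_add_sq_real, norm_add_sq_real, norm_sub_sq_real, inner_smul_right,
    inner_smul_right, inner_smul_right, norm_smul, norm_smul, norm_smul, mul_pow, mul_pow, mul_pow] at h
  simp only [Real.norm_eq_abs, sq_abs] at h
  -- Once the test is expanded the terms in `‖e‖²` cancel, and what separates it from the claim is
  -- `7/8` of a quadratic form in `u, d` with cross coefficient `18/7`. It is nonnegative since
  -- `(9/7)² < 15/7`.
  have h0 : 0 ≤ ‖sx • u + (9 / 7 : ℝ) • d‖ ^ 2 := sq_nonneg _
  rw [norm_add_sq_real, inner_smul_left, inner_smul_right, norm_smul, norm_smul, mul_pow,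
    mul_pow] at h0
  simp only [Real.norm_eq_abs, sq_abs, conj_trivial] at h0
  rw [real_inner_comm] at h
  have hinv : sx * sx⁻¹ = 1 := mul_inv_cancel₀ hsx.ne'
  have e1 : 8 / sx = 8 * sx⁻¹ := by ring
  rw [e1] at h ⊢
  have hi : 0 < sx⁻¹ := inv_pos.2 hsx
  have k1 := mul_nonneg hi.le h0
  have k2 := mul_nonneg hi.le (sq_nonneg ‖d‖)
  generalize inner ℝ u d = a at *
  generalize inner ℝ v e = b at *
  generalize ‖u‖ ^ 2 = U at *
  generalize ‖v‖ ^ 2 = V at *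
  generalize ‖d‖ ^ 2 = Dd at *
  generalize ‖e‖ ^ 2 = Ee at *
  generalize sx⁻¹ = i at *
  have x1 : 8 * i * ((1 / 2) ^ 2 * (Dd + 2 * (sx * a) + sx ^ 2 * U)) =
      2 * (i * Dd) + 4 * (sx * i) * a + 2 * (sx * i) * sx * U := by ring
  have x2 : 8 * i * (V + 2 * (sx / 8 * b) + (sx / 8) ^ 2 * Ee) =
      8 * i * V + 2 * (sx * i) * b + (sx * i) * sx / 8 * Ee := by ring
  have x3 : sx / 8 * (U - 2 * (i * a) + i ^ 2 * Dd) =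
      sx / 8 * U - (sx * i) / 4 * a + (sx * i) / 8 * (i * Dd) := by ring
  have x4 : i * (sx ^ 2 * U + 2 * (sx * (9 / 7 * a)) + (9 / 7) ^ 2 * Dd) =
      (sx * i) * sx * U + 18 / 7 * (sx * i) * a + 81 / 49 * (i * Dd) := by ring
  rw [x1, x2, x3] at h
  rw [x4] at k1
  rw [hinv] at *
  linarith

variable [CompleteSpace E] [CompleteSpace F]

namespace InnerData

variable (D : InnerData E F) {S : Set (WithLp 2 (E × F))}

/-- The finite value `hbar(x, y) + p(x) - q(y)` of the objective on its domain. -/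
def payoff (x : E) (y : F) : ℝ :=
  D.hbar (WithLp.toLp 2 (x, y)) + (D.p x).toReal - (D.q y).toReal

/-- The function whose supremum over `x` is the objective of the dual problem in `(z, y)` that the
inner method minimizes. -/
noncomputable def dualValue (z : E) (y : F) (x : E) : ℝ :=
  ‖z + D.sx • x‖ ^ 2 / (2 * D.sx) - D.payoff x y

/-- `π` bounds the objective of the dual problem at `(z, y)`. -/
def IsDualBound (z : E) (y : F) (π : ℝ) : Prop :=
  ∀ x ∈ effDom D.p, D.dualValue z y x ≤ π

/-- The Lyapunov function of the inner method, relative to the saddle point `(xs, ys)`. -/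
noncomputable def lyapunov (xs : E) (ys : F) (z : E) (y : F) (π : ℝ) : ℝ :=
  ‖z + D.sx • xs‖ ^ 2 / D.etaZ + ‖y - ys‖ ^ 2 / D.etaY + 2 / D.alpha * (π + D.payoff xs ys)

/-- The variables of the next iteration of the `for` loop. -/
noncomputable def leaveVars (v : HeadVars E F) (w : LoopVars E F) : HeadVars E F :=
  let zf := D.hatGx w.x w.y + w.bx
  let wf := -D.hatGy w.x w.y + w.by'
  { z := v.z + (D.etaZ * D.sx⁻¹) • (zf - v.z) - D.etaZ • (w.x + D.sx⁻¹ • zf)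
    y := v.y + (D.etaY * D.sy) • (w.y - v.y) - D.etaY • (wf + D.sy • w.y)
    zf := zf
    yf := w.y }

variable {D}

/-- The vector `∇_x hbar - σ_x x + b` is a subgradient at `x` of the convex function `ĥ(·, y) + p`,
so the supremum defining the dual objective is attained at `x`. -/
theorem dualValue_le (hD : D.IsRegular S) {x x' b : E} {y : F} (hb : IsSubgradient D.p x b)
    (hy : y ∈ effDom D.q) (hx' : x' ∈ effDom D.p) :
    D.dualValue (D.gx x y - D.sx • x + b) y x' ≤ D.dualValue (D.gx x y - D.sx • x + b) y x := by
  have hsx := hD.sx_pos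
  have h1 := hD.convex_left x hb.1 x' hx' y hy
  have h2 := hb.2 x' hx'
  unfold dualValue payoff
  have e1 : D.gx x y - D.sx • x + b + D.sx • x' = (D.gx x y + b) + D.sx • (x' - x) := by module
  have e2 : D.gx x y - D.sx • x + b + D.sx • x = D.gx x y + b := by module
  rw [e1, e2, norm_add_sq_real, inner_smul_right, norm_smul, mul_pow, Real.norm_eq_abs, sq_abs,
    inner_add_left]
  have e3 : (‖D.gx x y + b‖ ^ 2 + 2 * (D.sx * (inner ℝ (D.gx x y) (x' - x) + inner ℝ b (x' - x))) +
      D.sx ^ 2 * ‖x' - x‖ ^ 2) / (2 * D.sx) = ‖D.gx x y + b‖ ^ 2 / (2 * D.sx) +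
      inner ℝ (D.gx x y) (x' - x) + inner ℝ b (x' - x) + D.sx / 2 * ‖x' - x‖ ^ 2 := by
    field_simp
    ring
  rw [e3]
  linarith

/-- For fixed `x` the expression is strongly convex in `(z, y)`, with modulus `1 / σ_x` in `z` and
`σ_y` in `y`, and `(x + σ_x⁻¹ z', c - ∇_y hbar)` is a subgradient at `(z', y')`. -/
theorem le_dualValue (hD : D.IsRegular S) {x z z' : E} {y y' c : F} (hx : x ∈ effDom D.p)
    (hc : IsSubgradient D.q y' c) (hy : y ∈ effDom D.q) :
    D.dualValue z' y' x + inner ℝ (x + D.sx⁻¹ • z') (z - z') + 1 / D.sx / 2 * ‖z - z'‖ ^ 2 +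
      inner ℝ (c - D.gy x y') (y - y') + D.sy / 2 * ‖y - y'‖ ^ 2 ≤ D.dualValue z y x := by
  have hsx := hD.sx_pos
  have h1 := hD.concave_right x hx y' hc.1 y hy
  have h2 := hc.2 y hy
  unfold dualValue payoff
  have e1 : z + D.sx • x = D.sx • (x + D.sx⁻¹ • z') + (z - z') := by
    rw [smul_add, smul_smul, mul_inv_cancel₀ hsx.ne']; module
  have e2 : z' + D.sx • x = D.sx • (x + D.sx⁻¹ • z') := by
    rw [smul_add, smul_smul, mul_inv_cancel₀ hsx.ne']; module
  rw [e1, e2, norm_add_sq_real, inner_smul_left, inner_sub_left]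
  simp only [conj_trivial]
  have e3 : ∀ N i M : ℝ, (N + 2 * (D.sx * i) + M) / (2 * D.sx) = N / (2 * D.sx) + i + 1 / D.sx / 2 * M := by
    intro N i M
    field_simp
  rw [e3]
  linarith

theorem IsSaddle.payoff_le (hD : D.IsRegular S) {xs : E} {ys : F} (hs : D.IsSaddle xs ys) {x : E}
    (hx : x ∈ effDom D.p) : D.payoff xs ys + D.sx / 2 * ‖x - xs‖ ^ 2 ≤ D.payoff x ys := by
  have h1 := hD.convex_left xs hs.left.1 x hx ys hs.right.1
  have h2 := hs.left.2 x hx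
  rw [inner_neg_left] at h2
  unfold payoff
  linarith

theorem IsSaddle.le_payoff (hD : D.IsRegular S) {xs : E} {ys : F} (hs : D.IsSaddle xs ys) {y : F}
    (hy : y ∈ effDom D.q) : D.payoff xs y ≤ D.payoff xs ys := by
  have h1 := hD.concave_right xs hs.left.1 ys hs.right.1 y hy
  have h2 := hs.right.2 y hy
  have h3 := mul_nonneg hD.sy_pos.le (sq_nonneg ‖y - ys‖)
  unfold payoff
  linarith

theorem IsSaddle.dualValue_le (hD : D.IsRegular S) {xs : E} {ys : F} (hs : D.IsSaddle xs ys) {x : E}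
    (hx : x ∈ effDom D.p) : D.dualValue (-(D.sx • xs)) ys x ≤ -D.payoff xs ys := by
  have hsx := hD.sx_pos
  have h1 := hs.payoff_le hD hx
  have e : -(D.sx • xs) + D.sx • x = D.sx • (x - xs) := by module
  unfold dualValue
  rw [e, norm_smul, mul_pow, Real.norm_eq_abs, sq_abs]
  have e2 : D.sx ^ 2 * ‖x - xs‖ ^ 2 / (2 * D.sx) = D.sx / 2 * ‖x - xs‖ ^ 2 := by field_simp
  linarith

theorem IsSaddle.neg_payoff_le (hD : D.IsRegular S) {xs : E} {ys : F} (hs : D.IsSaddle xs ys)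
    {z : E} {y : F} (hy : y ∈ effDom D.q) {π : ℝ} (hπ : D.IsDualBound z y π) :
    -D.payoff xs ys ≤ π := by
  have hsx := hD.sx_pos
  refine le_trans ?_ (hπ xs hs.left.1)
  have h1 := hs.le_payoff hD hy
  unfold dualValue
  have : 0 ≤ ‖z + D.sx • xs‖ ^ 2 / (2 * D.sx) := by positivity
  linarith

/-- The standard estimate for accelerated proximal point methods. The pair `(u, c)` is a dual
subgradient at the new point, and the extrapolation formula splits its product with `(v.z + σ_x x*,
v.y - y*)` into three pieces. These are controlled by the relative test, by convexity against the
old point `(v.zf, v.yf)`, and by strong convexity against the saddle point. An upper bound `π`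
stands in for the dual objective, so an explicit bound can be used at the start. -/
theorem lyapunov_leaveVars_le (hD : D.IsRegular S) {xs : E} {ys : F} (hs : D.IsSaddle xs ys)
    {v : HeadVars E F} {π : ℝ} (hyf : v.yf ∈ effDom D.q) (hπ : D.IsDualBound v.zf v.yf π)
    {w : LoopVars E F} (hbx : IsSubgradient D.p w.x w.bx) (hby : IsSubgradient D.q w.y w.by')
    (hzg : w.zg = D.alpha • v.z + (1 - D.alpha) • v.zf)
    (hyg : w.yg = D.alpha • v.y + (1 - D.alpha) • v.yf) (hw : ¬ D.continues w) :
    ∃ π', D.IsDualBound (D.leaveVars v w).zf (D.leaveVars v w).yf π' ∧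
      D.lyapunov xs ys (D.leaveVars v w).z (D.leaveVars v w).y π' ≤
        (1 - D.alpha / 2) * D.lyapunov xs ys v.z v.y π := by
  have hsx := hD.sx_pos
  have hsy := hD.sy_pos
  have hα := alpha_pos hD
  have hα1 := alpha_le_one (D := D)
  have hη := etaY_pos hD
  have hηs := etaY_mul_sy hD
  set zf := D.hatGx w.x w.y + w.bx with hzf
  set u := w.x + D.sx⁻¹ • zf with hu
  set c := w.by' - D.gy w.x w.y with hc
  have hzf' : zf = D.gx w.x w.y - D.sx • w.x + w.bx := rfl
  refine ⟨D.dualValue zf w.y w.x, fun x hx => ?_, ?_⟩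
  · change D.dualValue zf w.y x ≤ _
    rw [hzf']
    exact dualValue_le hD hbx hby.1 hx
  set π' := D.dualValue zf w.y w.x with hπ'
  -- the updates
  have ez : (D.leaveVars v w).z = v.z + (D.etaZ * D.sx⁻¹) • (zf - v.z) - D.etaZ • u := rfl
  have ey : (D.leaveVars v w).y = v.y + (D.etaY * D.sy) • (w.y - v.y) - D.etaY • c := by
    change v.y + (D.etaY * D.sy) • (w.y - v.y) - D.etaY •
      (-(D.gy w.x w.y + D.sy • w.y) + w.by' + D.sy • w.y) = _
    rw [hc]
    module
  have hZ : D.etaZ = D.sx / 2 := rfl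
  have hZs : D.etaZ * D.sx⁻¹ = 1 / 2 := by rw [hZ]; field_simp
  have sz := norm_step_sq_le (η := D.etaZ) (μ := D.sx⁻¹) (by rw [hZ]; positivity) (by positivity)
    hZs.le v.z zf (-(D.sx • xs)) u
  have sy := norm_step_sq_le (η := D.etaY) (μ := D.sy) hη hsy (by rw [hηs]; linarith) v.y w.y ys c
  rw [← ez, sub_neg_eq_add, sub_neg_eq_add, sub_neg_eq_add, hZs] at sz
  rw [← ey, hηs] at sy
  -- the dual inequalities
  have i1 := (le_dualValue hD (z := v.zf) (z' := zf) hbx.1 hby hyf).trans (hπ w.x hbx.1)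
  have i2 := (le_dualValue hD (z := -(D.sx • xs)) (z' := zf) hbx.1 hby hs.right.1).trans
    (hs.dualValue_le hD hbx.1)
  have i3 := hs.neg_payoff_le hD hyf hπ
  rw [← hπ', ← hu, ← hc] at i1 i2
  -- the test
  have test : 2 * inner ℝ u (zf - w.zg) + 2 * inner ℝ c (w.y - w.yg) + D.sx * ‖u‖ ^ 2 +
      8 / D.sx * ‖c‖ ^ 2 ≤ 0 := by
    apply relative_test_le hsx
    rw [continues, not_lt] at hw
    have g1 : D.gam = 8 / D.sx := rfl
    have g2 : D.gam⁻¹ = D.sx / 8 := by rw [g1, inv_div]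
    rw [g2, g1] at hw
    have t1 : D.ax w.zg w.x w.y + w.bx = (1 / 2 : ℝ) • (zf - w.zg + D.sx • u) := by
      have e0 : D.sx • u = D.sx • w.x + zf := by
        rw [hu, smul_add, smul_smul, mul_inv_cancel₀ hsx.ne', one_smul]
      have e1 : (D.sx / 2) • D.sx⁻¹ • w.zg = (1 / 2 : ℝ) • w.zg := by
        rw [smul_smul]; congr 1
      rw [e0, ax, smul_sub, e1, hzf]
      module
    have t2 : D.ay w.yg w.x w.y + w.by' = c + (D.sx / 8) • (w.y - w.yg) := by
      rw [ay, hatGy, hc]; module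
    have t3 : w.x - -(D.sx⁻¹ • w.zg) = u - D.sx⁻¹ • (zf - w.zg) := by rw [hu]; module
    rw [t1, t2, t3] at hw
    exact hw
  set i := 1 / D.alpha with hi
  have hi1 : 1 ≤ i := by rw [hi, le_div_iff₀ hα]; linarith
  have hαi : D.alpha * i = 1 := by rw [hi]; field_simp
  -- decomposition of the inner products
  have dz : inner ℝ u (v.z + D.sx • xs) = -i * inner ℝ u (zf - w.zg) -
      (i - 1) * inner ℝ u (v.zf - zf) - inner ℝ u (-(D.sx • xs) - zf) := by
    have : i • w.zg = v.z + (i - 1) • v.zf := by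
      rw [hzg, smul_add, smul_smul, smul_smul, mul_comm i, hαi, one_smul, mul_sub, mul_comm i D.alpha,
        hαi, mul_one]
    have e : v.z + D.sx • xs = (-i) • (zf - w.zg) - (i - 1) • (v.zf - zf) - (-(D.sx • xs) - zf) := by
      rw [neg_smul, smul_sub i, this]; module
    rw [e, inner_sub_right, inner_sub_right, inner_smul_right, inner_smul_right]
  have dy : inner ℝ c (v.y - ys) = -i * inner ℝ c (w.y - w.yg) -
      (i - 1) * inner ℝ c (v.yf - w.y) - inner ℝ c (ys - w.y) := by
    have : i • w.yg = v.y + (i - 1) • v.yf := by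
      rw [hyg, smul_add, smul_smul, smul_smul, mul_comm i, hαi, one_smul, mul_sub, mul_comm i D.alpha,
        hαi, mul_one]
    have e : v.y - ys = (-i) • (w.y - w.yg) - (i - 1) • (v.yf - w.y) - (ys - w.y) := by
      rw [neg_smul, smul_sub i, this]; module
    rw [e, inner_sub_right, inner_sub_right, inner_smul_right, inner_smul_right]
  rw [dz] at sz
  rw [dy] at sy
  have n1 : ‖zf + D.sx • xs‖ = ‖-(D.sx • xs) - zf‖ := by rw [← norm_neg]; congr 1; abel
  rw [n1] at sz
  rw [norm_sub_rev w.y ys] at sy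
  have j1 : inner ℝ u (v.zf - zf) + inner ℝ c (v.yf - w.y) ≤ π - π' := by
    have : 0 ≤ 1 / D.sx / 2 * ‖v.zf - zf‖ ^ 2 := by positivity
    have : 0 ≤ D.sy / 2 * ‖v.yf - w.y‖ ^ 2 := by positivity
    linarith
  have j2 := mul_le_mul_of_nonneg_left j1 (by linarith : 0 ≤ 2 * (i - 1))
  have j3 := mul_le_mul_of_nonneg_left test (by linarith : 0 ≤ i)
  have j4 : 2 * D.etaY * ‖c‖ ^ 2 ≤ i * (8 / D.sx * ‖c‖ ^ 2) := by
    have : D.etaY ≤ 4 / (D.alpha * D.sx) := min_le_right _ _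
    have e : i * (8 / D.sx * ‖c‖ ^ 2) = 2 * (4 / (D.alpha * D.sx)) * ‖c‖ ^ 2 := by
      rw [hi]; field_simp; ring
    rw [e]
    gcongr
  have j5 : 2 * D.etaZ * ‖u‖ ^ 2 ≤ i * (D.sx * ‖u‖ ^ 2) := by
    have h0 : 0 ≤ D.sx * ‖u‖ ^ 2 := by positivity
    rw [hZ]
    nlinarith
  have j6 : 1 / 2 * (‖v.z + D.sx • xs‖ ^ 2 / D.etaZ) ≤
      (1 - D.alpha / 2) * (‖v.z + D.sx • xs‖ ^ 2 / D.etaZ) := by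
    have : 0 ≤ ‖v.z + D.sx • xs‖ ^ 2 / D.etaZ := by rw [hZ]; positivity
    apply mul_le_mul_of_nonneg_right _ this
    linarith
  have e0 : 2 / D.alpha = 2 * i := by rw [hi]; ring
  -- With `i = 1 / ᾱ` the right-hand coefficient is `2i - 1`, and `π + payoff ≥ 0` because the
  -- saddle point minimizes the dual.
  have j7 : 2 * (i - 1) * (π + D.payoff xs ys) ≤
      (1 - D.alpha / 2) * (2 * i * (π + D.payoff xs ys)) := by
    have : 0 ≤ π + D.payoff xs ys := by linarith
    have e : (1 - D.alpha / 2) * (2 * i * (π + D.payoff xs ys)) =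
      (2 * i - D.alpha * i) * (π + D.payoff xs ys) := by ring
    rw [e, hαi]
    apply mul_le_mul_of_nonneg_right _ this
    linarith
  have e1 : 1 / D.sx / 2 * ‖-(D.sx • xs) - zf‖ ^ 2 = D.sx⁻¹ * ‖-(D.sx • xs) - zf‖ ^ 2 / 2 := by ring
  rw [e1] at i2
  unfold lyapunov
  rw [e0]
  linarith

end InnerData

end Lyapunov

theorem WithLp.norm_toLp_neg_snd {E F : Type*} [NormedAddCommGroup E] [NormedAddCommGroup F]
    (a : E) (b : F) : ‖WithLp.toLp 2 (a, -b)‖ = ‖WithLp.toLp 2 (a, b)‖ := by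
  refine (sq_eq_sq₀ (norm_nonneg _) (norm_nonneg _)).1 ?_
  rw [WithLp.prod_norm_sq_eq_of_L2, WithLp.prod_norm_sq_eq_of_L2, WithLp.toLp_snd, norm_neg]
  rfl

/-! ### Termination residual, and oracle calls of one pass of the `for` loop. -/

section Calls

variable {E F : Type*} [NormedAddCommGroup E] [InnerProductSpace ℝ E] [CompleteSpace E]
  [NormedAddCommGroup F] [InnerProductSpace ℝ F] [CompleteSpace F]

namespace InnerData

variable (D : InnerData E F) {S : Set (WithLp 2 (E × F))}

/-- The pair `(-z / σ_x, y)` of primal and dual iterates. -/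
noncomputable def iterate (v : HeadVars E F) : WithLp 2 (E × F) :=
  WithLp.toLp 2 (-(D.sx⁻¹ • v.z), v.y)

/-- The candidate output of the inner method. -/
noncomputable def candidate (v : HeadVars E F) : WithLp 2 (E × F) :=
  WithLp.toLp 2
    (prox D.p D.zetaBar ((D.iterate v).fst - D.zetaBar • D.gx (D.iterate v).fst (D.iterate v).snd),
      prox D.q D.zetaBar ((D.iterate v).snd + D.zetaBar • D.gy (D.iterate v).fst (D.iterate v).snd))

/-- The residual of the termination test of the inner method. -/
noncomputable def residual (v : HeadVars E F) : WithLp 2 (E × F) :=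
  D.zetaBar⁻¹ • WithLp.toLp 2 ((D.iterate v).fst - (D.candidate v).fst,
      (D.candidate v).snd - (D.iterate v).snd) -
    (gradient D.hbar (D.iterate v) - gradient D.hbar (D.candidate v))

open Classical in
theorem leave_eq (v : HeadVars E F) (w : LoopVars E F) :
    D.leave v w =
      (if ‖D.residual (D.leaveVars v w)‖ ≤ D.tol then
          .done (D.candidate (D.leaveVars v w)).fst (D.candidate (D.leaveVars v w)).snd
        else .head (D.leaveVars v w),
        ⟨[D.iterate (D.leaveVars v w), D.candidate (D.leaveVars v w)], 1, 1⟩) := rfl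

/-- `(x, y)` satisfies the optimality conditions of the saddle problem up to the tolerance. -/
def IsApproxSaddle (x : E) (y : F) : Prop :=
  ∃ b c, IsSubgradient D.p x b ∧ IsSubgradient D.q y c ∧
    ‖D.gx x y + b‖ ^ 2 + ‖c - D.gy x y‖ ^ 2 ≤ D.tol ^ 2

variable {D}

theorem isApproxSaddle_candidate (hD : D.IsRegular S) {v : HeadVars E F}
    (h : ‖D.residual v‖ ≤ D.tol) : D.IsApproxSaddle (D.candidate v).fst (D.candidate v).snd := by
  have hz := zetaBar_pos hD
  set x := (D.iterate v).fst with hx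
  set y := (D.iterate v).snd with hy
  refine ⟨_, _, hD.hp.isSubgradient_prox hD.hpc hz (x - D.zetaBar • D.gx x y),
    hD.hq.isSubgradient_prox hD.hqc hz (y + D.zetaBar • D.gy x y), ?_⟩
  set xt := (D.candidate v).fst with hxt
  set yt := (D.candidate v).snd with hyt
  have hxt' : prox D.p D.zetaBar (x - D.zetaBar • D.gx x y) = xt := rfl
  have hyt' : prox D.q D.zetaBar (y + D.zetaBar • D.gy x y) = yt := rfl
  rw [hxt', hyt']
  have e1 : D.gx xt yt + (1 / D.zetaBar) • (x - D.zetaBar • D.gx x y - xt) = (D.residual v).fst := by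
    change _ = D.zetaBar⁻¹ • (x - xt) - (D.gx x y - D.gx xt yt)
    rw [sub_right_comm, smul_sub _ (x - xt), smul_smul, one_div, inv_mul_cancel₀ hz.ne', one_smul]
    abel
  have e2 : (1 / D.zetaBar) • (y + D.zetaBar • D.gy x y - yt) - D.gy xt yt = -(D.residual v).snd := by
    change _ = -(D.zetaBar⁻¹ • (yt - y) - (D.gy x y - D.gy xt yt))
    rw [add_sub_right_comm, smul_add _ (y - yt), smul_smul, one_div, inv_mul_cancel₀ hz.ne', one_smul,
      ← neg_sub y yt, smul_neg]
    abel
  rw [e1, e2, norm_neg, ← WithLp.prod_norm_sq_eq_of_L2]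
  gcongr

/-- As `ζ̄ L̄ ≤ 1/3`, nonexpansive proximal maps keep the candidate within `4/3` of the distance
from the iterate to the saddle point, hence within `7/3` of it from the iterate. The iterate may
leave the domains; membership in `S` suffices. -/
theorem norm_residual_le (hD : D.IsRegular S) {xs : E} {ys : F} (hs : D.IsSaddle xs ys)
    {v : HeadVars E F} (hv : D.iterate v ∈ S) :
    ‖D.residual v‖ ≤ (D.zetaBar⁻¹ + D.Lbar) * (7 / 3 * ‖D.iterate v - WithLp.toLp 2 (xs, ys)‖) := by
  have hz := zetaBar_pos hD
  have hsx := hD.sx_pos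
  have hL : 0 < D.Lbar := by rw [hD.Lbar_eq]; positivity
  set i := D.iterate v with hi
  set s := WithLp.toLp 2 (xs, ys) with hs_def
  set c := D.candidate v with hc
  have hcS : c ∈ S := hD.mem _ (hD.hp.prox_mem hD.hpc hz _) _ (hD.hq.prox_mem hD.hqc hz _)
  have hsS : s ∈ S := hD.mem _ hs.left.1 _ hs.right.1
  have hzL : D.zetaBar * D.Lbar ≤ 1 / 3 := by
    have h1 : D.zetaBar * D.Lbar = min D.sx D.sy / D.Lbar := by
      unfold zetaBar; field_simp
    rw [h1, hD.Lbar_eq, div_le_iff₀ (by positivity)]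
    linarith [min_le_left D.sx D.sy]
  have h1 : ‖c - s‖ ≤ 4 / 3 * ‖i - s‖ := by
    have p1 := (hD.hp.isSubgradient_prox hD.hpc hz (i.fst - D.zetaBar • D.gx i.fst i.snd)).norm_sub_le hz
      (w' := xs - D.zetaBar • D.gx xs ys) (u' := xs) (by
        convert hs.left using 1
        rw [sub_sub_cancel_left, smul_neg, smul_smul, one_div, inv_mul_cancel₀ hz.ne', one_smul])
    have p2 := (hD.hq.isSubgradient_prox hD.hqc hz (i.snd + D.zetaBar • D.gy i.fst i.snd)).norm_sub_le hz
      (w' := ys + D.zetaBar • D.gy xs ys) (u' := ys) (by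
        convert hs.right using 1
        rw [add_sub_cancel_left, smul_smul, one_div, inv_mul_cancel₀ hz.ne', one_smul])
    set G : WithLp 2 (E × F) :=
      WithLp.toLp 2 (D.gx i.fst i.snd - D.gx xs ys, -(D.gy i.fst i.snd - D.gy xs ys)) with hG
    have hGn : ‖G‖ = ‖gradient D.hbar i - gradient D.hbar s‖ := WithLp.norm_toLp_neg_snd _ _
    have h2 : ‖c - s‖ ≤ ‖(i - s) - D.zetaBar • G‖ := by
      refine (sq_le_sq₀ (norm_nonneg _) (norm_nonneg _)).1 ?_
      rw [WithLp.prod_norm_sq_eq_of_L2, WithLp.prod_norm_sq_eq_of_L2]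
      have e1 : ((i - s) - D.zetaBar • G).fst =
          i.fst - D.zetaBar • D.gx i.fst i.snd - (xs - D.zetaBar • D.gx xs ys) := by
        change i.fst - xs - D.zetaBar • (D.gx i.fst i.snd - D.gx xs ys) = _
        module
      have e2 : ((i - s) - D.zetaBar • G).snd =
          i.snd + D.zetaBar • D.gy i.fst i.snd - (ys + D.zetaBar • D.gy xs ys) := by
        change i.snd - ys - D.zetaBar • -(D.gy i.fst i.snd - D.gy xs ys) = _
        module
      rw [e1, e2]
      exact add_le_add (pow_le_pow_left₀ (norm_nonneg _) p1 2) (pow_le_pow_left₀ (norm_nonneg _) p2 2)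
    refine h2.trans ((norm_sub_le _ _).trans ?_)
    rw [norm_smul, Real.norm_of_nonneg hz.le, hGn]
    have h3 := mul_le_mul_of_nonneg_left (hD.lip i hv s hsS) hz.le
    have h4 := mul_le_mul_of_nonneg_right hzL (norm_nonneg (i - s))
    linarith
  have h2 : ‖i - c‖ ≤ 7 / 3 * ‖i - s‖ := by
    have e : i - c = (i - s) - (c - s) := by abel
    rw [e]
    linarith [norm_sub_le (i - s) (c - s)]
  have h3 : ‖WithLp.toLp 2 (i.fst - c.fst, c.snd - i.snd)‖ = ‖i - c‖ := by
    rw [← neg_sub i.snd c.snd]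
    exact WithLp.norm_toLp_neg_snd _ _
  change ‖D.zetaBar⁻¹ • WithLp.toLp 2 (i.fst - c.fst, c.snd - i.snd) -
    (gradient D.hbar i - gradient D.hbar c)‖ ≤ _
  refine (norm_sub_le _ _).trans ?_
  rw [norm_smul, Real.norm_of_nonneg (inv_pos.2 hz).le, h3]
  have h4 := hD.lip i hv c hcS
  have h5 := mul_le_mul_of_nonneg_left h2 (by positivity : 0 ≤ D.zetaBar⁻¹ + D.Lbar)
  linarith

/-- The iterate is `(-z / σ_x, y)`, so the first two terms of the Lyapunov function are weighted
squared distances to the saddle point; the third is nonnegative. -/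
theorem norm_iterate_sub_sq_le (hD : D.IsRegular S) {xs : E} {ys : F} (hs : D.IsSaddle xs ys)
    {v : HeadVars E F} {π : ℝ} (hyf : v.yf ∈ effDom D.q) (hπ : D.IsDualBound v.zf v.yf π) :
    ‖D.iterate v - WithLp.toLp 2 (xs, ys)‖ ^ 2 ≤
      max (1 / (2 * D.sx)) D.etaY * D.lyapunov xs ys v.z v.y π := by
  have hsx := hD.sx_pos
  have hη := etaY_pos hD
  have hα := alpha_pos hD
  rw [WithLp.prod_norm_sq_eq_of_L2]
  have e1 : (D.iterate v - WithLp.toLp 2 (xs, ys)).fst = -(D.sx⁻¹ • (v.z + D.sx • xs)) := by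
    change -(D.sx⁻¹ • v.z) - xs = _
    rw [smul_add, smul_smul, inv_mul_cancel₀ hsx.ne']
    module
  have e2 : (D.iterate v - WithLp.toLp 2 (xs, ys)).snd = v.y - ys := rfl
  have h0 : 0 ≤ 2 / D.alpha * (π + D.payoff xs ys) := by
    have := hs.neg_payoff_le hD hyf hπ
    have : 0 ≤ π + D.payoff xs ys := by linarith
    positivity
  rw [e1, e2, norm_neg, norm_smul, mul_pow, Real.norm_eq_abs, sq_abs]
  have hZ : D.etaZ = D.sx / 2 := rfl
  have hZ0 : 0 < D.etaZ := by rw [hZ]; positivity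
  have h1 : D.sx⁻¹ ^ 2 * ‖v.z + D.sx • xs‖ ^ 2 = 1 / (2 * D.sx) * (‖v.z + D.sx • xs‖ ^ 2 / D.etaZ) := by
    rw [hZ]; field_simp
  have h2 : ‖v.y - ys‖ ^ 2 = D.etaY * (‖v.y - ys‖ ^ 2 / D.etaY) := by field_simp
  rw [h1, h2]
  set M := max (1 / (2 * D.sx)) D.etaY with hM
  have hM0 : 0 < M := lt_max_of_lt_right hη
  have h3 : 1 / (2 * D.sx) * (‖v.z + D.sx • xs‖ ^ 2 / D.etaZ) ≤ M * (‖v.z + D.sx • xs‖ ^ 2 / D.etaZ) := by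
    gcongr; exact le_max_left _ _
  have h4 : D.etaY * (‖v.y - ys‖ ^ 2 / D.etaY) ≤ M * (‖v.y - ys‖ ^ 2 / D.etaY) := by
    gcongr; exact le_max_right _ _
  have h5 := mul_nonneg hM0.le h0
  unfold lyapunov
  linarith

end InnerData

namespace OuterData

variable (A : OuterData E F) {S : Set (WithLp 2 (E × F))}

/-- The outer method reaches the state `s` with at most `N` oracle calls of each kind. -/
def Reaches (s : OuterState E F) (N : ℝ) : Prop :=
  ∃ n, (A.run n).1 = s ∧ (A.run n).2.AtMost N

variable {A}

theorem Reaches.mono {s : OuterState E F} {N N' : ℝ} (h : A.Reaches s N) (hN : N ≤ N') :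
    A.Reaches s N' := by
  obtain ⟨n, h1, h2, h3, h4⟩ := h
  exact ⟨n, h1, h2.trans hN, h3.trans hN, h4.trans hN⟩

theorem Reaches.step {s : OuterState E F} {N c : ℝ} (h : A.Reaches s N)
    (hc : (A.step s).2.AtMost c) : A.Reaches (A.step s).1 (N + c) := by
  obtain ⟨n, h1, h2, h3, h4⟩ := h
  refine ⟨n + 1, by rw [run, h1], ?_, ?_, ?_⟩
  · have e : (A.run (n + 1)).2.grads = (A.run n).2.grads ++ (A.step s).2.grads := by
      rw [← h1]; rfl
    rw [e, List.length_append, Nat.cast_add]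
    exact add_le_add h2 hc.1
  · have e : (A.run (n + 1)).2.proxP = (A.run n).2.proxP + (A.step s).2.proxP := by
      rw [← h1]; rfl
    rw [e, Nat.cast_add]
    exact add_le_add h3 hc.2.1
  · have e : (A.run (n + 1)).2.proxQ = (A.run n).2.proxQ + (A.step s).2.proxQ := by
      rw [← h1]; rfl
    rw [e, Nat.cast_add]
    exact add_le_add h4 hc.2.2

/-- This turns the assumption on the evaluated points into membership in `S` for the extrapolated
points, which need not belong to the domains. -/
theorem Reaches.query_mem {s : OuterState E F} {N : ℝ} (h : A.Reaches s N)
    (hS : ∀ n, ∀ z ∈ (A.run n).2.grads, z ∈ S) {z : WithLp 2 (E × F)}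
    (hz : z ∈ (A.step s).2.grads) : z ∈ S := by
  obtain ⟨n, h1, -⟩ := h
  refine hS (n + 1) z ?_
  have e : (A.run (n + 1)).2.grads = (A.run n).2.grads ++ (A.step s).2.grads := by
    rw [← h1]; rfl
  rw [e]
  exact List.mem_append_right _ hz

theorem Reaches.exists_loop_exit {k : ℕ} {xk : E} {yk : F} {v : HeadVars E F} {N : ℝ}
    (h : A.Reaches (.running k xk yk (.head v)) N) (hD : (A.call k xk).IsRegular S)
    (hS : ∀ n, ∀ z ∈ (A.run n).2.grads, z ∈ S) :
    ∃ t, A.Reaches (.running k xk yk (.loop v ((A.call k xk).loopSeq v t))) (N + 2001) ∧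
      ¬ (A.call k xk).continues ((A.call k xk).loopSeq v t) := by
  set D := A.call k xk with hD_def
  by_contra hcon
  push Not at hcon
  have hstep : ∀ w, D.continues w →
      A.step (.running k xk yk (.loop v w)) = (.running k xk yk (.loop v (D.body w).1),
        ⟨[WithLp.toLp 2 (w.x, w.y), D.halfPoint w], 1, 1⟩) := by
    intro w hw
    change (OuterState.running k xk yk (D.step (.loop v w)).1, (D.step (.loop v w)).2) = _
    rw [InnerData.step, if_pos hw]
    rfl
  -- Entering the loop costs one gradient. Each pass costs two, at the tested point and at the half
  -- point, which gives `2001` after `1000` passes.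
  have hreach : ∀ t : ℕ, t ≤ 1000 →
      A.Reaches (.running k xk yk (.loop v (D.loopSeq v t))) (N + 1 + 2 * t) := by
    intro t
    induction t with
    | zero =>
      intro _
      have h1 := h.step (c := 1) ⟨by simp [OuterData.step, InnerData.step, InnerData.enter_eq],
        by simp [OuterData.step, InnerData.step, InnerData.enter_eq],
        by simp [OuterData.step, InnerData.step, InnerData.enter_eq]⟩
      exact Reaches.mono (s := .running k xk yk (.loop v (D.loopSeq v 0))) h1 (by simp)
    | succ t ih =>
      intro ht
      have h1 := ih (by lia)
      have htr : (t : ℝ) + 1 ≤ 1000 := by exact_mod_cast ht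
      have hc := hcon t (h1.mono (by linarith))
      have h2 := h1.step (c := 2) (by rw [hstep _ hc]; norm_num [Ledger.AtMost])
      rw [hstep _ hc] at h2
      refine h2.mono (le_of_eq ?_)
      push_cast; ring
  have hc : ∀ t : ℕ, t ≤ 1000 → D.continues (D.loopSeq v t) := by
    intro t ht
    have htr : (t : ℝ) ≤ 1000 := by exact_mod_cast ht
    exact hcon t ((hreach t ht).mono (by linarith))
  refine InnerData.not_continues_loopSeq hD v ?_ ?_ (hc 1000 le_rfl)
  · refine h.query_mem hS ?_
    change _ ∈ (D.step (.head v)).2.grads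
    rw [InnerData.step, InnerData.enter_eq]
    simp
  · intro t ht
    refine (hreach t (by lia)).query_mem hS ?_
    rw [hstep _ (hc t (by lia))]
    simp

theorem Reaches.head_step {k : ℕ} {xk : E} {yk : F} {v : HeadVars E F} {N π : ℝ}
    (h : A.Reaches (.running k xk yk (.head v)) N) (hD : (A.call k xk).IsRegular S)
    (hS : ∀ n, ∀ z ∈ (A.run n).2.grads, z ∈ S) {xs : E} {ys : F} (hs : (A.call k xk).IsSaddle xs ys)
    (hyf : v.yf ∈ effDom A.q) (hπ : (A.call k xk).IsDualBound v.zf v.yf π) :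
    (∃ x y, A.Reaches (.running k xk yk (.done x y)) (N + 3397) ∧
        (A.call k xk).IsApproxSaddle x y) ∨
      ∃ v' π', A.Reaches (.running k xk yk (.head v')) (N + 3397) ∧ v'.yf ∈ effDom A.q ∧
        (A.call k xk).IsDualBound v'.zf v'.yf π' ∧
        (A.call k xk).lyapunov xs ys v'.z v'.y π' ≤
          (1 - (A.call k xk).alpha / 2) * (A.call k xk).lyapunov xs ys v.z v.y π ∧
        (A.call k xk).tol < ((A.call k xk).zetaBar⁻¹ + (A.call k xk).Lbar) *
          (7 / 3 * ‖(A.call k xk).iterate v' - WithLp.toLp 2 (xs, ys)‖) := by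
  obtain ⟨t, ht, hexit⟩ := h.exists_loop_exit hD hS
  set D := A.call k xk with hD_def
  set w := D.loopSeq v t with hw
  obtain ⟨hb, hc⟩ := InnerData.loopSeq_isSubgradient hD v t
  obtain ⟨hzg, hyg, -, -, -⟩ := InnerData.loopSeq_const (D := D) v t
  obtain ⟨π', hπ', hly⟩ := InnerData.lyapunov_leaveVars_le hD hs hyf hπ hb hc hzg hyg hexit
  have hstep : A.step (.running k xk yk (.loop v w)) = (.running k xk yk (D.leave v w).1,
        ⟨[WithLp.toLp 2 (w.x, w.y), D.iterate (D.leaveVars v w), D.candidate (D.leaveVars v w)],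
          1, 1⟩) := by
    change (OuterState.running k xk yk (D.step (.loop v w)).1, (D.step (.loop v w)).2) = _
    rw [InnerData.step, if_neg hexit]
    rfl
  -- The three gradients are those of the failed test, of the new iterate and of the candidate;
  -- `2001 + 3` is below `3397`.
  have h1 := ht.step (c := 3) (by rw [hstep]; norm_num [Ledger.AtMost])
  have hmem : D.iterate (D.leaveVars v w) ∈ S := ht.query_mem hS (by rw [hstep]; simp)
  rw [hstep, InnerData.leave_eq] at h1
  have h2 := h1.mono (N' := N + 3397) (by linarith)
  by_cases hres : ‖D.residual (D.leaveVars v w)‖ ≤ D.tol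
  · left
    rw [if_pos hres] at h2
    exact ⟨_, _, h2, InnerData.isApproxSaddle_candidate hD hres⟩
  · right
    rw [if_neg hres] at h2
    exact ⟨_, π', h2, hc.1, hπ', hly,
      (not_le.1 hres).trans_le (InnerData.norm_residual_le hD hs hmem)⟩

end OuterData

end Calls

/-! ### Oracle calls of one call of the inner method. -/

section CallBound

variable {E F : Type*} [NormedAddCommGroup E] [InnerProductSpace ℝ E] [CompleteSpace E]
  [NormedAddCommGroup F] [InnerProductSpace ℝ F] [CompleteSpace F]

namespace OuterData

variable {A : OuterData E F} {S : Set (WithLp 2 (E × F))}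

theorem Reaches.iterate_head {k : ℕ} {xk : E} {yk : F} {v : HeadVars E F} {N π : ℝ}
    (h : A.Reaches (.running k xk yk (.head v)) N) (hD : (A.call k xk).IsRegular S)
    (hS : ∀ n, ∀ z ∈ (A.run n).2.grads, z ∈ S) {xs : E} {ys : F} (hs : (A.call k xk).IsSaddle xs ys)
    (hyf : v.yf ∈ effDom A.q) (hπ : (A.call k xk).IsDualBound v.zf v.yf π) (K : ℕ) :
    (∃ x y, A.Reaches (.running k xk yk (.done x y)) (N + 3397 * K) ∧
        (A.call k xk).IsApproxSaddle x y) ∨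
      ∃ v' π', A.Reaches (.running k xk yk (.head v')) (N + 3397 * K) ∧ v'.yf ∈ effDom A.q ∧
        (A.call k xk).IsDualBound v'.zf v'.yf π' ∧
        (A.call k xk).lyapunov xs ys v'.z v'.y π' ≤
          (1 - (A.call k xk).alpha / 2) ^ K * (A.call k xk).lyapunov xs ys v.z v.y π ∧
        (0 < K → (A.call k xk).tol < ((A.call k xk).zetaBar⁻¹ + (A.call k xk).Lbar) *
          (7 / 3 * ‖(A.call k xk).iterate v' - WithLp.toLp 2 (xs, ys)‖)) := by
  induction K with
  | zero => exact Or.inr ⟨v, π, by simpa using h, hyf, hπ, by simp, by simp⟩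
  | succ K ih =>
    have hN : N + 3397 * (K : ℝ) + 3397 = N + 3397 * ((K + 1 : ℕ) : ℝ) := by push_cast; ring
    rcases ih with ⟨x, y, h1, h2⟩ | ⟨v1, π1, h1, h2, h3, h4, -⟩
    · exact Or.inl ⟨x, y, h1.mono (by rw [← hN]; linarith), h2⟩
    · rcases h1.head_step hD hS hs h2 h3 with ⟨x, y, g1, g2⟩ | ⟨v2, π2, g1, g2, g3, g4, g5⟩
      · exact Or.inl ⟨x, y, by rwa [hN] at g1, g2⟩
      · refine Or.inr ⟨v2, π2, by rwa [hN] at g1, g2, g3, g4.trans ?_, fun _ => g5⟩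
        rw [pow_succ', mul_assoc]
        have := InnerData.alpha_le_one (D := A.call k xk)
        exact mul_le_mul_of_nonneg_left h4 (by linarith)

/-- The bound on the number of iterations of the `for` loop in one call of the inner method. -/
theorem Reaches.exists_done {k : ℕ} {xk : E} {yk : F} {v : HeadVars E F} {N π Θ : ℝ}
    (h : A.Reaches (.running k xk yk (.head v)) N) (hD : (A.call k xk).IsRegular S)
    (hS : ∀ n, ∀ z ∈ (A.run n).2.grads, z ∈ S) {xs : E} {ys : F} (hs : (A.call k xk).IsSaddle xs ys)
    (hyf : v.yf ∈ effDom A.q) (hπ : (A.call k xk).IsDualBound v.zf v.yf π) (he : 0 < A.eps0)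
    (hΘ : (A.call k xk).lyapunov xs ys v.z v.y π ≤ Θ) :
    ∃ x y, A.Reaches (.running k xk yk (.done x y)) (N + 3397 * (2 / (A.call k xk).alpha *
        (max 0 (Real.log (4 * max (1 / (2 * (A.call k xk).sx)) (A.call k xk).etaY * Θ /
          ((((A.call k xk).zetaBar⁻¹ + (A.call k xk).Lbar) ^ 2)⁻¹ * A.eps0 ^ 2))) + 1 +
          2 * Real.log ((k : ℝ) + 1)))) ∧ (A.call k xk).IsApproxSaddle x y := by
  have htol : (A.call k xk).tol = A.eps0 / ((k : ℝ) + 1) := rfl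
  set D := A.call k xk with hD_def
  set R := D.zetaBar⁻¹ + D.Lbar with hR
  set M := max (1 / (2 * D.sx)) D.etaY with hM
  set C := 4 * M * Θ / ((R ^ 2)⁻¹ * A.eps0 ^ 2) with hC
  have hα := InnerData.alpha_pos hD
  have hα1 := InnerData.alpha_le_one (D := D)
  have hη := InnerData.etaY_pos hD
  have hz := InnerData.zetaBar_pos hD
  have hsx := hD.sx_pos
  have hM0 : 0 < M := lt_max_of_lt_right hη
  have hR0 : 0 < R := by
    have : 0 < D.Lbar := by rw [hD.Lbar_eq]; positivity
    positivity
  have hlogk : 0 ≤ Real.log ((k : ℝ) + 1) := Real.log_nonneg (by linarith [Nat.cast_nonneg (α := ℝ) k])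
  -- Of the final `+ 1`, one half absorbs the constant `log (49/36)` below. The other half,
  -- multiplied by `2 / ᾱ ≥ 2`, pays for rounding `X` up to an integer.
  set X := 2 / D.alpha * (max 0 (Real.log C) + 1 / 2 + 2 * Real.log ((k : ℝ) + 1)) with hX
  have hX0 : 0 ≤ X := by
    have := le_max_left 0 (Real.log C)
    have : 0 ≤ max 0 (Real.log C) + 1 / 2 + 2 * Real.log ((k : ℝ) + 1) := by linarith
    positivity
  have hK1 : ((⌊X⌋₊ + 1 : ℕ) : ℝ) ≤ 2 / D.alpha * (max 0 (Real.log C) + 1 + 2 * Real.log ((k : ℝ) + 1)) := by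
    push_cast
    have h1 := Nat.floor_le hX0
    have h2 : 1 ≤ 2 / D.alpha * (1 / 2) := by
      rw [div_mul_div_comm, mul_comm D.alpha, le_div_iff₀ (by positivity)]; linarith
    have e : 2 / D.alpha * (max 0 (Real.log C) + 1 + 2 * Real.log ((k : ℝ) + 1)) =
      X + 2 / D.alpha * (1 / 2) := by rw [hX]; ring
    rw [e]
    linarith
  rcases h.iterate_head hD hS hs hyf hπ (⌊X⌋₊ + 1) with ⟨x, y, h1, h2⟩ | ⟨v', π', h1, h2, h3, h4, h5⟩
  · exact ⟨x, y, h1.mono (by linarith), h2⟩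
  exfalso
  have h6 := h5 (Nat.succ_pos _)
  rw [htol] at h6
  have h7 := InnerData.norm_iterate_sub_sq_le hD hs h2 h3
  set K := ⌊X⌋₊ + 1 with hK
  have hXK : X < K := by rw [hK]; push_cast; exact Nat.lt_floor_add_one X
  have hΘ0 : 0 ≤ Θ := by
    refine le_trans ?_ hΘ
    have h8 := InnerData.norm_iterate_sub_sq_le hD hs hyf hπ
    by_contra hneg
    nlinarith [sq_nonneg ‖D.iterate v - WithLp.toLp 2 (xs, ys)‖]
  have hexp : (1 - D.alpha / 2) ^ K ≤ Real.exp (-(K * (D.alpha / 2))) := by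
    have e : Real.exp (-(K * (D.alpha / 2))) = Real.exp (-(D.alpha / 2)) ^ K := by
      rw [← Real.exp_nat_mul]; ring_nf
    rw [e]
    refine pow_le_pow_left₀ (by linarith) ?_ K
    have := Real.add_one_le_exp (-(D.alpha / 2))
    linarith
  set T := Real.exp (-(K * (D.alpha / 2))) with hT
  have hT0 : 0 < T := Real.exp_pos _
  have h8 : ‖D.iterate v' - WithLp.toLp 2 (xs, ys)‖ ^ 2 ≤ M * (T * Θ) := by
    refine h7.trans (mul_le_mul_of_nonneg_left (h4.trans ?_) hM0.le)
    refine (mul_le_mul_of_nonneg_left hΘ (pow_nonneg (by linarith) K)).trans ?_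
    exact mul_le_mul_of_nonneg_right hexp hΘ0
  have hk0 : (0 : ℝ) < (k : ℝ) + 1 := by positivity
  have h9 := pow_lt_pow_left₀ h6 (by positivity) two_ne_zero
  rw [mul_pow, mul_pow, div_pow] at h9
  have h10 : A.eps0 ^ 2 / ((k : ℝ) + 1) ^ 2 < R ^ 2 * ((7 / 3) ^ 2 * (M * (T * Θ))) :=
    h9.trans_le (by gcongr)
  have hCe : C * A.eps0 ^ 2 = R ^ 2 * (4 * M * Θ) := by
    rw [hC]; field_simp
  -- The factor `49/36` is `(7/3)²` from the residual bound divided by the `4` in `C`; `(k + 1)²`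
  -- comes from the tolerance.
  have h11 : 1 < 49 / 36 * C * T * ((k : ℝ) + 1) ^ 2 := by
    rw [div_lt_iff₀ (by positivity)] at h10
    have e : R ^ 2 * ((7 / 3) ^ 2 * (M * (T * Θ))) * ((k : ℝ) + 1) ^ 2 =
        49 / 36 * C * T * ((k : ℝ) + 1) ^ 2 * A.eps0 ^ 2 := by
      calc _ = 49 / 36 * (R ^ 2 * (4 * M * Θ)) * T * ((k : ℝ) + 1) ^ 2 := by ring
        _ = _ := by rw [← hCe]; ring
    rw [e] at h10
    by_contra hneg
    nlinarith [pow_pos he 2]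
  have hC0 : 0 < C := by
    by_contra hneg
    have : 49 / 36 * C * T * ((k : ℝ) + 1) ^ 2 ≤ 0 := by
      have h12 : C * (T * ((k : ℝ) + 1) ^ 2) ≤ 0 :=
        mul_nonpos_of_nonpos_of_nonneg (not_lt.1 hneg) (by positivity)
      linarith
    linarith
  have h12 := Real.log_pos h11
  rw [Real.log_mul (by positivity) (by positivity), Real.log_mul (by positivity) (by positivity),
    Real.log_mul (by positivity) (by positivity), hT, Real.log_exp, Real.log_pow] at h12
  have h13 : Real.log (49 / 36) ≤ 1 / 2 := by
    have := Real.log_le_sub_one_of_pos (by norm_num : (0 : ℝ) < 49 / 36)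
    linarith
  have h14 := le_max_right 0 (Real.log C)
  push_cast at h12
  have h15 : (K : ℝ) * (D.alpha / 2) < max 0 (Real.log C) + 1 / 2 + 2 * Real.log ((k : ℝ) + 1) := by
    linarith
  have h16 : X * (D.alpha / 2) = max 0 (Real.log C) + 1 / 2 + 2 * Real.log ((k : ℝ) + 1) := by
    rw [hX]; field_simp
  have h17 := mul_lt_mul_of_pos_right hXK (by positivity : 0 < D.alpha / 2)
  linarith

end OuterData

end CallBound

/-! ### Finite values of the objective. -/

section Values

variable {E F : Type*}

theorem infEDist_zero_le_of_mem {H : Type*} [NormedAddCommGroup H] {T : Set H} {s : H} {ε : ℝ}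
    (hs : s ∈ T) (hn : ‖s‖ ≤ ε) : Metric.infEDist 0 T ≤ ENNReal.ofReal ε := by
  refine (Metric.infEDist_le_edist_of_mem hs).trans ?_
  rw [edist_dist, dist_zero_left]
  exact ENNReal.ofReal_le_ofReal hn

theorem objH_of_notMem_right {h : WithLp 2 (E × F) → ℝ} {p : E → EReal} {q : F → EReal} {y : F}
    (hy : y ∉ effDom q) (x : E) : objH h p q x y = ⊥ := by
  have : q y = ⊤ := by simpa [effDom] using hy
  unfold objH
  rw [this, EReal.sub_top]

/-- The finite value of the objective on its domain. -/
def OuterData.value (A : OuterData E F) (x : E) (y : F) : ℝ :=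
  A.h (WithLp.toLp 2 (x, y)) + (A.p x).toReal - (A.q y).toReal

theorem OuterData.payoff_call [NormedAddCommGroup E] {A : OuterData E F} (k : ℕ) (xk x : E) (y : F) :
    (A.call k xk).payoff x y = A.value x y + A.L * ‖x - xk‖ ^ 2 := by
  unfold InnerData.payoff value
  simp only [call, hk, WithLp.toLp_fst]
  ring

end Values

/-! ### The functions `max_y H` and `H*` as real numbers, and one outer iteration. -/

section Outer

variable {E F : Type*} [NormedAddCommGroup E] [InnerProductSpace ℝ E] [CompleteSpace E]
  [NormedAddCommGroup F] [InnerProductSpace ℝ F] [CompleteSpace F]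

namespace OuterData

/-- The assumptions on the minimax problem. -/
structure IsRegular (A : OuterData E F) (U : Set E) (V : Set F) : Prop where
  hp : IsProperClosedConvex A.p
  hq : IsProperClosedConvex A.q
  hpc : IsCompact (effDom A.p)
  hqc : IsCompact (effDom A.q)
  hL : 0 < A.L
  hsy : 0 < A.sy
  hU : effDom A.p ⊆ U
  hV : effDom A.q ⊆ V
  hsmooth : SmoothOn A.h A.L {z | z.fst ∈ U ∧ z.snd ∈ V}
  hconc : ∀ x ∈ effDom A.p, StrongConcaveOn V A.sy fun y => A.h (WithLp.toLp 2 (x, y))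

variable (A : OuterData E F)

/-- `max_y H(x, y)` as a real number. -/
noncomputable def maxValue (x : E) : ℝ := (maxH A.h A.p A.q x).toReal

variable {A} {U : Set E} {V : Set F}

namespace IsRegular

theorem inner_isRegular (hA : A.IsRegular U V) (k : ℕ) (xk : E) :
    (A.call k xk).IsRegular {z | z.fst ∈ U ∧ z.snd ∈ V} :=
  A.call_isRegular hA.hp hA.hq hA.hpc hA.hqc hA.hL hA.hsy hA.hU hA.hV hA.hsmooth hA.hconc k xk

theorem differentiableAt (hA : A.IsRegular U V) {x : E} {y : F} (hx : x ∈ effDom A.p)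
    (hy : y ∈ effDom A.q) : DifferentiableAt ℝ A.h (WithLp.toLp 2 (x, y)) :=
  hA.hsmooth.1 _ ⟨hA.hU hx, hA.hV hy⟩

theorem objH_eq (hA : A.IsRegular U V) {x : E} {y : F} (hx : x ∈ effDom A.p)
    (hy : y ∈ effDom A.q) : objH A.h A.p A.q x y = (A.value x y : EReal) := by
  unfold objH value
  rw [← hA.hp.coe_toReal hx, ← hA.hq.coe_toReal hy]
  simp

theorem objH_of_notMem_left (hA : A.IsRegular U V) {x : E} {y : F} (hx : x ∉ effDom A.p)
    (hy : y ∈ effDom A.q) : objH A.h A.p A.q x y = ⊤ := by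
  have : A.p x = ⊤ := by simpa [effDom] using hx
  unfold objH
  rw [this, ← hA.hq.coe_toReal hy, EReal.coe_add_top, EReal.top_sub_coe]

theorem exists_value_le (hA : A.IsRegular U V) {x : E} (hx : x ∈ effDom A.p) :
    ∃ M, ∀ y ∈ effDom A.q, A.value x y ≤ M := by
  have hcont : ContinuousOn (fun y => A.h (WithLp.toLp 2 (x, y))) (effDom A.q) := fun y hy =>
    (hA.differentiableAt hx hy).hasGradientAt.comp_toLp_right.hasFDerivAt.continuousAt.continuousWithinAt
  obtain ⟨M, hM⟩ := hA.hqc.bddAbove_image hcont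
  obtain ⟨m, hm⟩ := hA.hq.exists_lower_bound hA.hqc
  refine ⟨M + (A.p x).toReal - m, fun y hy => ?_⟩
  have h1 := hM (Set.mem_image_of_mem _ hy)
  have h2 := hm y hy
  unfold value
  linarith

theorem exists_le_value (hA : A.IsRegular U V) {y : F} (hy : y ∈ effDom A.q) :
    ∃ M, ∀ x ∈ effDom A.p, M ≤ A.value x y := by
  have hcont : ContinuousOn (fun x => A.h (WithLp.toLp 2 (x, y))) (effDom A.p) := fun x hx =>
    (hA.differentiableAt hx hy).hasGradientAt.comp_toLp_left.hasFDerivAt.continuousAt.continuousWithinAt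
  obtain ⟨M, hM⟩ := hA.hpc.bddBelow_image hcont
  obtain ⟨m, hm⟩ := hA.hp.exists_lower_bound hA.hpc
  refine ⟨M + m - (A.q y).toReal, fun x hx => ?_⟩
  have h1 := hM (Set.mem_image_of_mem _ hx)
  have h2 := hm x hx
  unfold value
  linarith

theorem maxH_le (hA : A.IsRegular U V) {x : E} (hx : x ∈ effDom A.p) {c : ℝ}
    (h : ∀ y ∈ effDom A.q, A.value x y ≤ c) : maxH A.h A.p A.q x ≤ c := by
  refine iSup_le fun y => ?_
  by_cases hy : y ∈ effDom A.q
  · rw [hA.objH_eq hx hy]; exact_mod_cast h y hy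
  · rw [objH_of_notMem_right hy]; exact bot_le

theorem coe_maxValue (hA : A.IsRegular U V) {x : E} (hx : x ∈ effDom A.p) :
    (A.maxValue x : EReal) = maxH A.h A.p A.q x := by
  obtain ⟨M, hM⟩ := hA.exists_value_le hx
  obtain ⟨y, hy⟩ := hA.hq.nonempty_dom
  refine EReal.coe_toReal (ne_top_of_le_ne_top (EReal.coe_ne_top M) (hA.maxH_le hx hM)) ?_
  refine ne_bot_of_le_ne_bot (EReal.coe_ne_bot (A.value x y)) ?_
  rw [← hA.objH_eq hx hy]
  exact le_iSup (fun y => objH A.h A.p A.q x y) y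

theorem value_le_maxValue (hA : A.IsRegular U V) {x : E} {y : F} (hx : x ∈ effDom A.p)
    (hy : y ∈ effDom A.q) : A.value x y ≤ A.maxValue x := by
  have h := le_iSup (fun y => objH A.h A.p A.q x y) y
  rw [hA.objH_eq hx hy] at h
  change _ ≤ maxH A.h A.p A.q x at h
  rw [← hA.coe_maxValue hx] at h
  exact_mod_cast h

theorem maxValue_le (hA : A.IsRegular U V) {x : E} (hx : x ∈ effDom A.p) {c : ℝ}
    (h : ∀ y ∈ effDom A.q, A.value x y ≤ c) : A.maxValue x ≤ c := by
  have := hA.maxH_le hx h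
  rw [← hA.coe_maxValue hx] at this
  exact_mod_cast this

theorem maxH_of_notMem (hA : A.IsRegular U V) {x : E} (hx : x ∉ effDom A.p) :
    maxH A.h A.p A.q x = ⊤ := by
  obtain ⟨y, hy⟩ := hA.hq.nonempty_dom
  rw [eq_top_iff, ← hA.objH_of_notMem_left hx hy]
  exact le_iSup (fun y => objH A.h A.p A.q x y) y

theorem le_optH (hA : A.IsRegular U V) {c : ℝ} (h : ∀ x ∈ effDom A.p, c ≤ A.maxValue x) :
    (c : EReal) ≤ optH A.h A.p A.q := by
  refine le_iInf fun x => ?_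
  by_cases hx : x ∈ effDom A.p
  · rw [← hA.coe_maxValue hx]; exact_mod_cast h x hx
  · rw [hA.maxH_of_notMem hx]; exact le_top

theorem coe_optH (hA : A.IsRegular U V) :
    ((optH A.h A.p A.q).toReal : EReal) = optH A.h A.p A.q := by
  obtain ⟨x, hx⟩ := hA.hp.nonempty_dom
  obtain ⟨y, hy⟩ := hA.hq.nonempty_dom
  obtain ⟨m, hm⟩ := hA.exists_le_value hy
  refine EReal.coe_toReal (ne_top_of_le_ne_top (EReal.coe_ne_top (A.maxValue x)) ?_)
    (ne_bot_of_le_ne_bot (EReal.coe_ne_bot m)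
      (hA.le_optH fun x hx => (hm x hx).trans (hA.value_le_maxValue hx hy)))
  rw [hA.coe_maxValue hx]
  exact iInf_le _ x

theorem optH_le (hA : A.IsRegular U V) {x : E} (hx : x ∈ effDom A.p) :
    (optH A.h A.p A.q).toReal ≤ A.maxValue x := by
  have : optH A.h A.p A.q ≤ maxH A.h A.p A.q x := iInf_le _ x
  rw [← hA.coe_optH, ← hA.coe_maxValue hx] at this
  exact_mod_cast this

theorem le_toReal_optH (hA : A.IsRegular U V) {c : ℝ} (h : ∀ x ∈ effDom A.p, c ≤ A.maxValue x) :
    c ≤ (optH A.h A.p A.q).toReal := by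
  have := hA.le_optH h
  rw [← hA.coe_optH] at this
  exact_mod_cast this

theorem lowH_le (hA : A.IsRegular U V) (hlow : lowH A.h A.p A.q ≠ ⊥) {x : E} {y : F}
    (hx : x ∈ effDom A.p) (hy : y ∈ effDom A.q) : (lowH A.h A.p A.q).toReal ≤ A.value x y := by
  have h : lowH A.h A.p A.q ≤ A.value x y := by
    rw [← hA.objH_eq hx hy]
    exact iInf₂_le_of_le x hx (iInf₂_le y hy)
  rw [← EReal.coe_toReal (ne_top_of_le_ne_top (EReal.coe_ne_top _) h) hlow] at h
  exact_mod_cast h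

/-! ### Descent and stationarity -/

/-- The proximal term vanishes at `x`, so `H(x, y')` bounds the payoff at `(x', y')` up to `‖s‖² /
(2L)` by strong convexity; strong concavity bounds `max_y` of the payoff at `x'` up to `‖r‖² /
(2σ_y)`. Removing the proximal term at `x'` leaves the gain `L‖x' - x‖²`. -/
theorem descent (hA : A.IsRegular U V) {k : ℕ} {x x' : E} {y' : F} (hx : x ∈ effDom A.p)
    (h : (A.call k x).IsApproxSaddle x' y') :
    A.maxValue x' + A.L * ‖x' - x‖ ^ 2 ≤
      A.maxValue x + (A.eps0 / ((k : ℝ) + 1)) ^ 2 * (A.L⁻¹ + (A.sy ^ 2)⁻¹ * A.L) := by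
  obtain ⟨b, c, hb, hc, htol⟩ := h
  have hL := hA.hL
  have hsy := hA.hsy
  have hD := hA.inner_isRegular k x
  have htol_eq : (A.call k x).tol = A.eps0 / ((k : ℝ) + 1) := rfl
  rw [htol_eq] at htol
  set D := A.call k x with hD_def
  have hDL : D.sx = A.L := rfl
  have hDs : D.sy = A.sy := rfl
  set τ := (A.eps0 / ((k : ℝ) + 1)) ^ 2 with hτ
  set s := D.gx x' y' + b with hs
  set r := c - D.gy x' y' with hr
  have h1 : D.payoff x' y' - ‖s‖ ^ 2 / (2 * A.L) ≤ A.maxValue x := by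
    have g1 := hD.convex_left x' hb.1 x hx y' hc.1
    have g2 := hb.2 x hx
    have g3 := hA.value_le_maxValue hx hc.1
    have g4 : D.payoff x y' = A.value x y' := by
      rw [hD_def, payoff_call]; simp
    rw [hDL] at g1
    have g5 : D.payoff x' y' + inner ℝ s (x - x') + A.L / 2 * ‖x - x'‖ ^ 2 ≤ D.payoff x y' := by
      unfold InnerData.payoff
      rw [hs, inner_add_left]
      linarith
    have g6 := neg_le_of_abs_le (abs_real_inner_le_norm s (x - x'))
    have g7 : ‖s‖ * ‖x - x'‖ ≤ ‖s‖ ^ 2 / (2 * A.L) + A.L / 2 * ‖x - x'‖ ^ 2 := by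
      have : 0 ≤ (‖s‖ - A.L * ‖x - x'‖) ^ 2 / (2 * A.L) := by positivity
      have e : (‖s‖ - A.L * ‖x - x'‖) ^ 2 / (2 * A.L) =
          ‖s‖ ^ 2 / (2 * A.L) + A.L / 2 * ‖x - x'‖ ^ 2 - ‖s‖ * ‖x - x'‖ := by
        field_simp; ring
      linarith
    linarith
  have h2 : ∀ y ∈ effDom A.q, D.payoff x' y ≤ D.payoff x' y' + ‖r‖ ^ 2 / (2 * A.sy) := by
    intro y hy
    have g1 := hD.concave_right x' hb.1 y' hc.1 y hy
    have g2 := hc.2 y hy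
    rw [hDs] at g1
    have g5 : D.payoff x' y ≤ D.payoff x' y' - inner ℝ r (y - y') - A.sy / 2 * ‖y - y'‖ ^ 2 := by
      unfold InnerData.payoff
      rw [hr, inner_sub_left]
      linarith
    have g6 := neg_le_of_abs_le (abs_real_inner_le_norm r (y - y'))
    have g7 : ‖r‖ * ‖y - y'‖ ≤ ‖r‖ ^ 2 / (2 * A.sy) + A.sy / 2 * ‖y - y'‖ ^ 2 := by
      have : 0 ≤ (‖r‖ - A.sy * ‖y - y'‖) ^ 2 / (2 * A.sy) := by positivity
      have e : (‖r‖ - A.sy * ‖y - y'‖) ^ 2 / (2 * A.sy) =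
          ‖r‖ ^ 2 / (2 * A.sy) + A.sy / 2 * ‖y - y'‖ ^ 2 - ‖r‖ * ‖y - y'‖ := by
        field_simp; ring
      linarith
    linarith
  -- One constant dominates both `1 / (2L)` and `1 / (2σ_y)`; for the latter, `L⁻¹ + L / σ_y² ≥ 2 /
  -- σ_y` by the arithmetic-geometric mean inequality.
  set cst := A.L⁻¹ + (A.sy ^ 2)⁻¹ * A.L with hcst
  have c1 : 1 / (2 * A.L) ≤ cst := by
    have : 0 ≤ (A.sy ^ 2)⁻¹ * A.L := by positivity
    have e : 1 / (2 * A.L) = A.L⁻¹ / 2 := by field_simp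
    have : 0 < A.L⁻¹ := by positivity
    linarith
  have c2 : 1 / (2 * A.sy) ≤ cst := by
    have e : cst = 2 / A.sy + (A.sy - A.L) ^ 2 / (A.L * A.sy ^ 2) := by
      rw [hcst]; field_simp; ring
    have : 0 ≤ (A.sy - A.L) ^ 2 / (A.L * A.sy ^ 2) := by positivity
    have e2 : 1 / (2 * A.sy) = 2 / A.sy / 4 := by field_simp; norm_num
    have : 0 < 2 / A.sy := by positivity
    linarith
  have h3 : ‖s‖ ^ 2 / (2 * A.L) + ‖r‖ ^ 2 / (2 * A.sy) ≤ τ * cst := by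
    have k1 := mul_le_mul_of_nonneg_right c1 (sq_nonneg ‖s‖)
    have k2 := mul_le_mul_of_nonneg_right c2 (sq_nonneg ‖r‖)
    have k3 := mul_le_mul_of_nonneg_right htol (by positivity : 0 ≤ cst)
    rw [one_div_mul_eq_div] at k1 k2
    linarith
  have h4 : A.maxValue x' ≤ A.maxValue x + τ * cst - A.L * ‖x' - x‖ ^ 2 := by
    refine hA.maxValue_le hb.1 fun y hy => ?_
    have := h2 y hy
    rw [hD_def, payoff_call] at this
    linarith
  linarith

/-- The `x` gradient of the subproblem differs from that of `h` by `2L(x' - x)`, of norm at most `ε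
/ 2`; the tolerance contributes the other half. The `y` gradients agree. -/
theorem isPDStationary (hA : A.IsRegular U V) (heps0 : 0 < A.eps0) (heps : A.eps0 ≤ A.eps / 2)
    {k : ℕ} {x x' : E} {y' : F} (h : (A.call k x).IsApproxSaddle x' y')
    (hx' : ‖x' - x‖ ≤ A.eps / (4 * A.L)) :
    IsPDStationary (objH A.h A.p A.q) A.eps x' y' := by
  obtain ⟨b, c, hb, hc, htol⟩ := h
  have hL := hA.hL
  have htol_le : (A.call k x).tol ≤ A.eps / 2 := by
    refine le_trans ?_ heps
    exact div_le_self heps0.le (by linarith [Nat.cast_nonneg (α := ℝ) k])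
  have htol0 : 0 ≤ (A.call k x).tol := by
    change 0 ≤ A.eps0 / ((k : ℝ) + 1)
    positivity
  have hd := hA.differentiableAt hb.1 hc.1
  set G := gradient A.h (WithLp.toLp 2 (x', y')) with hG
  have ex : (A.call k x).gx x' y' = G.fst + (2 * A.L) • (x' - x) := by
    unfold InnerData.gx
    simp only [call]
    rw [A.gradient_hk x hd]
    rfl
  have ey : (A.call k x).gy x' y' = G.snd := by
    unfold InnerData.gy
    simp only [call]
    rw [A.gradient_hk x hd]
    exact add_zero _
  rw [ex, ey] at htol
  have n1 : ‖G.fst + (2 * A.L) • (x' - x) + b‖ ≤ (A.call k x).tol := by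
    refine (sq_le_sq₀ (norm_nonneg _) htol0).1 ?_
    linarith [sq_nonneg ‖c - G.snd‖]
  have n2 : ‖c - G.snd‖ ≤ (A.call k x).tol := by
    refine (sq_le_sq₀ (norm_nonneg _) htol0).1 ?_
    linarith [sq_nonneg ‖G.fst + (2 * A.L) • (x' - x) + b‖]
  have n3 : ‖G.fst + b‖ ≤ A.eps := by
    have e : G.fst + b = (G.fst + (2 * A.L) • (x' - x) + b) - (2 * A.L) • (x' - x) := by abel
    rw [e]
    refine (norm_sub_le _ _).trans ?_
    rw [norm_smul, Real.norm_of_nonneg (by positivity)]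
    have := mul_le_mul_of_nonneg_left hx' (by positivity : 0 ≤ 2 * A.L)
    have e2 : 2 * A.L * (A.eps / (4 * A.L)) = A.eps / 2 := by field_simp; ring
    linarith
  refine ⟨infEDist_zero_le_of_mem ?_ n3, infEDist_zero_le_of_mem (s := G.snd - c) ?_ ?_⟩
  · refine mem_subdiff_of_hasGradientAt (c := -(A.q y').toReal) hd.hasGradientAt.comp_toLp_left hb
      (fun u hu => ?_) fun u hu => hA.objH_of_notMem_left hu hc.1
    rw [hA.objH_eq hu hc.1]
    rfl
  · change -(G.snd - c) ∈ subdiff (fun u => -objH A.h A.p A.q x' u) y'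
    have hg : HasGradientAt (fun u => -A.h (WithLp.toLp 2 (x', u))) (-G.snd) y' := by
      rw [hasGradientAt_iff_hasFDerivAt, map_neg]
      exact hd.hasGradientAt.comp_toLp_right.hasFDerivAt.neg
    have e : -(G.snd - c) = -G.snd + c := by abel
    rw [e]
    refine mem_subdiff_of_hasGradientAt (p := A.q) (c := -(A.p x').toReal) hg hc (fun u hu => ?_) fun u hu => ?_
    · rw [hA.objH_eq hb.1 hu, ← EReal.coe_neg]
      congr 1
      unfold value
      ring
    · rw [objH_of_notMem_right hu, EReal.neg_bot]
  · rw [norm_sub_rev]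
    linarith

end IsRegular

end OuterData

end Outer

/-! ### Summation over the outer iterations. -/

section Complexity

theorem sum_log_le (k : ℕ) :
    ∑ j ∈ Finset.range (k + 1), Real.log ((j : ℝ) + 1) ≤ k * Real.log ((k : ℝ) + 1) := by
  induction k with
  | zero => simp
  | succ k ih =>
    rw [Finset.sum_range_succ]
    have h : Real.log ((k : ℝ) + 1) ≤ Real.log (((k + 1 : ℕ) : ℝ) + 1) :=
      Real.log_le_log (by positivity) (by push_cast; linarith)
    have h2 := mul_le_mul_of_nonneg_left h (Nat.cast_nonneg (α := ℝ) k)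
    push_cast at *
    linarith

/-- The term `-1 / (k + 1)` makes `errorSum_lt` strict, which the bound on the outer iterations
needs. -/
theorem sum_inv_sq_le (k : ℕ) :
    ∑ j ∈ Finset.range (k + 1), 1 / ((j : ℝ) + 1) ^ 2 ≤ 2 - 1 / ((k : ℝ) + 1) := by
  induction k with
  | zero => norm_num
  | succ k ih =>
    rw [Finset.sum_range_succ]
    have h : 1 / (((k + 1 : ℕ) : ℝ) + 1) ^ 2 ≤ 1 / ((k : ℝ) + 1) - 1 / (((k + 1 : ℕ) : ℝ) + 1) := by
      push_cast
      have hk : (0 : ℝ) ≤ k := Nat.cast_nonneg k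
      rw [div_sub_div _ _ (by positivity) (by positivity), div_le_div_iff₀ (by positivity) (by positivity)]
      nlinarith
    linarith

theorem two_div_alphaHat_le {L sy : ℝ} (hL : 0 < L) (hsy : 0 < sy) :
    2 / alphaHat L sy ≤ max 2 (√(L / (2 * sy))) := by
  unfold alphaHat
  have hq : 0 < √(8 * sy / L) := by positivity
  rcases le_total 1 (√(8 * sy / L)) with h | h
  · rw [min_eq_left h]; simp
  · rw [min_eq_right h]
    refine le_max_of_le_right (le_of_eq ?_)
    rw [div_eq_iff hq.ne', ← Real.sqrt_mul (by positivity)]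
    have e : L / (2 * sy) * (8 * sy / L) = 2 ^ 2 := by field_simp; norm_num
    rw [e, Real.sqrt_sq (by norm_num)]

variable {E F : Type*} [NormedAddCommGroup E] [InnerProductSpace ℝ E] [CompleteSpace E]
  [NormedAddCommGroup F] [InnerProductSpace ℝ F] [CompleteSpace F]

namespace OuterData

variable {A : OuterData E F} {U : Set E} {V : Set F}

/-- With `z = -L x` the quadratic is `(L/2)‖u - x‖²`, dominated by the proximal term `L‖u - x‖²` of
the payoff. -/
theorem isDualBound_start (hA : A.IsRegular U V) {k : ℕ} {x : E} {y : F} {m : ℝ}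
    (hm : ∀ u ∈ effDom A.p, m ≤ A.value u y) :
    (A.call k x).IsDualBound (-(A.L • x)) y (-m) := by
  intro u hu
  have hL := hA.hL
  have h := hm u hu
  have e : -(A.L • x) + (A.call k x).sx • u = A.L • (u - x) := by
    change -(A.L • x) + A.L • u = _
    module
  unfold InnerData.dualValue
  rw [e, payoff_call, norm_smul, mul_pow, Real.norm_eq_abs, sq_abs]
  have e2 : A.L ^ 2 * ‖u - x‖ ^ 2 / (2 * (A.call k x).sx) = A.L / 2 * ‖u - x‖ ^ 2 := by
    change A.L ^ 2 * ‖u - x‖ ^ 2 / (2 * A.L) = _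
    field_simp
  rw [e2]
  have : 0 ≤ A.L / 2 * ‖u - x‖ ^ 2 := by positivity
  linarith

variable (A) in
/-- The bound on the Lyapunov function at the start of a call of the inner method. -/
noncomputable def startBound : ℝ :=
  deltaHat A.L A.sy (Metric.diam (effDom A.p)) (Metric.diam (effDom A.q)) +
    2 * (alphaHat A.L A.sy)⁻¹ * ((optH A.h A.p A.q).toReal - (lowH A.h A.p A.q).toReal +
      A.L * Metric.diam (effDom A.p) ^ 2)

/-- The distance terms are bounded by the diameters. The saddle value minimizes the payoff at `ys`,
hence is at most `max_y H(u, y) + L D_x²` for every `u`, that is, at most `H* + L D_x²`. -/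
theorem lyapunov_start_le (hA : A.IsRegular U V) (k : ℕ) {x : E} {y : F} (hx : x ∈ effDom A.p)
    (hy : y ∈ effDom A.q) {xs : E} {ys : F} (hs : (A.call k x).IsSaddle xs ys) :
    (A.call k x).lyapunov xs ys (-(A.L • x)) y (-(lowH A.h A.p A.q).toReal) ≤ A.startBound := by
  have hL := hA.hL
  have hsy := hA.hsy
  have hD := hA.inner_isRegular k x
  have hα := InnerData.alpha_pos hD
  have hη := InnerData.etaY_pos hD
  set Dx := Metric.diam (effDom A.p) with hDx
  set Dy := Metric.diam (effDom A.q) with hDy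
  have hαe : (A.call k x).alpha = alphaHat A.L A.sy := rfl
  have dx : ∀ u ∈ effDom A.p, ∀ u' ∈ effDom A.p, ‖u - u'‖ ≤ Dx := fun u hu u' hu' => by
    rw [← dist_eq_norm]; exact Metric.dist_le_diam_of_mem hA.hpc.isBounded hu hu'
  have dy : ‖y - ys‖ ≤ Dy := by
    rw [← dist_eq_norm]; exact Metric.dist_le_diam_of_mem hA.hqc.isBounded hy hs.right.1
  have h1 : ‖-(A.L • x) + (A.call k x).sx • xs‖ ^ 2 / (A.call k x).etaZ ≤ 2 * A.L * Dx ^ 2 := by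
    have e : -(A.L • x) + (A.call k x).sx • xs = A.L • (xs - x) := by
      change -(A.L • x) + A.L • xs = _
      module
    change _ / (A.L / 2) ≤ _
    rw [e, norm_smul, mul_pow, Real.norm_eq_abs, sq_abs]
    have e2 : A.L ^ 2 * ‖xs - x‖ ^ 2 / (A.L / 2) = 2 * A.L * ‖xs - x‖ ^ 2 := by field_simp
    rw [e2]
    have := dx xs hs.left.1 x hx
    gcongr
  have h2 : ‖y - ys‖ ^ 2 / (A.call k x).etaY ≤
      max (2 * A.sy) (alphaHat A.L A.sy * A.L / 4) * Dy ^ 2 := by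
    have hη' : (A.call k x).etaY = min (1 / (2 * A.sy)) (4 / (alphaHat A.L A.sy * A.L)) := rfl
    rw [hαe] at hα
    have h3 : 1 ≤ max (2 * A.sy) (alphaHat A.L A.sy * A.L / 4) * (A.call k x).etaY := by
      rw [hη']
      rcases min_choice (1 / (2 * A.sy)) (4 / (alphaHat A.L A.sy * A.L)) with h | h
      · rw [h]
        calc (1 : ℝ) = 2 * A.sy * (1 / (2 * A.sy)) := by field_simp
          _ ≤ _ := by gcongr; exact le_max_left _ _
      · rw [h]
        calc (1 : ℝ) = alphaHat A.L A.sy * A.L / 4 * (4 / (alphaHat A.L A.sy * A.L)) := by field_simp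
          _ ≤ _ := by gcongr; exact le_max_right _ _
    rw [div_le_iff₀ hη]
    have h4 : ‖y - ys‖ ^ 2 ≤ Dy ^ 2 := by gcongr
    nlinarith [sq_nonneg Dy]
  have h3 : (A.call k x).payoff xs ys ≤ (optH A.h A.p A.q).toReal + A.L * Dx ^ 2 := by
    rw [← sub_le_iff_le_add]
    refine hA.le_toReal_optH fun u hu => ?_
    have g1 := hs.payoff_le hD hu
    have g2 : 0 ≤ (A.call k x).sx / 2 * ‖u - xs‖ ^ 2 := by
      have := hD.sx_pos
      positivity
    rw [payoff_call k x u] at g1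
    have g3 := hA.value_le_maxValue hu hs.right.1
    have g4 : A.L * ‖u - x‖ ^ 2 ≤ A.L * Dx ^ 2 := by
      have := dx u hu x hx
      gcongr
    linarith
  unfold InnerData.lyapunov startBound deltaHat
  rw [hαe] at hα ⊢
  have h4 : 2 / alphaHat A.L A.sy * (-(lowH A.h A.p A.q).toReal + (A.call k x).payoff xs ys) ≤
      2 * (alphaHat A.L A.sy)⁻¹ * ((optH A.h A.p A.q).toReal - (lowH A.h A.p A.q).toReal + A.L * Dx ^ 2) := by
    rw [← div_eq_mul_inv]
    exact mul_le_mul_of_nonneg_left (by linarith) (by positivity)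
  -- The summand `α̂⁻¹ L D_x²` of `δ̂` is not needed.
  have h5 : 0 ≤ (alphaHat A.L A.sy)⁻¹ * A.L * Dx ^ 2 := by positivity
  linarith

variable (A) in
/-- The logarithmic factor of the complexity bound. -/
noncomputable def logFactor : ℝ :=
  max 0 (Real.log (4 * max (1 / (2 * A.L)) (min (1 / (2 * A.sy)) (4 / (alphaHat A.L A.sy * A.L))) *
    A.startBound / (((9 * A.L ^ 2 / min A.L A.sy + 3 * A.L) ^ 2)⁻¹ * A.eps0 ^ 2)))

variable (A) in
/-- The bound on the numbers of oracle calls in the first `k` outer iterations. -/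
noncomputable def callBound (k : ℕ) : ℝ :=
  3397 * (2 / alphaHat A.L A.sy) * (k * (A.logFactor + 1) +
    2 * ∑ j ∈ Finset.range k, Real.log ((j : ℝ) + 1))

theorem Reaches.exists_done_of_start (hA : A.IsRegular U V) (heps0 : 0 < A.eps0)
    (hS : ∀ n, ∀ z ∈ (A.run n).2.grads, z.fst ∈ U ∧ z.snd ∈ V) {k : ℕ} {x : E} {y : F} {N : ℝ}
    (h : A.Reaches (A.start k x y) N) (hx : x ∈ effDom A.p) (hy : y ∈ effDom A.q) :
    ∃ x' y' N', A.Reaches (.running k x y (.done x' y')) N' ∧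
      (A.call k x).IsApproxSaddle x' y' ∧
      (lowH A.h A.p A.q ≠ ⊥ → N ≤ A.callBound k → N' ≤ A.callBound (k + 1)) := by
  have hD := hA.inner_isRegular k x
  obtain ⟨xs, ys, hs⟩ := InnerData.exists_isSaddle hD
  by_cases hlow : lowH A.h A.p A.q = ⊥
  -- Termination does not need `H_low` to be finite: for the current `y`, compactness of `dom p`
  -- bounds `H(·, y)` below. Only the uniform count is lost.
  · obtain ⟨m, hm⟩ := hA.exists_le_value hy
    obtain ⟨x', y', h1, h2⟩ := h.exists_done hD hS hs hy (isDualBound_start hA hm) heps0 le_rfl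
    exact ⟨x', y', _, h1, h2, fun h3 => absurd hlow h3⟩
  · obtain ⟨x', y', h1, h2⟩ := h.exists_done hD hS hs hy
      (isDualBound_start hA fun u hu => hA.lowH_le hlow hu hy) heps0 (lyapunov_start_le hA k hx hy hs)
    refine ⟨x', y', _, h1, h2, fun _ hN => ?_⟩
    have hsx := hA.hL
    have e1 : (A.call k x).zetaBar⁻¹ + (A.call k x).Lbar =
        9 * A.L ^ 2 / min A.L A.sy + 3 * A.L := by
      change (min A.L A.sy / (3 * A.L) ^ 2)⁻¹ + 3 * A.L = _
      rw [inv_div, mul_pow]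
      norm_num
    rw [e1]
    change N + 3397 * (2 / alphaHat A.L A.sy * (A.logFactor + 1 + 2 * Real.log ((k : ℝ) + 1))) ≤ _
    have e2 : A.callBound (k + 1) = A.callBound k +
        3397 * (2 / alphaHat A.L A.sy * (A.logFactor + 1 + 2 * Real.log ((k : ℝ) + 1))) := by
      unfold callBound
      rw [Finset.sum_range_succ]
      push_cast
      ring
    rw [e2]
    linarith

theorem Reaches.outer_step {k : ℕ} {xk x : E} {yk y : F} {N : ℝ}
    (h : A.Reaches (.running k xk yk (.done x y)) N) :
    (‖x - xk‖ ≤ A.eps / (4 * A.L) ∧ A.Reaches (.terminated (k + 1) x y) N) ∨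
      (A.eps / (4 * A.L) < ‖x - xk‖ ∧ A.Reaches (A.start (k + 1) x y) N) := by
  have h1 := h.step (c := 0) (by
    change (Ledger.empty : Ledger E F).AtMost 0
    simp [Ledger.AtMost, Ledger.empty])
  rw [add_zero, OuterData.step] at h1
  by_cases hle : ‖x - xk‖ ≤ A.eps / (4 * A.L)
  · rw [if_pos hle] at h1; exact Or.inl ⟨hle, h1⟩
  · rw [if_neg hle] at h1; exact Or.inr ⟨not_le.1 hle, h1⟩

variable (A) in
/-- The total descent error of the first `k` outer iterations. -/
noncomputable def errorSum (k : ℕ) : ℝ :=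
  ∑ j ∈ Finset.range k, (A.eps0 / ((j : ℝ) + 1)) ^ 2 * (A.L⁻¹ + (A.sy ^ 2)⁻¹ * A.L)

theorem errorSum_lt (hA : A.IsRegular U V) (heps0 : 0 < A.eps0) (k : ℕ) :
    A.errorSum (k + 1) < 2 * A.eps0 ^ 2 * (A.L⁻¹ + (A.sy ^ 2)⁻¹ * A.L) := by
  have hL := hA.hL
  have hsy := hA.hsy
  have e : A.errorSum (k + 1) = A.eps0 ^ 2 * (A.L⁻¹ + (A.sy ^ 2)⁻¹ * A.L) *
      ∑ j ∈ Finset.range (k + 1), 1 / ((j : ℝ) + 1) ^ 2 := by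
    unfold errorSum
    rw [Finset.mul_sum]
    refine Finset.sum_congr rfl fun j _ => ?_
    rw [div_pow]
    ring
  have h1 := sum_inv_sq_le k
  have h2 : 0 < 1 / ((k : ℝ) + 1) := by positivity
  have h3 : 0 < A.eps0 ^ 2 * (A.L⁻¹ + (A.sy ^ 2)⁻¹ * A.L) := by positivity
  rw [e]
  nlinarith

/-- After `k` outer iterations the method has terminated, or is about to start the next one after
sufficient decrease of `max_y H`. -/
theorem terminated_or_start (hA : A.IsRegular U V) (heps : 0 < A.eps) (heps0 : 0 < A.eps0)
    (heps0' : A.eps0 ≤ A.eps / 2) (hx0 : A.x0 ∈ effDom A.p) (hy0 : A.y0 ∈ effDom A.q)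
    (hS : ∀ n, ∀ z ∈ (A.run n).2.grads, z.fst ∈ U ∧ z.snd ∈ V) (k : ℕ) :
    (∃ i < k, ∃ x y N, A.Reaches (.terminated (i + 1) x y) N ∧
        IsPDStationary (objH A.h A.p A.q) A.eps x y ∧ x ∈ effDom A.p ∧
        A.maxValue x ≤ A.maxValue A.x0 + A.errorSum (i + 1) ∧
        (lowH A.h A.p A.q ≠ ⊥ → N ≤ A.callBound (i + 1))) ∨
      ∃ x y N, A.Reaches (A.start k x y) N ∧ x ∈ effDom A.p ∧ y ∈ effDom A.q ∧
        A.maxValue x + k * (A.L * (A.eps / (4 * A.L)) ^ 2) ≤ A.maxValue A.x0 + A.errorSum k ∧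
        (lowH A.h A.p A.q ≠ ⊥ → N ≤ A.callBound k) := by
  have hL := hA.hL
  induction k with
  | zero =>
    refine Or.inr ⟨A.x0, A.y0, 0, ⟨0, rfl, ?_⟩, hx0, hy0, ?_, fun _ => ?_⟩
    · change (Ledger.empty : Ledger E F).AtMost 0
      simp [Ledger.AtMost, Ledger.empty]
    · simp [errorSum]
    · simp [callBound]
  | succ k ih =>
    rcases ih with ⟨i, hi, h⟩ | ⟨x, y, N, h1, hx, hy, h2, h3⟩
    · exact Or.inl ⟨i, by lia, h⟩
    obtain ⟨x', y', N', g1, g2, g3⟩ := h1.exists_done_of_start hA heps0 hS hx hy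
    have hdesc := hA.descent hx g2
    have hx' : x' ∈ effDom A.p := by obtain ⟨b, c, hb, -⟩ := g2; exact hb.1
    have hy' : y' ∈ effDom A.q := by obtain ⟨b, c, -, hc, -⟩ := g2; exact hc.1
    have herr : A.errorSum (k + 1) = A.errorSum k +
        (A.eps0 / ((k : ℝ) + 1)) ^ 2 * (A.L⁻¹ + (A.sy ^ 2)⁻¹ * A.L) := Finset.sum_range_succ _ _
    have h0 : 0 ≤ (k : ℝ) * (A.L * (A.eps / (4 * A.L)) ^ 2) := by positivity
    rcases g1.outer_step with ⟨hle, hr⟩ | ⟨hlt, hr⟩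
    · refine Or.inl ⟨k, k.lt_succ_self, x', y', N', hr,
        hA.isPDStationary heps0 heps0' g2 hle, hx', ?_, fun hl => g3 hl (h3 hl)⟩
      have : 0 ≤ A.L * ‖x' - x‖ ^ 2 := by positivity
      linarith
    · refine Or.inr ⟨x', y', N', hr, hx', hy', ?_, fun hl => g3 hl (h3 hl)⟩
      -- An iteration that does not stop moves by more than `ε / (4L)` and so gains at least `ε² /
      -- (16L)`.
      have : A.L * (A.eps / (4 * A.L)) ^ 2 ≤ A.L * ‖x' - x‖ ^ 2 := by gcongr
      push_cast
      linarith

end OuterData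

end Complexity

theorem theorem1 (n m : ℕ)
    (h : WithLp 2 (EuclideanSpace ℝ (Fin n) × EuclideanSpace ℝ (Fin m)) → ℝ)
    (p : EuclideanSpace ℝ (Fin n) → EReal) (q : EuclideanSpace ℝ (Fin m) → EReal)
    (L sy eps eps0 : ℝ)
    (x0 : EuclideanSpace ℝ (Fin n)) (y0 : EuclideanSpace ℝ (Fin m))
    (U : Set (EuclideanSpace ℝ (Fin n))) (V : Set (EuclideanSpace ℝ (Fin m)))
    -- `p`, `q` are proper closed convex with compact domains
    (hp : IsProperClosedConvex p) (hq : IsProperClosedConvex q)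
    (hpc : IsCompact (effDom p)) (hqc : IsCompact (effDom q))
    -- `h` is `L`-smooth on `U × V ⊇ dom p × dom q` and strongly concave in `y ∈ V`
    (hL : 0 < L) (hsy : 0 < sy)
    (hU : effDom p ⊆ U) (hV : effDom q ⊆ V)
    (hsmooth : SmoothOn h L {z | z.fst ∈ U ∧ z.snd ∈ V})
    (hconc : ∀ x ∈ effDom p, StrongConcaveOn V sy fun y => h (WithLp.toLp 2 (x, y)))
    -- the input of the algorithm
    (heps : 0 < eps) (heps0 : 0 < eps0) (heps0' : eps0 ≤ eps / 2)
    (hx0 : x0 ∈ effDom p) (hy0 : y0 ∈ effDom q)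
    -- the algorithm evaluates `∇h` in the region `U × V` only (no condition if `U`, `V` are the
    -- whole spaces)
    (hquery : ∀ k, ∀ z ∈ ((OuterData.mk h p q L sy eps eps0 x0 y0).run k).2.grads,
      z.fst ∈ U ∧ z.snd ∈ V) :
    ∃ (k iters : ℕ) (xe : EuclideanSpace ℝ (Fin n)) (ye : EuclideanSpace ℝ (Fin m)),
      -- the algorithm terminates with output `(xe, ye)` after `iters` outer iterations
      ((OuterData.mk h p q L sy eps eps0 x0 y0).run k).1 = OuterState.terminated iters xe ye ∧
      iters ≤ THat L sy eps eps0 (maxH h p q x0).toReal (optH h p q).toReal + 1 ∧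
      IsPDStationary (objH h p q) eps xe ye ∧
      maxH h p q xe ≤
        maxH h p q x0 + ((2 * eps0 ^ 2 * (L⁻¹ + (sy ^ 2)⁻¹ * L) : ℝ) : EReal) ∧
      -- the numbers of evaluations of `∇h` and of the two proximal operators
      (lowH h p q ≠ ⊥ →
        ((OuterData.mk h p q L sy eps eps0 x0 y0).run k).2.AtMost
          (NHat L sy eps0 (Metric.diam (effDom p)) (Metric.diam (effDom q))
            (optH h p q).toReal (lowH h p q).toReal
            (THat L sy eps eps0 (maxH h p q x0).toReal (optH h p q).toReal))) := by
  set A := OuterData.mk h p q L sy eps eps0 x0 y0 with hA_def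
  have hA : A.IsRegular U V := ⟨hp, hq, hpc, hqc, hL, hsy, hU, hV, hsmooth, hconc⟩
  set T := THat L sy eps eps0 (maxH h p q x0).toReal (optH h p q).toReal with hT
  have hlast : ∃ i < T + 1, ∃ x y N, A.Reaches (.terminated (i + 1) x y) N ∧
      IsPDStationary (objH h p q) eps x y ∧ x ∈ effDom p ∧
      A.maxValue x ≤ A.maxValue x0 + A.errorSum (i + 1) ∧
      (lowH h p q ≠ ⊥ → N ≤ A.callBound (i + 1)) := by
    rcases OuterData.terminated_or_start hA heps heps0 heps0' hx0 hy0 hquery (T + 1) with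
      hterm | ⟨x, y, N, -, hx, -, hdec, -⟩
    · exact hterm
    exfalso
    have h1 := hA.optH_le hx
    have h2 := OuterData.errorSum_lt hA heps0 T
    have h3 : 16 * ((maxH h p q x0).toReal - (optH h p q).toReal) * L / eps ^ 2 +
        32 * eps0 ^ 2 * (1 + L ^ 2 / sy ^ 2) / eps ^ 2 - 1 ≤ T := Nat.le_ceil _
    -- Multiplied by the gain `ε² / (16L)`, the threshold in `T̂` becomes `max_y H(x̂⁰, y) - H*`
    -- plus the bound on the total error. Hence `T̂ + 1` iterations without stopping would bring
    -- `max_y H` strictly below `H*`.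
    have h4 := mul_le_mul_of_nonneg_right (sub_le_iff_le_add.1 h3)
      (by positivity : 0 ≤ L * (eps / (4 * L)) ^ 2)
    have e : (16 * ((maxH h p q x0).toReal - (optH h p q).toReal) * L / eps ^ 2 +
        32 * eps0 ^ 2 * (1 + L ^ 2 / sy ^ 2) / eps ^ 2) * (L * (eps / (4 * L)) ^ 2) =
        (maxH h p q x0).toReal - (optH h p q).toReal +
          2 * eps0 ^ 2 * (L⁻¹ + (sy ^ 2)⁻¹ * L) := by
      field_simp
      ring
    rw [e] at h4
    push_cast at hdec
    change A.maxValue x + (T + 1) * (L * (eps / (4 * L)) ^ 2) ≤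
      (maxH h p q x0).toReal + A.errorSum (T + 1) at hdec
    change A.errorSum (T + 1) < 2 * eps0 ^ 2 * (L⁻¹ + (sy ^ 2)⁻¹ * L) at h2
    change (optH h p q).toReal ≤ A.maxValue x at h1
    linarith
  obtain ⟨i, hi, xe, ye, N, ⟨k, hk, hled⟩, hstat, hxe, hmax, hN⟩ := hlast
  refine ⟨k, i + 1, xe, ye, hk, by lia, hstat, ?_, fun hlow => ?_⟩
  · have h1 := hA.coe_maxValue hxe
    have h2 := hA.coe_maxValue hx0
    change (A.maxValue xe : EReal) = maxH h p q xe at h1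
    change (A.maxValue x0 : EReal) = maxH h p q x0 at h2
    rw [← h1, ← h2, ← EReal.coe_add, EReal.coe_le_coe_iff]
    exact hmax.trans (add_le_add_right (OuterData.errorSum_lt hA heps0 i).le _)
  · have hle : N ≤ NHat L sy eps0 (Metric.diam (effDom p)) (Metric.diam (effDom q))
        (optH h p q).toReal (lowH h p q).toReal T := by
      refine (hN hlow).trans ?_
      change _ ≤ 3397 * max 2 (√(L / (2 * sy))) * (((T : ℝ) + 1) * A.logFactor +
        (T : ℝ) + 1 + 2 * (T : ℝ) * Real.log ((T : ℝ) + 1))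
      change 3397 * (2 / alphaHat L sy) * (((i + 1 : ℕ) : ℝ) * (A.logFactor + 1) +
        2 * ∑ j ∈ Finset.range (i + 1), Real.log ((j : ℝ) + 1)) ≤ _
      have hlog : 0 ≤ A.logFactor := le_max_left _ _
      have hiT : (i : ℝ) ≤ T := by exact_mod_cast Nat.lt_succ_iff.1 hi
      have h1 := sum_log_le i
      have h2 : (i : ℝ) * Real.log ((i : ℝ) + 1) ≤ T * Real.log ((T : ℝ) + 1) := by
        have : Real.log ((i : ℝ) + 1) ≤ Real.log ((T : ℝ) + 1) :=
          Real.log_le_log (by positivity) (by linarith)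
        have h0 : 0 ≤ Real.log ((i : ℝ) + 1) :=
          Real.log_nonneg (by linarith [Nat.cast_nonneg (α := ℝ) i])
        gcongr
      have h3 : 0 ≤ ∑ j ∈ Finset.range (i + 1), Real.log ((j : ℝ) + 1) :=
        Finset.sum_nonneg fun j _ => Real.log_nonneg (by linarith [Nat.cast_nonneg (α := ℝ) j])
      have h4 := two_div_alphaHat_le hL hsy
      have h5 : ((i + 1 : ℕ) : ℝ) * (A.logFactor + 1) ≤ (T + 1) * (A.logFactor + 1) := by
        push_cast
        gcongr
      refine mul_le_mul (by linarith) (by linarith) (by positivity) (by positivity)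
    exact ⟨hled.1.trans hle, hled.2.1.trans hle, hled.2.2.trans hle⟩
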